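/- Fix an integer $r\ge 1$. For a matroid $M$ on $[n]=\{1,\dots,n\}$ let $\mathcal X\subseteq\{0,1\}^n$ be either the set of incidence vectors of all independent sets of $M$ or the set of incidence vectors of all bases of $M$. In each of these two cases there is an algorithm that, for all $n\ge r$, all matroids $M$ on $[n]$, all matrices $A\in\mathbb R^{r\times n}$ of full row rank $r$ and all convex functions $f:\mathbb R^r\to\mathbb R$, computes an optimal solution of $$\max\{f(Ax):\ x\in\mathcal X\}$$ in $O(n^{2r-1}\log n)$ time, where the implied constant depends only on $r$. Here time is counted on a real random access machine: operations on integer variables (addition, subtraction, comparison), the operations $+,-,\times,/$ and comparisons of real numbers, array accesses, testing whether a subset of $[n]$ is independent in $M$, and evaluating $f$ at a point of $\mathbb R^r$ each cost one unit; $n$ and $A$ are given as input, and $M$ and $f$ are accessible only through these oracles. -/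

import Mathlib

open Filter Asymptotics

/-! A uniform real random access machine (unit cost), written as a small imperative language.

A program is a fixed finite term.  It works on integer variables, real variables, integer arrays
and real arrays, all unbounded in length; the names of variables and arrays are constants of the
program, indices into arrays are values of integer variables.  Integers admit addition, truncated
subtraction and comparison; reals admit the four field operations and comparison.  There is no
rounding and no conversion from reals to integers.  Two further unit-cost instructions query the
oracles: membership of a subset of `[n]` in a family of sets, and the value of a real function
at a point of `ℝ ^ r`. -/

namespace RealRAM

/-- The contents of the memory. -/
structure State where
  /-- integer variables -/
  ivar : ℕ → ℕ
  /-- integer arrays: `iarr a i` is entry `i` of array `a` -/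
  iarr : ℕ → ℕ → ℕ
  /-- real variables -/
  rvar : ℕ → ℝ
  /-- real arrays: `rarr a i` is entry `i` of array `a` -/
  rarr : ℕ → ℕ → ℝ

/-- Elementary instructions.  In the comments `x y z` are integer variables, `u v w` are real
variables, `a` is an array. -/
inductive Instr where
  /-- `x := k` -/
  | iconst (x k : ℕ)
  /-- `x := y + z` -/
  | iadd (x y z : ℕ)
  /-- `x := y - z`, and `x := 0` if `y < z` -/
  | isub (x y z : ℕ)
  /-- `x := 1` if `y < z`, else `x := 0` -/
  | ilt (x y z : ℕ)
  /-- `x := a[y]` -/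
  | iload (x a y : ℕ)
  /-- `a[y] := x` -/
  | istore (a y x : ℕ)
  /-- `u := k` -/
  | rconst (u k : ℕ)
  /-- `u := v + w` -/
  | radd (u v w : ℕ)
  /-- `u := v - w` -/
  | rsub (u v w : ℕ)
  /-- `u := v * w` -/
  | rmul (u v w : ℕ)
  /-- `u := v / w`, and `u := 0` if `w = 0` -/
  | rdiv (u v w : ℕ)
  /-- `x := 1` if `v < w`, else `x := 0` -/
  | rlt (x v w : ℕ)
  /-- `u := a[y]` -/
  | rload (u a y : ℕ)
  /-- `a[y] := u` -/
  | rstore (a y u : ℕ)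
  /-- `x := 1` if the set of all `i` in `[n]` with `a[i] ≠ 0` passes the membership oracle,
  else `x := 0` -/
  | query (x a : ℕ)
  /-- `u := f (a[0], …, a[r - 1])` for the function oracle `f` -/
  | value (u a : ℕ)

/-- Programs. -/
inductive Prog where
  | instr (i : Instr)
  | seq (p q : Prog)
  /-- if `x ≠ 0` then `p` else `q` -/
  | ite (x : ℕ) (p q : Prog)
  /-- while `x ≠ 0` do `p` -/
  | loop (x : ℕ) (p : Prog)

namespace State

def setIvar (s : State) (x k : ℕ) : State :=
  { s with ivar := Function.update s.ivar x k }

def setIarr (s : State) (a i k : ℕ) : State :=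
  { s with iarr := Function.update s.iarr a (Function.update (s.iarr a) i k) }

def setRvar (s : State) (u : ℕ) (c : ℝ) : State :=
  { s with rvar := Function.update s.rvar u c }

def setRarr (s : State) (a i : ℕ) (c : ℝ) : State :=
  { s with rarr := Function.update s.rarr a (Function.update (s.rarr a) i c) }

end State

open Classical in
/-- The effect of one instruction, with membership oracle `mem` and function oracle `f`. -/
noncomputable def Instr.effect {n r : ℕ} (mem : Set (Fin n) → Prop) (f : (Fin r → ℝ) → ℝ)
    (s : State) : Instr → State
  | .iconst x k => s.setIvar x k
  | .iadd x y z => s.setIvar x (s.ivar y + s.ivar z)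
  | .isub x y z => s.setIvar x (s.ivar y - s.ivar z)
  | .ilt x y z => s.setIvar x (if s.ivar y < s.ivar z then 1 else 0)
  | .iload x a y => s.setIvar x (s.iarr a (s.ivar y))
  | .istore a y x => s.setIarr a (s.ivar y) (s.ivar x)
  | .rconst u k => s.setRvar u (k : ℝ)
  | .radd u v w => s.setRvar u (s.rvar v + s.rvar w)
  | .rsub u v w => s.setRvar u (s.rvar v - s.rvar w)
  | .rmul u v w => s.setRvar u (s.rvar v * s.rvar w)
  | .rdiv u v w => s.setRvar u (s.rvar v / s.rvar w)
  | .rlt x v w => s.setIvar x (if s.rvar v < s.rvar w then 1 else 0)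
  | .rload u a y => s.setRvar u (s.rarr a (s.ivar y))
  | .rstore a y u => s.setRarr a (s.ivar y) (s.rvar u)
  | .query x a => s.setIvar x (if mem {i : Fin n | s.iarr a i ≠ 0} then 1 else 0)
  | .value u a => s.setRvar u (f fun i : Fin r => s.rarr a i)

/-- `Exec mem f p s t s'`: the program `p`, started in state `s`, halts after exactly `t` steps in
state `s'`.  Every instruction and every test of a conditional or of a loop is one step. -/
inductive Exec {n r : ℕ} (mem : Set (Fin n) → Prop) (f : (Fin r → ℝ) → ℝ) :
    Prog → State → ℕ → State → Prop where
  | instr (i : Instr) (s : State) : Exec mem f (.instr i) s 1 (i.effect mem f s)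
  | seq {p q : Prog} {s s' s'' : State} {t t' : ℕ} :
      Exec mem f p s t s' → Exec mem f q s' t' s'' → Exec mem f (.seq p q) s (t + t') s''
  | iteTrue {x : ℕ} {p q : Prog} {s s' : State} {t : ℕ} :
      s.ivar x ≠ 0 → Exec mem f p s t s' → Exec mem f (.ite x p q) s (t + 1) s'
  | iteFalse {x : ℕ} {p q : Prog} {s s' : State} {t : ℕ} :
      s.ivar x = 0 → Exec mem f q s t s' → Exec mem f (.ite x p q) s (t + 1) s'
  | loopDone {x : ℕ} {p : Prog} {s : State} :
      s.ivar x = 0 → Exec mem f (.loop x p) s 1 s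
  | loopStep {x : ℕ} {p : Prog} {s s' s'' : State} {t t' : ℕ} :
      s.ivar x ≠ 0 → Exec mem f p s t s' → Exec mem f (.loop x p) s' t' s'' →
      Exec mem f (.loop x p) s (t + t' + 1) s''

/-- Execution is deterministic: the run time and the final state are unique. -/
theorem Exec.unique {n r : ℕ} {mem : Set (Fin n) → Prop} {f : (Fin r → ℝ) → ℝ} {p : Prog}
    {s s₁ s₂ : State} {t₁ t₂ : ℕ} (h₁ : Exec mem f p s t₁ s₁) (h₂ : Exec mem f p s t₂ s₂) :
    t₁ = t₂ ∧ s₁ = s₂ := by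
  induction h₁ generalizing t₂ s₂ with
  | instr i s => cases h₂; exact ⟨rfl, rfl⟩
  | seq _ _ ih ih' =>
    cases h₂ with
    | seq a b =>
      obtain ⟨rfl, rfl⟩ := ih a
      obtain ⟨rfl, rfl⟩ := ih' b
      exact ⟨rfl, rfl⟩
  | iteTrue h _ ih =>
    cases h₂ with
    | iteTrue _ a => obtain ⟨rfl, rfl⟩ := ih a; exact ⟨rfl, rfl⟩
    | iteFalse h' _ => exact absurd h' h
  | iteFalse h _ ih =>
    cases h₂ with
    | iteTrue h' _ => exact absurd h h'
    | iteFalse _ a => obtain ⟨rfl, rfl⟩ := ih a; exact ⟨rfl, rfl⟩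
  | loopDone h =>
    cases h₂ with
    | loopDone _ => exact ⟨rfl, rfl⟩
    | loopStep h' _ _ => exact absurd h h'
  | loopStep h _ _ ih ih' =>
    cases h₂ with
    | loopDone h' => exact absurd h' h
    | loopStep _ a b =>
      obtain ⟨rfl, rfl⟩ := ih a
      obtain ⟨rfl, rfl⟩ := ih' b
      exact ⟨rfl, rfl⟩

/-- The initial state on input `A`: integer variable `0` holds `n`, row `i` of `A` is in real
array `i`, everything else is `0`. -/
noncomputable def inputState {n r : ℕ} (A : Matrix (Fin r) (Fin n) ℝ) : State where
  ivar x := if x = 0 then n else 0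
  iarr _ _ := 0
  rvar _ := 0
  rarr i j := if h : i < r ∧ j < n then A ⟨i, h.1⟩ ⟨j, h.2⟩ else 0

/-- The output: the first `n` entries of real array `0`. -/
def State.output (s : State) (n : ℕ) : Fin n → ℝ := fun j => s.rarr 0 j

end RealRAM

/-- The incidence vector of a subset of `[n]`. -/
noncomputable def incidenceVector {n : ℕ} (S : Set (Fin n)) : Fin n → ℝ :=
  S.indicator fun _ => 1

/-- The set of 0/1 vectors encoding the matroid `M`: incidence vectors of its independent sets. -/
def matroidVectors (n : ℕ) (M : Matroid (Fin n)) : Set (Fin n → ℝ) :=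
  {x | ∃ I : Set (Fin n), M.Indep I ∧ x = incidenceVector I}

/-- The set of 0/1 vectors encoding the bases of the matroid `M`. -/
def baseVectors (n : ℕ) (M : Matroid (Fin n)) : Set (Fin n → ℝ) :=
  {x | ∃ B : Set (Fin n), M.IsBase B ∧ x = incidenceVector B}

/-- Let `feasible n M` be the feasible region attached to a matroid `M` on `[n]`.  There is one
program that, for all `n`, all matroids `M` on `[n]`, all `A` in `ℝ ^ (r × n)` of full row rank and
all convex `f` on `ℝ ^ r`, given `n`, `A`, the independence oracle of `M` and the value oracle of
`f`, outputs an optimal solution of `max {f (A x) : x ∈ feasible n M}`, within a number of steps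
that is `O(g n)`; the bound depends only on `n` (and on `r`). -/
def ConvexMaxSolvableInTime (r : ℕ) (feasible : (n : ℕ) → Matroid (Fin n) → Set (Fin n → ℝ))
    (g : ℕ → ℝ) : Prop :=
  ∃ (P : RealRAM.Prog) (T : ℕ → ℕ),
    (fun n : ℕ => (T n : ℝ)) =O[atTop] g ∧
    ∀ (n : ℕ) (M : Matroid (Fin n)), M.E = Set.univ →
    ∀ A : Matrix (Fin r) (Fin n) ℝ, A.rank = r →
    ∀ f : (Fin r → ℝ) → ℝ, ConvexOn ℝ Set.univ f →
    ∃ (t : ℕ) (s : RealRAM.State),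
      RealRAM.Exec M.Indep f P (RealRAM.inputState A) t s ∧
      t ≤ T n ∧
      s.output n ∈ feasible n M ∧
      ∀ y ∈ feasible n M, f (A.mulVec y) ≤ f (A.mulVec (s.output n))

/-!
Among the points `A x`, `x` feasible, a convex function `f` is largest at a vertex of their convex
hull, so it suffices to maximize `f` over a family of feasible sets that contains a maximizer of
every linear functional `c` on `ℝ ^ r`: a feasible point outside the convex hull of their images
could be separated from it (`le_of_forall_candidate_le`). For a linear functional `c`, a feasible
set with the largest value is found by the greedy algorithm, applied to the elements of `[n]` in
descending order of the values of `c` at the columns of `A` (`sum_le_sum_greedySet`). For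
independent sets, elements of negative value are left out; to this end a zero column is appended to
`A`, and an element is used only if it is ranked above this column. Only the order of the columns
matters, and every order that refines the order by values of `c` will do.

A family of `O(n ^ (2 r - 2))` orders suffices. Let `V` be the set of differences of columns, where
also the unit vectors have been appended as columns. Degenerating `c` as far as possible without
reversing a sign that is positive leads to an extreme ray `δ`: its zeros in `V` span a hyperplane
(`exists_extreme_functional`). Elements of `V` where `c` is positive and `δ` is not are zeros of
`δ`, and on these one continues in the hyperplane. The result is a flag that is spanned by elements
`h 0, …, h (r - 1)` of `V` and has the following property. If `d j` is a functional that vanishes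
on the first `j` of them and is positive on `h j`, then `c v > 0` for `v` in `V` implies that the
sequence of the `d j v` is lexicographically positive, `d (r - 1) v` being the leading entry
(`exists_flag`). The products with the Gram–Schmidt vectors of `h` are such functionals, so sorting
the columns lexicographically by these products refines the order by values of `c`
(`exists_admissible_below`). The vector `h (r - 1)` merely fixes the sign of the leading
functional, whence it may be taken from any set that spans `ℝ ^ r` and is closed under negation;
the differences of the `r + 1` appended columns form such a set, of a size that does not depend on
`n`. The remaining `r - 1` differences are described by `2 r - 2` column indices.

The program runs through all tuples of indices, sorts the columns by merge sort in `O(n log n)`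
steps, applies the greedy algorithm, and keeps the best set found. The sort keys are computed by
programs of constant length from arithmetic expressions. Division by zero gives zero, so that
tuples with linearly dependent differences need no special treatment; they yield some feasible set.

The program analysis uses total correctness triples `Run mem f p s Q` with running times, where all
bookkeeping about untouched memory comes from the set of locations that occur as targets in the
text of a program (`Frame`, `Prog.writes`). Throughout, the memory is laid out as follows.

* Integer variables: `0` holds `n`, `1` the number one, `2` the number `n + 1 + r` of columns, `3`
  the least power of two that is at least `n`, which is the number of indices to be sorted, `4` is
  nonzero once a first candidate has been found, `5` is the condition of counting loops, `9` holds
  zero, `12` is the counter of all counting loops but those of the enumeration, the other ones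
  from `10` to `22` are scratch memory, and those from `100` on hold the tuple of indices.
* Integer arrays: `0` is the list of indices, `1` the target of merging, `2` the characteristic
  function of the current set, and `3` that of the best set so far.
* Real variables: `0` holds the value of the best set so far, and the other ones are scratch
  memory.
* Real arrays: `0, …, r - 1` are the rows of the extended matrix and `r` is the point at which `f`
  is evaluated. In the end the array `0` is overwritten by the result.
-/

namespace RealRAM

/-! ### Total correctness with running times -/

namespace State

variable (s : State) (x y k a i u : ℕ) (c : ℝ)

@[simp] lemma ivar_setIvar : (s.setIvar x k).ivar y = if y = x then k else s.ivar y := by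
  simp [setIvar, Function.update_apply]
@[simp] lemma iarr_setIvar : (s.setIvar x k).iarr = s.iarr := rfl
@[simp] lemma rvar_setIvar : (s.setIvar x k).rvar = s.rvar := rfl
@[simp] lemma rarr_setIvar : (s.setIvar x k).rarr = s.rarr := rfl
@[simp] lemma ivar_setIarr : (s.setIarr a i k).ivar = s.ivar := rfl
@[simp] lemma iarr_setIarr : (s.setIarr a i k).iarr y =
    if y = a then Function.update (s.iarr a) i k else s.iarr y := by
  simp [setIarr, Function.update_apply]
@[simp] lemma ivar_setRvar : (s.setRvar u c).ivar = s.ivar := rfl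
@[simp] lemma iarr_setRvar : (s.setRvar u c).iarr = s.iarr := rfl
@[simp] lemma rvar_setRvar : (s.setRvar u c).rvar y = if y = u then c else s.rvar y := by
  simp [setRvar, Function.update_apply]
@[simp] lemma rarr_setRvar : (s.setRvar u c).rarr = s.rarr := rfl
@[simp] lemma ivar_setRarr : (s.setRarr a i c).ivar = s.ivar := rfl
@[simp] lemma rarr_setRarr : (s.setRarr a i c).rarr y =
    if y = a then Function.update (s.rarr a) i c else s.rarr y := by
  simp [setRarr, Function.update_apply]

end State

variable {n r : ℕ} {mem : Set (Fin n) → Prop} {f : (Fin r → ℝ) → ℝ}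

/-- Total correctness: started in `s`, the program halts, and the number of steps together with
the final state satisfies `Q`. -/
def Run (mem : Set (Fin n) → Prop) (f : (Fin r → ℝ) → ℝ) (p : Prog) (s : State)
    (Q : ℕ → State → Prop) : Prop :=
  ∃ t s', Exec mem f p s t s' ∧ Q t s'

lemma run_instr {i : Instr} {s : State} {Q : ℕ → State → Prop} :
    Run mem f (.instr i) s Q ↔ Q 1 (i.effect mem f s) := by
  constructor
  · rintro ⟨t, s', h, hQ⟩
    cases h
    exact hQ
  · exact fun h => ⟨_, _, .instr _ _, h⟩

lemma run_seq {p q : Prog} {s : State} {Q : ℕ → State → Prop} :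
    Run mem f (.seq p q) s Q ↔
      Run mem f p s fun t s' => Run mem f q s' fun t' s'' => Q (t + t') s'' := by
  constructor
  · rintro ⟨t, s', h, hQ⟩
    cases h with
    | seq h₁ h₂ => exact ⟨_, _, h₁, _, _, h₂, hQ⟩
  · rintro ⟨t, s', h₁, t', s'', h₂, hQ⟩
    exact ⟨_, _, .seq h₁ h₂, hQ⟩

lemma run_ite {x : ℕ} {p q : Prog} {s : State} {Q : ℕ → State → Prop} :
    Run mem f (.ite x p q) s Q ↔
      if s.ivar x = 0 then Run mem f q s fun t => Q (t + 1)
      else Run mem f p s fun t => Q (t + 1) := by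
  split_ifs with hx
  · constructor
    · rintro ⟨t, s', h, hQ⟩
      cases h with
      | iteTrue h' _ => exact absurd hx h'
      | iteFalse _ h => exact ⟨_, _, h, hQ⟩
    · rintro ⟨t, s', h, hQ⟩
      exact ⟨_, _, .iteFalse hx h, hQ⟩
  · constructor
    · rintro ⟨t, s', h, hQ⟩
      cases h with
      | iteTrue _ h => exact ⟨_, _, h, hQ⟩
      | iteFalse h' _ => exact absurd h' hx
    · rintro ⟨t, s', h, hQ⟩
      exact ⟨_, _, .iteTrue hx h, hQ⟩

/-- The rule for loops.  In the invariant, `I k s` describes a state from which exactly `k` more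
rounds follow. -/
lemma Run.loop {x : ℕ} {p : Prog} {T : ℕ} {Q : State → Prop} (I : ℕ → State → Prop)
    (hstep : ∀ k s, I (k + 1) s → s.ivar x ≠ 0 ∧ Run mem f p s fun t s' => t ≤ T ∧ I k s')
    (hdone : ∀ s, I 0 s → s.ivar x = 0 ∧ Q s) (k : ℕ) {s : State} (hs : I k s) :
    Run mem f (.loop x p) s fun t s' => t ≤ k * (T + 1) + 1 ∧ Q s' := by
  induction k generalizing s with
  | zero => exact ⟨1, s, .loopDone (hdone s hs).1, by simp, (hdone s hs).2⟩
  | succ k ih =>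
    obtain ⟨hx, t, s', h, ht, hI⟩ := hstep k s hs
    obtain ⟨t', s'', h', ht', hQ⟩ := ih hI
    exact ⟨_, _, .loopStep hx h h', by linarith [add_one_mul k (T + 1)], hQ⟩

/-! ### What a program leaves unchanged -/

/-- The parts of the memory: one part for each variable and for each array. -/
inductive Loc where
  | ivar (x : ℕ)
  | iarr (a : ℕ)
  | rvar (u : ℕ)
  | rarr (a : ℕ)

/-- The part of the memory that an instruction writes to. -/
def Instr.target : Instr → Loc
  | .iconst x _ | .iadd x _ _ | .isub x _ _ | .ilt x _ _ | .iload x _ _ | .rlt x _ _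
  | .query x _ => .ivar x
  | .istore a _ _ => .iarr a
  | .rconst u _ | .radd u _ _ | .rsub u _ _ | .rmul u _ _ | .rdiv u _ _ | .rload u _ _
  | .value u _ => .rvar u
  | .rstore a _ _ => .rarr a

/-- The parts of the memory that a program may write to, read off from its text. -/
def Prog.writes : Prog → Set Loc
  | .instr i => {i.target}
  | .seq p q => p.writes ∪ q.writes
  | .ite _ p q => p.writes ∪ q.writes
  | .loop _ p => p.writes

/-- Two states agree on a part of the memory. -/
def Loc.Same (s s' : State) : Loc → Prop
  | .ivar x => s'.ivar x = s.ivar x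
  | .iarr a => s'.iarr a = s.iarr a
  | .rvar u => s'.rvar u = s.rvar u
  | .rarr a => s'.rarr a = s.rarr a

/-- The states `s` and `s'` agree outside the parts of the memory that `p` may write to. -/
def Frame (p : Prog) (s s' : State) : Prop :=
  ∀ l ∉ p.writes, l.Same s s'

namespace Frame

variable {p : Prog} {s s' s'' : State}

lemma ivar (h : Frame p s s') {x : ℕ} (hx : Loc.ivar x ∉ p.writes) : s'.ivar x = s.ivar x := h _ hx
lemma iarr (h : Frame p s s') {a : ℕ} (ha : Loc.iarr a ∉ p.writes) : s'.iarr a = s.iarr a := h _ ha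
lemma rvar (h : Frame p s s') {u : ℕ} (hu : Loc.rvar u ∉ p.writes) : s'.rvar u = s.rvar u := h _ hu
lemma rarr (h : Frame p s s') {a : ℕ} (ha : Loc.rarr a ∉ p.writes) : s'.rarr a = s.rarr a := h _ ha

lemma refl (p : Prog) (s : State) : Frame p s s := fun l _ => by cases l <;> rfl

lemma trans (h : Frame p s s') (h' : Frame p s' s'') : Frame p s s'' := fun l hl => by
  have h₁ := h l hl
  have h₂ := h' l hl
  cases l <;> exact Eq.trans h₂ h₁

lemma mono {q : Prog} (h : Frame p s s') (hpq : p.writes ⊆ q.writes) : Frame q s s' :=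
  fun l hl => h l fun h' => hl (hpq h')

end Frame

lemma Instr.frame (i : Instr) (s : State) : Frame (.instr i) s (i.effect mem f s) := by
  rintro l hl
  cases i <;> cases l <;>
    simp_all [Instr.effect, Prog.writes, Instr.target, Loc.Same, State.setIvar, State.setIarr,
      State.setRvar, State.setRarr]

lemma Exec.frame {p : Prog} {s s' : State} {t : ℕ} (h : Exec mem f p s t s') : Frame p s s' := by
  induction h with
  | instr i s => exact i.frame s
  | seq _ _ ih ih' =>
    exact (ih.mono Set.subset_union_left).trans (ih'.mono Set.subset_union_right)
  | iteTrue _ _ ih => exact ih.mono Set.subset_union_left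
  | iteFalse _ _ ih => exact ih.mono Set.subset_union_right
  | loopDone _ => exact Frame.refl _ _
  | loopStep _ _ _ ih ih' => exact Frame.trans (fun l hl => ih l hl) ih'

/-- Consequence rule.  The new postcondition may use that the program has changed nothing outside
the parts of the memory it may write to. -/
lemma Run.imp {p : Prog} {s : State} {Q Q' : ℕ → State → Prop} (h : Run mem f p s Q)
    (hQ : ∀ t s', Frame p s s' → Q t s' → Q' t s') : Run mem f p s Q' := by
  obtain ⟨t, s', h, hq⟩ := h
  exact ⟨t, s', h, hQ t s' h.frame hq⟩

/-! ### Counting loops -/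

/-- `while i < b do (body; i := i + 1)`.  The integer variable `1` has to hold the number `1`, and
variable `5` is used for the loop condition; the body may overwrite it, as it is recomputed before
each test.  Assigning a constant to variable `5` thus serves as an empty statement. -/
def forLoop (i b : ℕ) (body : Prog) : Prog :=
  .seq (.instr (.ilt 5 i b))
    (.loop 5 (.seq body (.seq (.instr (.iadd i i 1)) (.instr (.ilt 5 i b)))))

lemma writes_forLoop (i b : ℕ) (body : Prog) :
    (forLoop i b body).writes = body.writes ∪ {.ivar i, .ivar 5} := by
  ext l
  simp only [forLoop, Prog.writes, Instr.target, Set.mem_union, Set.mem_singleton_iff,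
    Set.mem_insert_iff]
  tauto

lemma Run.forLoop {i b : ℕ} {body : Prog} {s : State} {T : ℕ} (I : ℕ → State → Prop)
    (h1 : s.ivar 1 = 1) (hle : s.ivar i ≤ s.ivar b)
    (hib : i ≠ b ∧ i ≠ 1 ∧ i ≠ 5 ∧ b ≠ 5)
    (hw : Loc.ivar i ∉ body.writes ∧ Loc.ivar b ∉ body.writes ∧ Loc.ivar 1 ∉ body.writes)
    (h0 : ∀ v, I (s.ivar i) (s.setIvar 5 v))
    (hstep : ∀ k s', s.ivar i ≤ k → k < s.ivar b → Frame (forLoop i b body) s s' →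
      s'.ivar i = k → I k s' →
      Run mem f body s' fun t s'' =>
        t ≤ T ∧ ∀ v, I (k + 1) ((s''.setIvar i (k + 1)).setIvar 5 v)) :
    Run mem f (forLoop i b body) s fun t s' =>
      t ≤ (s.ivar b - s.ivar i) * (T + 3) + 2 ∧ I (s.ivar b) s' := by
  obtain ⟨hib, hi1, hi5, hb5⟩ := hib
  obtain ⟨hwi, hwb, hw1⟩ := hw
  -- with `k` rounds to go, the counter is `b - k`
  let J : ℕ → State → Prop := fun k s' =>
    Frame (RealRAM.forLoop i b body) s s' ∧ s'.ivar i + k = s.ivar b ∧ s.ivar i ≤ s'.ivar i ∧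
      s'.ivar 5 = (if s'.ivar i < s.ivar b then 1 else 0) ∧ I (s'.ivar i) s'
  have hframe : ∀ s', Frame (RealRAM.forLoop i b body) s s' →
      s'.ivar b = s.ivar b ∧ s'.ivar 1 = 1 := by
    intro s' hs'
    refine ⟨hs'.ivar ?_, (hs'.ivar ?_).trans h1⟩ <;> simp [writes_forLoop] <;> tauto
  unfold RealRAM.forLoop
  rw [run_seq, run_instr]
  refine Run.imp (Run.loop (T := T + 2) (Q := fun s' => I (s.ivar b) s') J ?_ ?_
    (s.ivar b - s.ivar i) ?_) ?_
  · rintro k s' ⟨hf, hk, hle', h5, hI⟩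
    have hlt : s'.ivar i < s.ivar b := by omega
    refine ⟨by simp [h5, hlt], ?_⟩
    rw [run_seq]
    refine (hstep _ s' hle' hlt hf rfl hI).imp ?_
    rintro t s'' hf' ⟨ht, hI'⟩
    have hi' : s''.ivar i = s'.ivar i := hf'.ivar hwi
    have hF : Frame (RealRAM.forLoop i b body) s s'' :=
      hf.trans (hf'.mono (by rw [writes_forLoop]; exact Set.subset_union_left))
    obtain ⟨hb'', h1''⟩ := hframe s'' hF
    rw [run_seq, run_instr, run_instr]
    simp only [Instr.effect, State.ivar_setIvar, hi', h1'', hb'', if_true, if_neg hib.symm,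
      J, if_neg hi5]
    refine ⟨by omega, ?_, by omega, by omega, by trivial, by simpa using hI' _⟩
    refine hF.trans ?_
    intro l hl
    cases l <;> simp_all [Loc.Same, writes_forLoop]
  · rintro s' ⟨hf, hk, hle', h5, hI⟩
    have hk' : s'.ivar i = s.ivar b := by simpa using hk
    rw [hk'] at h5 hI
    exact ⟨by simpa using h5, hI⟩
  · simp only [J, Instr.effect, State.ivar_setIvar, if_neg hi5, if_true]
    refine ⟨?_, by omega, le_rfl, trivial, h0 _⟩
    intro l hl
    cases l <;> simp_all [Loc.Same, writes_forLoop]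
  · rintro t s' - ⟨ht, hI⟩
    exact ⟨by linarith, hI⟩

/-! ### Arithmetic expressions -/

/-- Arithmetic expressions in the entries of the real arrays. -/
inductive Expr where
  /-- the entry of the real array `a` whose index is the value of the integer variable `x` -/
  | load (a x : ℕ)
  | zero
  | add (e e' : Expr)
  | sub (e e' : Expr)
  | mul (e e' : Expr)
  | div (e e' : Expr)

namespace Expr

/-- The value of an expression. -/
noncomputable def eval (s : State) : Expr → ℝ
  | load a x => s.rarr a (s.ivar x)
  | zero => 0
  | add e e' => e.eval s + e'.eval s
  | sub e e' => e.eval s - e'.eval s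
  | mul e e' => e.eval s * e'.eval s
  | div e e' => e.eval s / e'.eval s

/-- The program that computes the value of an expression in the real variable `d`, with the real
variables from `d` on as a stack. -/
def code (d : ℕ) : Expr → Prog
  | load a x => .instr (.rload d a x)
  | zero => .instr (.rconst d 0)
  | add e e' => .seq (e.code d) (.seq (e'.code (d + 1)) (.instr (.radd d d (d + 1))))
  | sub e e' => .seq (e.code d) (.seq (e'.code (d + 1)) (.instr (.rsub d d (d + 1))))
  | mul e e' => .seq (e.code d) (.seq (e'.code (d + 1)) (.instr (.rmul d d (d + 1))))
  | div e e' => .seq (e.code d) (.seq (e'.code (d + 1)) (.instr (.rdiv d d (d + 1))))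

/-- The running time of `Expr.code`. -/
def cost : Expr → ℕ
  | load _ _ | zero => 1
  | add e e' | sub e e' | mul e e' | div e e' => e.cost + e'.cost + 1

lemma writes_code (e : Expr) (d : ℕ) : (e.code d).writes ⊆ Loc.rvar '' Set.Ici d := by
  have hsub (d : ℕ) : Loc.rvar '' Set.Ici (d + 1) ⊆ Loc.rvar '' Set.Ici d :=
    Set.image_mono fun x (hx : d + 1 ≤ x) => (by simp; omega)
  induction e generalizing d with
  | load a x => simp [code, Prog.writes, Instr.target]
  | zero => simp [code, Prog.writes, Instr.target]
  | add e e' ih ih' | sub e e' ih ih' | mul e e' ih ih' | div e e' ih ih' =>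
    simp only [code, Prog.writes, Instr.target, Set.union_subset_iff, Set.singleton_subset_iff]
    exact ⟨ih d, (ih' _).trans (hsub d), d, Set.self_mem_Ici, rfl⟩

lemma eval_congr {s s' : State} (e : Expr) (hi : s'.ivar = s.ivar) (hr : s'.rarr = s.rarr) :
    e.eval s' = e.eval s := by
  induction e <;> simp_all [eval]

lemma frame_code {e : Expr} {d : ℕ} {s s' : State} (h : Frame (e.code d) s s') :
    s'.ivar = s.ivar ∧ s'.iarr = s.iarr ∧ s'.rarr = s.rarr ∧ ∀ u < d, s'.rvar u = s.rvar u := by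
  refine ⟨funext fun x => h.ivar fun hx => ?_, funext fun x => h.iarr fun hx => ?_,
    funext fun x => h.rarr fun hx => ?_, fun u hu => h.rvar fun hx => ?_⟩
  all_goals
    obtain ⟨y, hy, hy'⟩ := e.writes_code d hx
    cases hy'
  exact absurd hu (not_lt.2 hy)

lemma run_code (e : Expr) (d : ℕ) (s : State) :
    Run mem f (e.code d) s fun t s' => t = e.cost ∧ s'.rvar d = e.eval s := by
  induction e generalizing d s with
  | load a x => simp [code, run_instr, Instr.effect, cost, eval]
  | zero => simp [code, run_instr, Instr.effect, cost, eval]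
  | add e e' ih ih' | sub e e' ih ih' | mul e e' ih ih' | div e e' ih ih' =>
    simp only [code, run_seq, run_instr, Instr.effect]
    refine (ih d s).imp ?_
    rintro t s' hf ⟨rfl, hs'⟩
    refine (ih' (d + 1) s').imp ?_
    rintro t' s'' hf' ⟨rfl, hs''⟩
    obtain ⟨hi, -, hr, -⟩ := frame_code hf
    obtain ⟨-, -, -, hd⟩ := frame_code hf'
    rw [eval_congr e' hi hr] at hs''
    simp [cost, eval, hs'', hd d (by omega), hs']
    omega

end Expr

end RealRAM

/-! ### Gram–Schmidt residuals -/

section Residual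

variable {r : ℕ}

/-- The vector `v` after successive projection along the Gram–Schmidt vectors of
`h 0, …, h (k - 1)`.  Where such a vector vanishes, division by zero gives the coefficient `0`, so
no step needs a case distinction. -/
noncomputable def gsResidual (h : ℕ → Fin r → ℝ) : ℕ → (Fin r → ℝ) → Fin r → ℝ
  | 0, v => v
  | k + 1, v => fun i =>
    gsResidual h k v i -
      (gsResidual h k v ⬝ᵥ gsResidual h k (h k)) / (gsResidual h k (h k) ⬝ᵥ gsResidual h k (h k)) *
        gsResidual h k (h k) i

/-- The `k`-th Gram–Schmidt vector of the sequence `h`. -/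
noncomputable def orthoVec (h : ℕ → Fin r → ℝ) (k : ℕ) : Fin r → ℝ := gsResidual h k (h k)

variable (h : ℕ → Fin r → ℝ)

lemma residual_succ (k : ℕ) (v : Fin r → ℝ) :
    gsResidual h (k + 1) v = gsResidual h k v -
      ((gsResidual h k v ⬝ᵥ orthoVec h k) / (orthoVec h k ⬝ᵥ orthoVec h k)) • orthoVec h k := by
  ext i
  simp [gsResidual, orthoVec]

lemma residual_dotProduct_orthoVec (k : ℕ) (v : Fin r → ℝ) {j : ℕ} (hj : j < k) :
    gsResidual h k v ⬝ᵥ orthoVec h j = 0 := by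
  induction k generalizing v j with
  | zero => omega
  | succ k ih =>
    rw [residual_succ, sub_dotProduct, smul_dotProduct, smul_eq_mul]
    rcases Nat.lt_succ_iff_lt_or_eq.1 hj with hj | rfl
    · rw [ih v hj, orthoVec, ih (h k) hj]
      simp
    · by_cases h0 : orthoVec h j ⬝ᵥ orthoVec h j = 0
      · simp [dotProduct_self_eq_zero.1 h0]
      · rw [div_mul_cancel₀ _ h0, sub_self]

lemma sub_residual_mem_span_orthoVec (k : ℕ) (v : Fin r → ℝ) :
    v - gsResidual h k v ∈ Submodule.span ℝ (orthoVec h '' Set.Iio k) := by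
  induction k with
  | zero => simp [gsResidual]
  | succ k ih =>
    rw [residual_succ, ← sub_add]
    refine add_mem (Submodule.span_mono (Set.image_mono (Set.Iio_subset_Iio k.le_succ)) ih)
      (Submodule.smul_mem _ _ (Submodule.subset_span ⟨k, by simp, rfl⟩))

lemma orthoVec_mem_span (k : ℕ) :
    orthoVec h k ∈ Submodule.span ℝ (h '' Set.Iio (k + 1)) := by
  induction k using Nat.strong_induction_on with
  | _ k ih =>
    have h₁ : h k ∈ Submodule.span ℝ (h '' Set.Iio (k + 1)) :=
      Submodule.subset_span ⟨k, by simp, rfl⟩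
    have h₂ : h k - orthoVec h k ∈ Submodule.span ℝ (h '' Set.Iio (k + 1)) := by
      refine Submodule.span_le.2 ?_ (sub_residual_mem_span_orthoVec h k (h k))
      rintro _ ⟨j, hj, rfl⟩
      have hj : j < k := hj
      exact Submodule.span_mono (Set.image_mono (Set.Iio_subset_Iio (by omega))) (ih j hj)
    simpa using sub_mem h₁ h₂

lemma orthoVec_dotProduct_eq_zero_of_mem_span {k : ℕ} {v : Fin r → ℝ}
    (hv : v ∈ Submodule.span ℝ (orthoVec h '' Set.Iio k)) : orthoVec h k ⬝ᵥ v = 0 := by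
  induction hv using Submodule.span_induction with
  | mem _ hx =>
    obtain ⟨j, hj, rfl⟩ := hx
    exact residual_dotProduct_orthoVec h k _ hj
  | zero => simp
  | add _ _ _ _ h₁ h₂ => rw [dotProduct_add, h₁, h₂, add_zero]
  | smul _ _ _ h₁ => rw [dotProduct_smul, h₁, smul_zero]

lemma orthoVec_dotProduct_of_lt {j k : ℕ} (hj : j < k) : orthoVec h k ⬝ᵥ h j = 0 := by
  apply orthoVec_dotProduct_eq_zero_of_mem_span
  have h₁ := sub_residual_mem_span_orthoVec h j (h j)
  have h₂ : orthoVec h j ∈ Submodule.span ℝ (orthoVec h '' Set.Iio k) :=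
    Submodule.subset_span ⟨j, hj, rfl⟩
  simpa [orthoVec] using
    add_mem (Submodule.span_mono (Set.image_mono (Set.Iio_subset_Iio hj.le)) h₁) h₂

lemma orthoVec_dotProduct_self_pos {k : ℕ}
    (hk : h k ∉ Submodule.span ℝ (h '' Set.Iio k)) : 0 < orthoVec h k ⬝ᵥ h k := by
  have h₁ : orthoVec h k ⬝ᵥ (h k - orthoVec h k) = 0 :=
    orthoVec_dotProduct_eq_zero_of_mem_span h (sub_residual_mem_span_orthoVec h k (h k))
  rw [dotProduct_sub, sub_eq_zero] at h₁
  rw [h₁]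
  refine lt_of_le_of_ne (Finset.sum_nonneg fun i _ => mul_self_nonneg _) fun h0 => ?_
  replace h0 := dotProduct_self_eq_zero.1 h0.symm
  apply hk
  have h₂ := sub_residual_mem_span_orthoVec h k (h k)
  rw [show gsResidual h k (h k) = 0 from h0, sub_zero] at h₂
  refine Submodule.span_le.2 ?_ h₂
  rintro _ ⟨j, hj, rfl⟩
  have hj : j < k := hj
  exact Submodule.span_mono (Set.image_mono (Set.Iio_subset_Iio (by omega))) (orthoVec_mem_span h j)

end Residual

/-! ### Lexicographic comparison -/

/-- Lexicographic comparison of the first `k` entries of two sequences, the entry with the largest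
index being the most significant one. -/
def LexLT : ℕ → (ℕ → ℝ) → (ℕ → ℝ) → Prop
  | 0, _, _ => False
  | k + 1, a, b => a k < b k ∨ a k = b k ∧ LexLT k a b

namespace LexLT

variable {k : ℕ} {a b c : ℕ → ℝ}

lemma asymm (h : LexLT k a b) : ¬ LexLT k b a := by
  induction k with
  | zero => exact id
  | succ k ih =>
    rintro (h' | h') <;> rcases h with h | h
    · exact lt_asymm h h'
    · exact h'.ne' h.1
    · exact h.ne' h'.1
    · exact ih h.2 h'.2

/-- The negation of `LexLT` is transitive, so that `LexLT` is a strict weak order. -/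
lemma not_trans (h : ¬ LexLT k a b) (h' : ¬ LexLT k b c) : ¬ LexLT k a c := by
  induction k with
  | zero => exact id
  | succ k ih =>
    simp only [LexLT, not_or, not_lt, not_and] at h h' ⊢
    refine ⟨h'.1.trans h.1, fun hac => ih (h.2 ?_) (h'.2 ?_)⟩ <;> linarith [h.1, h'.1]

end LexLT

namespace RealRAM

variable {n r : ℕ} {mem : Set (Fin n) → Prop} {f : (Fin r → ℝ) → ℝ}

/-- The columns stored in the memory: row `i` is in the real array `i`. -/
def State.column (r : ℕ) (s : State) (e : ℕ) : Fin r → ℝ := fun i => s.rarr i e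

/-- The tuple of column indices that is currently under consideration; the integer variables from
`100` on are reserved for it. -/
def State.tuple (s : State) (l : ℕ) : ℕ := s.ivar (100 + l)

/-- The sequence of differences of columns described by a tuple of indices. -/
def diffVec (a : ℕ → Fin r → ℝ) (p : ℕ → ℕ) (k : ℕ) : Fin r → ℝ := a (p (2 * k)) - a (p (2 * k + 1))

/-- The sort key of column `e`: its inner products with the Gram–Schmidt vectors of the differences
described by the tuple `p`. -/
noncomputable def key (a : ℕ → Fin r → ℝ) (p : ℕ → ℕ) (e k : ℕ) : ℝ :=
  orthoVec (diffVec a p) k ⬝ᵥ a e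

/-- The strict weak order on columns that belongs to the tuple `p`. -/
def Below (a : ℕ → Fin r → ℝ) (p : ℕ → ℕ) (e e' : ℕ) : Prop :=
  LexLT r (key a p e) (key a p e')

namespace Expr

/-- The expression for an inner product. -/
def dot (v w : Fin r → Expr) : Expr :=
  (List.finRange r).foldr (fun i e => add (mul (v i) (w i)) e) zero

lemma eval_dot (s : State) (v w : Fin r → Expr) :
    (dot v w).eval s = (fun i => (v i).eval s) ⬝ᵥ fun i => (w i).eval s := by
  rw [dotProduct, Fin.sum_univ_def, dot]
  induction List.finRange r with
  | nil => rfl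
  | cons i l ih => simp [eval, ih]

/-- The expressions for the entries of a difference of two columns. -/
def diffVec (r k : ℕ) (i : Fin r) : Expr :=
  sub (load i (100 + 2 * k)) (load i (100 + (2 * k + 1)))

/-- The expressions for the entries of a Gram–Schmidt residual. -/
def residual (r : ℕ) : ℕ → (Fin r → Expr) → Fin r → Expr
  | 0, v => v
  | k + 1, v =>
    let w := residual r k v
    let u := residual r k (diffVec r k)
    fun i => sub (w i) (mul (div (dot w u) (dot u u)) (u i))

lemma eval_residual (s : State) (k : ℕ) (v : Fin r → Expr) :
    (fun i => (residual r k v i).eval s) =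
      gsResidual (RealRAM.diffVec (s.column r) s.tuple) k fun i => (v i).eval s := by
  induction k generalizing v with
  | zero => rfl
  | succ k ih =>
    have hd : (fun i => (diffVec r k i).eval s) = RealRAM.diffVec (s.column r) s.tuple k := rfl
    have h₁ := ih v
    have h₂ := ih (diffVec r k)
    rw [hd] at h₂
    ext i
    simp only [residual, eval, eval_dot, gsResidual]
    rw [← h₁, ← h₂]

/-- The expression for an entry of the sort key of the column whose index is in the integer
variable `x`. -/
def key (r x k : ℕ) : Expr := dot (residual r k (diffVec r k)) fun i => load i x

lemma eval_key (s : State) (x k : ℕ) :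
    (key r x k).eval s = RealRAM.key (s.column r) s.tuple (s.ivar x) k := by
  rw [key, eval_dot, eval_residual]
  rfl

end Expr

/-- `z := 1` if column `x` is below column `y` with respect to the first `k` entries of their keys,
else `z := 0`. -/
def lexCode (r x y z : ℕ) : ℕ → Prog
  | 0 => .instr (.iconst z 0)
  | k + 1 =>
    .seq ((Expr.key r x k).code 3) (.seq ((Expr.key r y k).code 4) (.seq (.instr (.rlt z 3 4))
      (.ite z (.instr (.iconst z 1))
        (.seq (.instr (.rlt z 4 3)) (.ite z (.instr (.iconst z 0)) (lexCode r x y z k))))))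

/-- A bound for the running time of `lexCode`. -/
def lexCost (r x y : ℕ) : ℕ → ℕ
  | 0 => 1
  | k + 1 => (Expr.key r x k).cost + (Expr.key r y k).cost + lexCost r x y k + 6

lemma writes_lexCode (r x y z k : ℕ) :
    (lexCode r x y z k).writes ⊆ {Loc.ivar z} ∪ Loc.rvar '' Set.Ici 3 := by
  induction k with
  | zero => simp [lexCode, Prog.writes, Instr.target]
  | succ k ih =>
    have h₄ : Loc.rvar '' Set.Ici 4 ⊆ Loc.rvar '' Set.Ici 3 :=
      Set.image_mono (Set.Ici_subset_Ici.2 (by norm_num))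
    simp only [lexCode, Prog.writes, Instr.target, Set.union_subset_iff, ih, and_true]
    exact ⟨(Expr.writes_code _ _).trans Set.subset_union_right,
      ((Expr.writes_code _ _).trans h₄).trans Set.subset_union_right, by simp⟩

open Classical in
lemma run_lexCode (x y z k : ℕ) (hx : x ≠ z) (hy : y ≠ z) (hz : z < 100) (s : State) :
    Run mem f (lexCode r x y z k) s fun t s' => t ≤ lexCost r x y k ∧
      s'.ivar z = if LexLT k (key (s.column r) s.tuple (s.ivar x))
        (key (s.column r) s.tuple (s.ivar y)) then 1 else 0 := by
  induction k generalizing s with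
  | zero => simp [lexCode, run_instr, Instr.effect, lexCost, LexLT]
  | succ k ih =>
    simp only [lexCode, run_seq]
    refine (Expr.run_code _ _ s).imp ?_
    rintro t₁ s₁ hf₁ ⟨rfl, hs₁⟩
    refine (Expr.run_code _ _ s₁).imp ?_
    rintro t₂ s₂ hf₂ ⟨rfl, hs₂⟩
    obtain ⟨hi₁, -, hr₁, -⟩ := Expr.frame_code hf₁
    obtain ⟨hi₂, -, hr₂, hd⟩ := Expr.frame_code hf₂
    rw [Expr.eval_congr _ hi₁ hr₁, Expr.eval_key] at hs₂
    rw [Expr.eval_key] at hs₁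
    have ih' := ih ((s₂.setIvar z 0).setIvar z 0)
    have hcol : (s₂.setIvar z 0).column r = s.column r := by
      funext e i
      simp [State.column, hr₁, hr₂]
    have htup : (s₂.setIvar z 0).tuple = s.tuple := by
      funext l
      have : 100 + l ≠ z := by omega
      simp [State.tuple, hi₁, hi₂, this]
    simp only [run_ite, run_seq, run_instr, Instr.effect, State.ivar_setIvar, State.rvar_setIvar,
      if_true, hd 3 (by norm_num), hs₁, hs₂, LexLT, lexCost]
    rcases lt_trichotomy (key (s.column r) s.tuple (s.ivar x) k)
      (key (s.column r) s.tuple (s.ivar y) k) with h | h | h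
    · simp [h]
      omega
    · simp only [h, lt_irrefl, if_false, if_true, true_and, false_or]
      refine ih'.imp ?_
      rintro t s' - ⟨ht, hs'⟩
      refine ⟨by omega, ?_⟩
      rw [hs']
      have hcol' : ((s₂.setIvar z 0).setIvar z 0).column r = s.column r := hcol
      have htup' : ((s₂.setIvar z 0).setIvar z 0).tuple = s.tuple := by
        rw [← htup]; funext l; simp [State.tuple]; intros; omega
      rw [hcol', htup']
      simp [hx, hy, hi₁, hi₂]
    · simp [h, h.not_gt, h.ne']
      omega

end RealRAM

/-! ### Merging sorted blocks -/

section Merge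

/-- The first `k` entries of `T` are sorted within each block of length `w`: no entry is below a
later one of the same block. -/
def SortedBlocks (B : ℕ → ℕ → Prop) (w k : ℕ) (T : ℕ → ℕ) : Prop :=
  ∀ b t t', b * w ≤ t → t < t' → t' < (b + 1) * w → t' < k → ¬ B (T t) (T t')

/-- The state of affairs while the two halves of the block number `b` of length `2 * w` of `S` are
being merged into `T`: positions before `i` and `j` of the two halves have been consumed, and `k`
entries have been written. -/
structure Merging (B : ℕ → ℕ → Prop) (S T : ℕ → ℕ) (w b i j k : ℕ) : Prop where
  le_i : b * (2 * w) ≤ i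
  i_le : i ≤ b * (2 * w) + w
  le_j : b * (2 * w) + w ≤ j
  j_le : j ≤ b * (2 * w) + 2 * w
  count : k + (b * (2 * w) + w) = i + j
  cover : ∀ t, t < i ∨ (b * (2 * w) + w ≤ t ∧ t < j) → ∃ t' < k, T t' = S t
  sorted : SortedBlocks B (2 * w) k T
  bound : ∀ t', b * (2 * w) ≤ t' → t' < k → ∀ t,
    (i ≤ t ∧ t < b * (2 * w) + w) ∨ (j ≤ t ∧ t < b * (2 * w) + 2 * w) → ¬ B (T t') (S t)

variable {B : ℕ → ℕ → Prop} {S T : ℕ → ℕ} {w b i j k N : ℕ}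

lemma eq_of_mem_block {b b' w k : ℕ} (h₁ : b * w ≤ k) (h₂ : k < (b + 1) * w)
    (h₁' : b' * w ≤ k) (h₂' : k < (b' + 1) * w) : b = b' := by
  have h : b < b' + 1 := Nat.lt_of_mul_lt_mul_right (h₁.trans_lt h₂')
  have h' : b' < b + 1 := Nat.lt_of_mul_lt_mul_right (h₁'.trans_lt h₂)
  omega

lemma Merging.start (hT : SortedBlocks B (2 * w) (b * (2 * w)) T)
    (hc : ∀ t < b * (2 * w), ∃ t' < b * (2 * w), T t' = S t) :
    Merging B S T w b (b * (2 * w)) (b * (2 * w) + w) (b * (2 * w)) where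
  le_i := le_rfl
  i_le := by omega
  le_j := le_rfl
  j_le := by omega
  count := by omega
  cover t ht := hc t (by omega)
  sorted := hT
  bound t' h₁ h₂ := by omega

lemma Merging.sortedBlocks_update {x : ℕ} (h : Merging B S T w b i j k)
    (hk : k < b * (2 * w) + 2 * w)
    (hx : ∀ t', b * (2 * w) ≤ t' → t' < k → ¬ B (T t') x) :
    SortedBlocks B (2 * w) (k + 1) (Function.update T k x) := by
  intro b' t t' h₁ h₂ h₃ h₄
  have hne : t ≠ k := by omega
  rcases Nat.lt_succ_iff_lt_or_eq.1 h₄ with h₄ | rfl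
  · rw [Function.update_of_ne hne, Function.update_of_ne h₄.ne]
    exact h.sorted b' t t' h₁ h₂ h₃ h₄
  · have hL : b * (2 * w) ≤ t' := by
      have := h.le_i; have := h.le_j; have := h.count; omega
    obtain rfl : b = b' := eq_of_mem_block hL (by rw [add_one_mul]; omega) (by omega) h₃
    rw [Function.update_of_ne hne, Function.update_self]
    exact hx t h₁ h₂

lemma exists_lt_update {T : ℕ → ℕ} {k x y : ℕ} (h : ∃ t < k, T t = y) :
    ∃ t < k + 1, Function.update T k x t = y := by
  obtain ⟨t, ht, rfl⟩ := h
  exact ⟨t, by omega, by rw [Function.update_of_ne ht.ne]⟩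

/-- One step of merging that takes the next entry of the left half. -/
lemma Merging.takeLeft (hB : ∀ x y z, ¬ B x y → ¬ B y z → ¬ B x z)
    (hS : SortedBlocks B w N S) (hN : b * (2 * w) + 2 * w ≤ N) (h : Merging B S T w b i j k)
    (hi : i < b * (2 * w) + w) (hij : j < b * (2 * w) + 2 * w → ¬ B (S i) (S j)) :
    Merging B S (Function.update T k (S i)) w b (i + 1) j (k + 1) := by
  have e₁ : 2 * b * w = b * (2 * w) := by ring
  have e₂ : (2 * b + 1) * w = b * (2 * w) + w := by ring
  have e₃ : (2 * b + 1 + 1) * w = b * (2 * w) + 2 * w := by ring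
  obtain ⟨h₁, h₂, h₃, h₄, h₅, h₆, h₇, h₈⟩ := h
  refine ⟨by omega, by omega, h₃, h₄, by omega, ?_, ?_, ?_⟩
  · intro t ht
    rcases eq_or_ne t i with rfl | hti
    · exact ⟨k, by omega, by simp⟩
    · exact exists_lt_update (h₆ t (by omega))
  · exact sortedBlocks_update ⟨h₁, h₂, h₃, h₄, h₅, h₆, h₇, h₈⟩ (by omega)
      fun t' ht' ht'' => h₈ t' ht' ht'' i (by omega)
  · intro t' ht' ht'' t ht
    rcases Nat.lt_succ_iff_lt_or_eq.1 ht'' with ht'' | rfl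
    · rw [Function.update_of_ne ht''.ne]
      exact h₈ t' ht' ht'' t (by omega)
    · rw [Function.update_self]
      rcases ht with ht | ht
      · exact hS (2 * b) i t (by omega) (by omega) (by omega) (by omega)
      · have hj := hij (by omega)
        rcases eq_or_lt_of_le ht.1 with rfl | hlt
        · exact hj
        · exact hB _ _ _ hj (hS (2 * b + 1) j t (by omega) hlt (by omega) (by omega))

/-- One step of merging that takes the next entry of the right half. -/
lemma Merging.takeRight (hB : ∀ x y z, ¬ B x y → ¬ B y z → ¬ B x z)
    (hS : SortedBlocks B w N S) (hN : b * (2 * w) + 2 * w ≤ N) (h : Merging B S T w b i j k)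
    (hj : j < b * (2 * w) + 2 * w) (hij : i < b * (2 * w) + w → ¬ B (S j) (S i)) :
    Merging B S (Function.update T k (S j)) w b i (j + 1) (k + 1) := by
  have e₁ : 2 * b * w = b * (2 * w) := by ring
  have e₂ : (2 * b + 1) * w = b * (2 * w) + w := by ring
  have e₃ : (2 * b + 1 + 1) * w = b * (2 * w) + 2 * w := by ring
  obtain ⟨h₁, h₂, h₃, h₄, h₅, h₆, h₇, h₈⟩ := h
  refine ⟨h₁, h₂, by omega, by omega, by omega, ?_, ?_, ?_⟩
  · intro t ht
    rcases eq_or_ne t j with rfl | htj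
    · exact ⟨k, by omega, by simp⟩
    · exact exists_lt_update (h₆ t (by omega))
  · exact sortedBlocks_update ⟨h₁, h₂, h₃, h₄, h₅, h₆, h₇, h₈⟩ (by omega)
      fun t' ht' ht'' => h₈ t' ht' ht'' j (by omega)
  · intro t' ht' ht'' t ht
    rcases Nat.lt_succ_iff_lt_or_eq.1 ht'' with ht'' | rfl
    · rw [Function.update_of_ne ht''.ne]
      exact h₈ t' ht' ht'' t (by omega)
    · rw [Function.update_self]
      rcases ht with ht | ht
      · have hi := hij (by omega)
        rcases eq_or_lt_of_le ht.1 with rfl | hlt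
        · exact hi
        · exact hB _ _ _ hi (hS (2 * b) i t (by omega) hlt (by omega) (by omega))
      · exact hS (2 * b + 1) j t (by omega) (by omega) (by omega) (by omega)

/-- The situation before the `k`-th entry is written in a pass that merges blocks of length `w` in
pairs.  Either a pair of blocks has just been completed, or a pair is being merged; `ei` and `ej`
are the ends of its two blocks. -/
def MergePass (B : ℕ → ℕ → Prop) (S T : ℕ → ℕ) (w i ei j ej k : ℕ) : Prop :=
  (ej = k ∧ ∃ b, k = b * (2 * w) ∧ SortedBlocks B (2 * w) k T ∧ ∀ t < k, ∃ t' < k, T t' = S t) ∨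
  (∃ b, Merging B S T w b i j k ∧ ei = b * (2 * w) + w ∧ ej = b * (2 * w) + 2 * w)

variable {ei ej : ℕ}

lemma MergePass.exists_merging (h : MergePass B S T w i ei j ej k) (hk : k < ej) :
    ∃ b, Merging B S T w b i j k ∧ ei = b * (2 * w) + w ∧ ej = b * (2 * w) + 2 * w := by
  rcases h with h | h
  · omega
  · exact h

lemma MergePass.exists_start (h : MergePass B S T w i ei j ej k) (hk : ¬ k < ej) :
    ∃ b, Merging B S T w b ej (ej + w) k ∧ ej = b * (2 * w) := by
  rcases h with ⟨rfl, b, rfl, hT, hc⟩ | ⟨b, hM, h₁, h₂⟩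
  · exact ⟨b, Merging.start hT hc, rfl⟩
  · obtain ⟨h₁, h₂, h₃, h₄, h₅, h₆, h₇, h₈⟩ := hM
    have hk' : k = (b + 1) * (2 * w) := by rw [add_one_mul]; omega
    have hej : ej = k := by rw [add_one_mul] at hk'; omega
    rw [hej]
    subst hk'
    exact ⟨b + 1, Merging.start h₇ fun t ht => h₆ t (by rw [add_one_mul] at ht; omega), rfl⟩

lemma MergePass.finish (hw : 0 < w) {m : ℕ} (h : MergePass B S T w i ei j ej (m * (2 * w))) :
    SortedBlocks B (2 * w) (m * (2 * w)) T ∧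
      ∀ t < m * (2 * w), ∃ t' < m * (2 * w), T t' = S t := by
  rcases h with ⟨-, b, -, hT, hc⟩ | ⟨b, ⟨h₁, h₂, h₃, h₄, h₅, h₆, h₇, h₈⟩, -, -⟩
  · exact ⟨hT, hc⟩
  · refine ⟨h₇, fun t ht => h₆ t ?_⟩
    have hb : b ≤ m := Nat.le_of_mul_le_mul_right (c := 2 * w) (by omega) (by omega)
    have hm : m ≤ b + 1 := Nat.le_of_mul_le_mul_right (c := 2 * w)
      (by rw [add_one_mul]; omega) (by omega)
    rcases (show m = b ∨ m = b + 1 by omega) with rfl | rfl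
    · omega
    · rw [add_one_mul] at ht h₅
      omega

end Merge

namespace RealRAM

variable {n r : ℕ} {mem : Set (Fin n) → Prop} {f : (Fin r → ℝ) → ℝ}

/-! ### Sorting the columns -/

lemma Below.not_trans {a : ℕ → Fin r → ℝ} {p : ℕ → ℕ} (x y z : ℕ) (h : ¬ Below a p x y)
    (h' : ¬ Below a p y z) : ¬ Below a p x z := LexLT.not_trans h h'

/-- Copies the first entries of the integer array `src` to `dst`, as many as the value of the
variable `b`. -/
def copyCode (src dst b : ℕ) : Prog :=
  .seq (.instr (.iconst 12 0))
    (forLoop 12 b (.seq (.instr (.iload 20 src 12)) (.instr (.istore dst 12 20))))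

lemma run_copyCode {src dst b : ℕ} (hne : src ≠ dst) (hb : b < 5) {s : State} (h1 : s.ivar 1 = 1) :
    Run mem f (copyCode src dst b) s fun t s' =>
      t ≤ s.ivar b * 5 + 3 ∧ ∀ j < s.ivar b, s'.iarr dst j = s.iarr src j := by
  rw [copyCode, run_seq, run_instr]
  have hb' : b ≠ 12 := by omega
  refine (Run.forLoop (T := 2)
    (fun k s' => ∀ j < k, s'.iarr dst j = s.iarr src j) (by simpa [Instr.effect])
    (by simp [Instr.effect]) (by omega)
    (by simp [Prog.writes, Instr.target]; omega) (by simp [Instr.effect]) ?_).imp ?_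
  · intro k s' _ hk hf hi hI
    have hsrc : s'.iarr src = s.iarr src := by
      refine hf.iarr ?_
      simp [writes_forLoop, Prog.writes, Instr.target, hne]
    simp only [run_seq, run_instr, Instr.effect]
    refine ⟨le_rfl, fun v j hj => ?_⟩
    rcases Nat.lt_succ_iff_lt_or_eq.1 hj with hj | rfl
    · simp [hi, hj.ne, hI j hj]
    · simp [hi, hsrc]
  · rintro t s' - ⟨ht, hI⟩
    simp only [Instr.effect, State.ivar_setIvar, hb', if_false, if_true] at ht hI
    exact ⟨by omega, hI⟩

/-- If the current pair of blocks has been consumed, moves on to the next pair.  Variable `10` holds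
the length of the blocks and variable `12` the number of entries written so far; the entries still
to be consumed are those from variable `14` up to `15` and from variable `16` up to `17`. -/
def nextBlocks : Prog :=
  .seq (.instr (.ilt 18 12 17))
    (.ite 18 (.instr (.iconst 5 0))
      (.seq (.instr (.iadd 14 17 9)) (.seq (.instr (.iadd 15 14 10))
        (.seq (.instr (.iadd 16 15 9)) (.instr (.iadd 17 16 10))))))

/-- Appends an entry of one of the two current blocks of the array `0` to the result in the array
`1`: the higher one of the two next entries, or the next entry of the block that is left. -/
def takeEntry (r : ℕ) : Prog :=
  .seq (.instr (.iload 20 0 14)) (.seq (.instr (.iload 21 0 16))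
  (.seq (lexCode r 20 21 22 r) (.seq (.instr (.ilt 18 14 15)) (.seq (.instr (.ilt 19 16 17))
    (.ite 18
      (.ite 19
        (.ite 22
          (.seq (.instr (.istore 1 12 21)) (.instr (.iadd 16 16 1)))
          (.seq (.instr (.istore 1 12 20)) (.instr (.iadd 14 14 1))))
        (.seq (.instr (.istore 1 12 20)) (.instr (.iadd 14 14 1))))
      (.seq (.instr (.istore 1 12 21)) (.instr (.iadd 16 16 1))))))))

/-- Writes one entry of the result of a merge pass. -/
def mergeStep (r : ℕ) : Prog := .seq nextBlocks (takeEntry r)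

lemma writes_nextBlocks : nextBlocks.writes ⊆ Loc.ivar '' {5, 14, 15, 16, 17, 18} := by
  intro l hl
  simp only [nextBlocks, Prog.writes, Instr.target, Set.mem_union, Set.mem_singleton_iff] at hl
  rcases hl with rfl | rfl | rfl | rfl | rfl | rfl <;> simp

lemma writes_takeEntry (r : ℕ) : (takeEntry r).writes ⊆
    Loc.ivar '' {14, 16, 18, 19, 20, 21, 22} ∪ {.iarr 1} ∪ Loc.rvar '' Set.Ici 3 := by
  have h := writes_lexCode r 20 21 22 r
  intro l hl
  simp only [takeEntry, Prog.writes, Instr.target, Set.mem_union, Set.mem_singleton_iff] at hl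
  by_cases hl' : l ∈ (lexCode r 20 21 22 r).writes
  · rcases h hl' with rfl | h
    · simp
    · exact Or.inr h
  · simp only [hl', false_or] at hl
    simp only [Set.image_insert_eq, Set.image_singleton, Set.mem_union, Set.mem_insert_iff,
      Set.mem_singleton_iff]
    tauto

lemma writes_mergeStep (r : ℕ) : (mergeStep r).writes ⊆
    Loc.ivar '' {5, 14, 15, 16, 17, 18, 19, 20, 21, 22} ∪ {.iarr 1} ∪ Loc.rvar '' Set.Ici 3 := by
  refine Set.union_subset (writes_nextBlocks.trans ?_) ((writes_takeEntry r).trans ?_)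
  · refine Set.subset_union_of_subset_left (Set.subset_union_of_subset_left
      (Set.image_mono ?_) _) _
    intro x hx
    simp at hx ⊢
    tauto
  · refine Set.union_subset_union_left _ (Set.union_subset_union_left _ (Set.image_mono ?_))
    intro x hx
    simp at hx ⊢
    tauto

lemma run_nextBlocks {B : ℕ → ℕ → Prop} {s : State} (h9 : s.ivar 9 = 0) (hw : 0 < s.ivar 10)
    (h : MergePass B (s.iarr 0) (s.iarr 1) (s.ivar 10) (s.ivar 14) (s.ivar 15) (s.ivar 16)
      (s.ivar 17) (s.ivar 12)) :
    Run mem f nextBlocks s fun t s' => t ≤ 6 ∧ s.ivar 12 < s'.ivar 17 ∧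
      ∃ b, Merging B (s.iarr 0) (s.iarr 1) (s.ivar 10) b (s'.ivar 14) (s'.ivar 16) (s.ivar 12) ∧
        s'.ivar 15 = b * (2 * s.ivar 10) + s.ivar 10 ∧
        s'.ivar 17 = b * (2 * s.ivar 10) + 2 * s.ivar 10 := by
  simp only [nextBlocks, run_seq, run_ite, run_instr, Instr.effect]
  by_cases hk : s.ivar 12 < s.ivar 17
  · simp only [State.ivar_setIvar, hk, if_true, if_false, one_ne_zero, Nat.reduceEqDiff,
      Nat.reduceAdd, Nat.reduceLeDiff, true_and]
    exact h.exists_merging hk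
  · obtain ⟨b, hM, hb⟩ := h.exists_start hk
    simp only [State.ivar_setIvar, hk, if_true, if_false, h9]
    simp only [Nat.reduceEqDiff, if_false, Nat.reduceAdd, le_refl, true_and]
    exact ⟨by have := hM.count; omega, b, by simpa using hM, by omega, by omega⟩

/-- The running time of `mergeStep`. -/
def mergeStepCost (r : ℕ) : ℕ := lexCost r 20 21 r + 15

open Classical in
lemma run_mergeStep {s : State} {N : ℕ} (h1 : s.ivar 1 = 1) (h9 : s.ivar 9 = 0)
    (hS : SortedBlocks (Below (s.column r) s.tuple) (s.ivar 10) N (s.iarr 0))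
    (hdvd : 2 * s.ivar 10 ∣ N) (hk : s.ivar 12 < N)
    (h : MergePass (Below (s.column r) s.tuple) (s.iarr 0) (s.iarr 1) (s.ivar 10) (s.ivar 14)
      (s.ivar 15) (s.ivar 16) (s.ivar 17) (s.ivar 12)) :
    Run mem f (mergeStep r) s fun t s' => t ≤ mergeStepCost r ∧
      MergePass (Below (s.column r) s.tuple) (s.iarr 0) (s'.iarr 1) (s.ivar 10) (s'.ivar 14)
      (s'.ivar 15) (s'.ivar 16) (s'.ivar 17) (s.ivar 12 + 1) := by
  rw [mergeStep, run_seq]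
  have hpos : 0 < s.ivar 10 := by
    obtain ⟨m, rfl⟩ := hdvd
    exact Nat.pos_of_ne_zero fun h0 => by simp [h0] at hk
  refine (run_nextBlocks h9 hpos h).imp ?_
  rintro t₀ s₀ hf₀ ⟨ht₀, hk', b, hM, h15, h17⟩
  have hw (x : ℕ) (hx : x ∉ ({5, 14, 15, 16, 17, 18} : Set ℕ)) : s₀.ivar x = s.ivar x :=
    hf₀.ivar fun h => hx (by simpa using writes_nextBlocks h)
  have hrarr : s₀.rarr = s.rarr := funext fun a => hf₀.rarr fun h => by
    simpa using writes_nextBlocks h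
  have hiarr : s₀.iarr = s.iarr := funext fun a => hf₀.iarr fun h => by
    simpa using writes_nextBlocks h
  have hN : b * (2 * s.ivar 10) + 2 * s.ivar 10 ≤ N := by
    obtain ⟨m, rfl⟩ := hdvd
    obtain ⟨h₁, h₂, h₃, h₄, h₅, -, -, -⟩ := hM
    have : b < m := Nat.lt_of_mul_lt_mul_left (a := 2 * s.ivar 10)
      (by rw [mul_comm]; omega)
    rw [← add_one_mul, mul_comm]
    exact Nat.mul_le_mul_left _ this
  simp only [takeEntry, run_seq, run_instr, Instr.effect]
  refine (run_lexCode 20 21 22 r (by norm_num) (by norm_num) (by norm_num) _).imp ?_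
  rintro t₁ s₁ hf₁ ⟨ht₁, h22⟩
  have hw₁ (x : ℕ) (hx : x ≠ 22) : Loc.ivar x ∉ (lexCode r 20 21 22 r).writes :=
    fun h => hx (by simpa using writes_lexCode _ _ _ _ _ h)
  have e12 := hf₁.ivar (hw₁ 12 (by norm_num))
  have e14 := hf₁.ivar (hw₁ 14 (by norm_num))
  have e15 := hf₁.ivar (hw₁ 15 (by norm_num))
  have e16 := hf₁.ivar (hw₁ 16 (by norm_num))
  have e17 := hf₁.ivar (hw₁ 17 (by norm_num))
  have e20 := hf₁.ivar (hw₁ 20 (by norm_num))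
  have e21 := hf₁.ivar (hw₁ 21 (by norm_num))
  have e1 := hf₁.ivar (hw₁ 1 (by norm_num))
  have eT : s₁.iarr 1 = _ := hf₁.iarr fun h => by simpa using writes_lexCode _ _ _ _ _ h
  simp only [State.ivar_setIvar, State.iarr_setIvar, Nat.reduceEqDiff, if_true, if_false, hiarr,
    OfNat.one_ne_ofNat, hw 1 (by simp), hw 12 (by simp), h1]
    at e12 e14 e15 e16 e17 e20 e21 e1 eT h22
  have h22' : s₁.ivar 22 = if Below (s.column r) s.tuple (s.iarr 0 (s₀.ivar 14))
      (s.iarr 0 (s₀.ivar 16)) then 1 else 0 := by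
    rw [h22]
    have hcol : State.column r ((s₀.setIvar 20 (s.iarr 0 (s₀.ivar 14))).setIvar 21
        (s.iarr 0 (s₀.ivar 16))) = s.column r := by
      funext e i
      simp [State.column, hrarr]
    have htup : State.tuple ((s₀.setIvar 20 (s.iarr 0 (s₀.ivar 14))).setIvar 21
        (s.iarr 0 (s₀.ivar 16))) = s.tuple := by
      funext l
      have h₁ : 100 + l ≠ 20 := by omega
      have h₂ : 100 + l ≠ 21 := by omega
      simp only [State.tuple, State.ivar_setIvar, h₁, h₂, if_false]
      exact hw _ (by simp; omega)
    rw [hcol, htup, Below]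
  have hleft (hi : s₀.ivar 14 < s₀.ivar 15) (hij : s₀.ivar 16 < s₀.ivar 17 →
      ¬ Below (s.column r) s.tuple (s.iarr 0 (s₀.ivar 14)) (s.iarr 0 (s₀.ivar 16))) :=
    hM.takeLeft Below.not_trans hS hN (by omega) (fun h => hij (by omega))
  have hright (hi : s₀.ivar 16 < s₀.ivar 17) (hij : s₀.ivar 14 < s₀.ivar 15 →
      ¬ Below (s.column r) s.tuple (s.iarr 0 (s₀.ivar 16)) (s.iarr 0 (s₀.ivar 14))) :=
    hM.takeRight Below.not_trans hS hN (by omega) (fun h => hij (by omega))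
  have hor : s₀.ivar 14 < s₀.ivar 15 ∨ s₀.ivar 16 < s₀.ivar 17 := by
    have := hM.count
    omega
  unfold mergeStepCost
  by_cases hi : s₀.ivar 14 < s₀.ivar 15
  · by_cases hj : s₀.ivar 16 < s₀.ivar 17
    · by_cases hb : Below (s.column r) s.tuple (s.iarr 0 (s₀.ivar 14)) (s.iarr 0 (s₀.ivar 16))
      · simp [run_ite, run_seq, run_instr, Instr.effect, e12, e14, e15, e16, e17, e21, e1, eT,
          h22', hi, hj, hb]
        exact ⟨by omega, Or.inr ⟨b, hright hj fun _ => LexLT.asymm hb, h15, h17⟩⟩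
      · simp [run_ite, run_seq, run_instr, Instr.effect, e12, e14, e15, e16, e17, e20, e1, eT,
          h22', hi, hj, hb]
        exact ⟨by omega, Or.inr ⟨b, hleft hi fun _ => hb, h15, h17⟩⟩
    · simp [run_ite, run_seq, run_instr, Instr.effect, e12, e14, e15, e16, e17, e20, e1, eT,
        hi, hj]
      exact ⟨by omega, Or.inr ⟨b, hleft hi fun h => absurd h hj, h15, h17⟩⟩
  · simp [run_ite, run_seq, run_instr, Instr.effect, e12, e14, e15, e16, e17, e21, e1, eT, hi]
    exact ⟨by omega, Or.inr ⟨b, hright (hor.resolve_left hi) fun h => absurd h hi, h15, h17⟩⟩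

lemma State.column_eq_of_frame {p : Prog} {s s' : State} (h : Frame p s s')
    (hp : ∀ i < r, Loc.rarr i ∉ p.writes) : s'.column r = s.column r := by
  funext e i
  exact congrFun (h.rarr (hp i i.2)) e

lemma State.tuple_eq_of_frame {p : Prog} {s s' : State} (h : Frame p s s')
    (hp : ∀ x, 100 ≤ x → Loc.ivar x ∉ p.writes) : s'.tuple = s.tuple :=
  funext fun _ => h.ivar (hp _ (Nat.le_add_right _ _))

@[simp] lemma State.column_setIvar (s : State) (x k : ℕ) :
    (s.setIvar x k).column r = s.column r := rfl

lemma State.tuple_setIvar (s : State) {x : ℕ} (hx : x < 100) (k : ℕ) :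
    (s.setIvar x k).tuple = s.tuple := by
  funext l
  have : 100 + l ≠ x := by omega
  simp [State.tuple, this]

/-- Merges the blocks of the array `0` in pairs; variable `10` holds the length of the blocks. -/
def mergePass (r : ℕ) : Prog :=
  .seq (.instr (.iconst 12 0)) (.seq (.instr (.iconst 17 0))
    (.seq (forLoop 12 3 (mergeStep r)) (copyCode 1 0 3)))

/-- The parts of the memory that sorting may overwrite, except for variables `10` and `11`. -/
def passScratch : Set Loc :=
  Loc.ivar '' ({5} ∪ Set.Ico 12 100) ∪ Loc.iarr '' {0, 1} ∪ Loc.rvar '' Set.Ici 3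

lemma writes_mergeStep_subset (r : ℕ) : (mergeStep r).writes ⊆ passScratch := by
  refine (writes_mergeStep r).trans (Set.union_subset_union_left _ (Set.union_subset_union
    (Set.image_mono ?_) ?_))
  · intro x hx
    simp at hx ⊢
    omega
  · simp

lemma writes_mergePass (r : ℕ) : (mergePass r).writes ⊆ passScratch := by
  have h := writes_mergeStep_subset r
  simp only [mergePass, copyCode, Prog.writes, Instr.target, writes_forLoop, Set.union_subset_iff,
    Set.singleton_subset_iff, Set.insert_subset_iff, h]
  simp [passScratch]

lemma run_mergePass {s : State} {N : ℕ} (h1 : s.ivar 1 = 1) (h9 : s.ivar 9 = 0)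
    (h3 : s.ivar 3 = N) (hw : 0 < s.ivar 10)
    (hS : SortedBlocks (Below (s.column r) s.tuple) (s.ivar 10) N (s.iarr 0))
    (hdvd : 2 * s.ivar 10 ∣ N) :
    Run mem f (mergePass r) s fun t s' => t ≤ N * (mergeStepCost r + 8) + 7 ∧
      SortedBlocks (Below (s.column r) s.tuple) (2 * s.ivar 10) N (s'.iarr 0) ∧
      ∀ t < N, ∃ t' < N, s'.iarr 0 t' = s.iarr 0 t := by
  simp only [mergePass, run_seq, run_instr, Instr.effect]
  set s₁ := (s.setIvar 12 0).setIvar 17 0 with hs₁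
  have hcol₁ : s₁.column r = s.column r := rfl
  have htup₁ : s₁.tuple = s.tuple := by
    rw [hs₁, State.tuple_setIvar _ (by norm_num), State.tuple_setIvar _ (by norm_num)]
  have hwr (x : ℕ) (hx : x ≠ 5) (hx' : x < 12 ∨ 100 ≤ x) :
      Loc.ivar x ∉ (mergeStep r).writes := fun h => by
    have := writes_mergeStep_subset r h
    simp [passScratch] at this
    omega
  have h12 : Loc.ivar 12 ∉ (mergeStep r).writes := fun h => by
    simpa using writes_mergeStep r h
  refine (Run.forLoop (T := mergeStepCost r) (fun k s' =>
    MergePass (Below (s.column r) s.tuple) (s.iarr 0) (s'.iarr 1) (s.ivar 10) (s'.ivar 14)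
      (s'.ivar 15) (s'.ivar 16) (s'.ivar 17) k) (by simpa [s₁]) (by simp [s₁]) (by norm_num)
    ⟨h12, hwr 3 (by norm_num) (by norm_num), hwr 1 (by norm_num) (by norm_num)⟩ ?_ ?_).imp ?_
  · intro v
    refine Or.inl ⟨by simp [s₁], 0, by simp [s₁], ?_, ?_⟩
    · simp [s₁, SortedBlocks]
    · simp [s₁]
  · intro k s' _ hk hf hi hI
    have hwf (x : ℕ) (hx : x ≠ 5) (hx' : x < 12 ∨ 100 ≤ x) :
        Loc.ivar x ∉ (forLoop 12 3 (mergeStep r)).writes := by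
      rw [writes_forLoop]
      have := hwr x hx hx'
      simp only [Set.mem_union, Set.mem_insert_iff, Set.mem_singleton_iff, Loc.ivar.injEq,
        not_or]
      exact ⟨this, by omega, by omega⟩
    have hcol : s'.column r = s.column r := (State.column_eq_of_frame hf fun i _ h => by
      rw [writes_forLoop] at h
      rcases h with h | h
      · simpa using writes_mergeStep r h
      · simp at h).trans hcol₁
    have htup : s'.tuple = s.tuple := (State.tuple_eq_of_frame hf fun x hx =>
      hwf x (by omega) (Or.inr hx)).trans htup₁
    have e0 : s'.iarr 0 = s.iarr 0 := (hf.iarr fun h => by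
      rw [writes_forLoop] at h
      rcases h with h | h
      · simpa using writes_mergeStep r h
      · simp at h)
    have e (x : ℕ) (hx : x ≠ 5) (hx' : x < 12) : s'.ivar x = s.ivar x := by
      rw [hf.ivar (hwf x hx (Or.inl hx'))]
      have h₁ : x ≠ 12 := by omega
      have h₂ : x ≠ 17 := by omega
      simp [s₁, h₁, h₂]
    have h10 := e 10 (by norm_num) (by norm_num)
    have hk' : k < N := by simpa [s₁, h3] using hk
    have := run_mergeStep (mem := mem) (f := f) (s := s') (N := N)
      ((e 1 (by norm_num) (by norm_num)).trans h1) ((e 9 (by norm_num) (by norm_num)).trans h9)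
      (by rwa [hcol, htup, h10, e0]) (by rwa [h10]) (by rwa [hi])
      (by rwa [hcol, htup, h10, e0, hi])
    refine this.imp ?_
    rintro t s'' hf' ⟨ht, hM⟩
    rw [hcol, htup, h10, e0, hi] at hM
    exact ⟨ht, fun v => by simpa using hM⟩
  · rintro t s₂ hf ⟨ht, hM⟩
    have hs3 : s₁.ivar 3 = N := by simpa [s₁] using h3
    have hs12 : s₁.ivar 12 = 0 := by simp [s₁]
    rw [hs3, hs12] at ht
    rw [hs3] at hM
    obtain ⟨m, rfl⟩ := hdvd
    rw [mul_comm _ m] at hM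
    obtain ⟨hT, hc⟩ := hM.finish hw
    rw [mul_comm m] at hT hc
    have hwf (x : ℕ) (hx : x ≠ 5) (hx' : x < 12) :
        s₂.ivar x = s₁.ivar x := hf.ivar <| by
      rw [writes_forLoop]
      have := hwr x hx (Or.inl hx')
      simp only [Set.mem_union, Set.mem_insert_iff, Set.mem_singleton_iff, Loc.ivar.injEq,
        not_or]
      exact ⟨this, by omega, by omega⟩
    refine (run_copyCode (by norm_num) (by norm_num) (s := s₂) ?_).imp ?_
    · rw [hwf 1 (by norm_num) (by norm_num)]
      simpa [s₁]
    · rintro t' s₃ - ⟨ht', hcopy⟩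
      rw [hwf 3 (by norm_num) (by norm_num), hs3] at ht' hcopy
      refine ⟨?_, ?_, ?_⟩
      · simp only [mul_add, Nat.sub_zero] at ht ht' ⊢
        omega
      · intro b t t' h₁ h₂ h₃ h₄
        rw [hcopy t (by omega), hcopy t' h₄]
        exact hT b t t' h₁ h₂ h₃ h₄
      · intro t ht
        obtain ⟨t', ht', h⟩ := hc t ht
        exact ⟨t', ht', by rw [hcopy t' ht', h]⟩

/-- Fills the integer array `0` with the indices of the columns in descending order, by bottom-up
merge sort.  Variable `3` holds the number of indices, a power of two. -/
def sortCode (r : ℕ) : Prog :=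
  .seq (.instr (.iconst 12 0)) (.seq (forLoop 12 3 (.instr (.istore 0 12 12)))
    (.seq (.instr (.iconst 10 1)) (.seq (.instr (.ilt 11 10 3))
      (.loop 11 (.seq (mergePass r)
        (.seq (.instr (.iadd 10 10 10)) (.instr (.ilt 11 10 3))))))))

/-- A bound for the running time of `sortCode` on `N = 2 ^ K` indices. -/
def sortCost (r N K : ℕ) : ℕ := N * 4 + K * (N * (mergeStepCost r + 8) + 10) + 6

lemma writes_sortCode (r : ℕ) : (sortCode r).writes ⊆ passScratch ∪ Loc.ivar '' {10, 11} := by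
  have h := writes_mergePass r
  simp only [sortCode, Prog.writes, Instr.target, writes_forLoop, Set.union_subset_iff,
    Set.singleton_subset_iff, Set.insert_subset_iff, h.trans Set.subset_union_left]
  simp [passScratch]

lemma run_sortCode {s : State} {K : ℕ} (h1 : s.ivar 1 = 1) (h9 : s.ivar 9 = 0)
    (h3 : s.ivar 3 = 2 ^ K) :
    Run mem f (sortCode r) s fun t s' => t ≤ sortCost r (2 ^ K) K ∧
      (∀ t t', t < t' → t' < 2 ^ K →
        ¬ Below (s.column r) s.tuple (s'.iarr 0 t) (s'.iarr 0 t')) ∧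
      ∀ e < 2 ^ K, ∃ t < 2 ^ K, s'.iarr 0 t = e := by
  simp only [sortCode, run_seq, run_instr, Instr.effect]
  refine (Run.forLoop (T := 1) (fun k s' => ∀ j < k, s'.iarr 0 j = j) (by simpa) (by simp)
    (by norm_num) (by simp [Prog.writes, Instr.target]) (by simp) ?_).imp ?_
  · intro k s' _ _ _ hi hI
    simp only [run_instr, Instr.effect]
    refine ⟨le_rfl, fun v j hj => ?_⟩
    rcases Nat.lt_succ_iff_lt_or_eq.1 hj with hj | rfl
    · simp [hi, hj.ne, hI j hj]
    · simp [hi]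
  rintro t₁ s₁ hf₁ ⟨ht₁, hI⟩
  have e₁ (x : ℕ) (hx : x ≠ 5) (hx' : x ≠ 12) : s₁.ivar x = s.ivar x := by
    rw [hf₁.ivar (by simp [writes_forLoop, Prog.writes, Instr.target]; omega)]
    simp [hx']
  have hcol₁ : s₁.column r = s.column r := (State.column_eq_of_frame hf₁ fun i _ => by
    simp [writes_forLoop, Prog.writes, Instr.target]).trans (s.column_setIvar 12 0)
  have htup₁ : s₁.tuple = s.tuple := (State.tuple_eq_of_frame hf₁ fun x hx => by
    simp [writes_forLoop, Prog.writes, Instr.target]; omega).trans (s.tuple_setIvar (by norm_num) 0)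
  simp only [State.ivar_setIvar, Nat.reduceEqDiff, if_true, if_false, h3] at ht₁ hI
  -- with `k` rounds to go, the blocks have length `2 ^ (K - k)`
  let J : ℕ → State → Prop := fun k s' => k ≤ K ∧ s'.ivar 1 = 1 ∧ s'.ivar 9 = 0 ∧
    s'.ivar 3 = 2 ^ K ∧ s'.ivar 10 = 2 ^ (K - k) ∧
    s'.ivar 11 = (if 2 ^ (K - k) < 2 ^ K then 1 else 0) ∧ s'.column r = s.column r ∧
    s'.tuple = s.tuple ∧
    SortedBlocks (Below (s.column r) s.tuple) (2 ^ (K - k)) (2 ^ K) (s'.iarr 0) ∧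
    ∀ e < 2 ^ K, ∃ t < 2 ^ K, s'.iarr 0 t = e
  refine (Run.loop (T := 2 ^ K * (mergeStepCost r + 8) + 9) (Q := J 0) J ?_ ?_ K ?_).imp ?_
  · rintro k s' ⟨hk, h1', h9', h3', h10', h11', hcol', htup', hsort, hcov⟩
    have hlt : 2 ^ (K - (k + 1)) < 2 ^ K := Nat.pow_lt_pow_right (by norm_num) (by omega)
    have hdbl : 2 ^ (K - k) = 2 * 2 ^ (K - (k + 1)) := by
      rw [← pow_succ']; congr 1; omega
    refine ⟨by simp [h11', hlt], ?_⟩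
    simp only [run_seq, run_instr, Instr.effect]
    refine (run_mergePass h1' h9' h3' (by rw [h10']; positivity)
      (by rwa [h10', hcol', htup']) ?_).imp ?_
    · rw [h10', ← hdbl]
      exact pow_dvd_pow 2 (by omega)
    rintro t s₂ hf₂ ⟨ht, hsort₂, hcov₂⟩
    have e₂ (x : ℕ) (hx : x ≠ 5) (hx' : x < 12) : s₂.ivar x = s'.ivar x := hf₂.ivar fun h => by
      have := writes_mergePass r h
      simp [passScratch] at this
      omega
    have hcol₂ : s₂.column r = s'.column r := State.column_eq_of_frame hf₂ fun i _ h => by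
      simpa [passScratch] using writes_mergePass r h
    have htup₂ : s₂.tuple = s'.tuple := State.tuple_eq_of_frame hf₂ fun x hx h => by
      have := writes_mergePass r h
      simp [passScratch] at this
      omega
    rw [hcol', htup', h10', ← hdbl] at hsort₂
    have h10₂ : s₂.ivar 10 + s₂.ivar 10 = 2 ^ (K - k) := by
      rw [e₂ 10 (by norm_num) (by norm_num), h10', hdbl]; ring
    refine ⟨by omega, by omega, ?_⟩
    simp only [State.ivar_setIvar, State.iarr_setIvar, State.column_setIvar, h10₂,
      Nat.reduceEqDiff, if_true, if_false, OfNat.one_ne_ofNat,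
      e₂ 1 (by norm_num) (by norm_num), e₂ 9 (by norm_num) (by norm_num),
      e₂ 3 (by norm_num) (by norm_num), h1', h9', h3', hcol₂, hcol', true_and]
    refine ⟨?_, hsort₂, fun e he => ?_⟩
    · rw [State.tuple_setIvar _ (by norm_num), State.tuple_setIvar _ (by norm_num), htup₂, htup']
    · obtain ⟨t, ht, rfl⟩ := hcov e he
      exact hcov₂ t ht
  · intro s' hs'
    exact ⟨by simpa using hs'.2.2.2.2.2.1, hs'⟩
  · simp only [J, State.ivar_setIvar, State.iarr_setIvar, State.column_setIvar,
      Nat.reduceEqDiff, if_true, if_false, OfNat.one_ne_ofNat, e₁ 1 (by norm_num) (by norm_num),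
      e₁ 9 (by norm_num) (by norm_num), e₁ 3 (by norm_num) (by norm_num), h1, h9, h3, hcol₁,
      Nat.sub_self, pow_zero, le_refl, true_and]
    refine ⟨?_, ?_, fun e he => ⟨e, he, hI e he⟩⟩
    · rw [State.tuple_setIvar _ (by norm_num), State.tuple_setIvar _ (by norm_num), htup₁]
    · intro b t t' h₁ h₂ h₃ _
      omega
  · rintro t s' - ⟨ht, -, -, -, -, -, -, -, -, hsort, hcov⟩
    refine ⟨?_, fun t t' h h' => ?_, hcov⟩
    · unfold sortCost
      have : K * (2 ^ K * (mergeStepCost r + 8) + 9 + 1) =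
        K * (2 ^ K * (mergeStepCost r + 8) + 10) := rfl
      omega
    · exact hsort 0 t t' (by simp) h (by simpa using h') h'

end RealRAM

/-! ### The greedy algorithm -/

/-- The set built by the greedy algorithm within `t` steps.  Step `t` adds the element `σ t` if this
is an eligible element of `[n]` and keeps the set independent. -/
def greedySet {n : ℕ} (mem : Set (Fin n) → Prop) (elig : ℕ → Prop) (σ : ℕ → ℕ) : ℕ → Set (Fin n)
  | 0 => ∅
  | t + 1 => {i | i ∈ greedySet mem elig σ t ∨
      ((i : ℕ) = σ t ∧ elig i ∧ mem (insert i (greedySet mem elig σ t)))}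

lemma mem_greedySet {n : ℕ} {mem : Set (Fin n) → Prop} (h0 : mem ∅) (elig : ℕ → Prop)
    (σ : ℕ → ℕ) (t : ℕ) : mem (greedySet mem elig σ t) := by
  induction t with
  | zero => exact h0
  | succ t ih =>
    by_cases h : ∃ i : Fin n, (i : ℕ) = σ t ∧ elig i ∧ mem (insert i (greedySet mem elig σ t))
    · obtain ⟨i, hi, he, hm⟩ := h
      convert hm using 1
      ext j
      simp only [greedySet, Set.mem_ofPred_eq, Set.mem_insert_iff]
      constructor
      · rintro (h | ⟨h, -⟩)
        · exact Or.inr h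
        · exact Or.inl (Fin.ext (h.trans hi.symm))
      · rintro (rfl | h)
        · exact Or.inr ⟨hi, he, hm⟩
        · exact Or.inl h
    · convert ih using 1
      ext j
      simp only [greedySet, Set.mem_ofPred_eq, or_iff_left_iff_imp]
      exact fun hj => absurd ⟨j, hj⟩ h

namespace RealRAM

variable {n r : ℕ} {mem : Set (Fin n) → Prop} {f : (Fin r → ℝ) → ℝ}

/-- An element is eligible for the greedy algorithm if either bases are wanted, or independent sets
are wanted (`ind = true`) and its column is above the column `n`, which is zero. -/
def Elig (ind : Bool) (n : ℕ) (a : ℕ → Fin r → ℝ) (p : ℕ → ℕ) (e : ℕ) : Prop :=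
  ind = true → Below a p n e

/-- The set of all `i` in `[n]` with a nonzero entry in the integer array `a`. -/
def State.support (s : State) (n a : ℕ) : Set (Fin n) := {i | s.iarr a i ≠ 0}

/-- `22 := 1` if the element in variable `20` is eligible, else `22 := 0`. -/
def eligCode (ind : Bool) (r : ℕ) : Prog :=
  if ind then lexCode r 0 20 22 r else .instr (.iconst 22 1)

/-- Treats one element of the sorted list.  The integer array `2` holds the current set. -/
def greedyStep (ind : Bool) (r : ℕ) : Prog :=
  .seq (.instr (.iload 20 0 12)) (.seq (.instr (.ilt 18 20 0))
    (.ite 18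
      (.seq (eligCode ind r)
        (.ite 22
          (.seq (.instr (.istore 2 20 1)) (.seq (.instr (.query 19 2))
            (.ite 19 (.instr (.iconst 5 0)) (.instr (.istore 2 20 9)))))
          (.instr (.iconst 5 0))))
      (.instr (.iconst 5 0))))

/-- The greedy algorithm on the sorted list in the integer array `0`. -/
def greedyCode (ind : Bool) (r : ℕ) : Prog :=
  .seq (.instr (.iconst 12 0)) (.seq (forLoop 12 0 (.instr (.istore 2 12 9)))
    (.seq (.instr (.iconst 12 0)) (forLoop 12 3 (greedyStep ind r))))

/-- The running time of `greedyStep`. -/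
def greedyStepCost (r : ℕ) : ℕ := lexCost r 0 20 r + 10

/-- A bound for the running time of `greedyCode` on a list of length `N`. -/
def greedyCost (r n N : ℕ) : ℕ := n * 4 + N * (greedyStepCost r + 3) + 6

lemma writes_eligCode (ind : Bool) (r : ℕ) :
    (eligCode ind r).writes ⊆ {.ivar 22} ∪ Loc.rvar '' Set.Ici 3 := by
  cases ind
  · simp [eligCode, Prog.writes, Instr.target]
  · exact writes_lexCode _ _ _ _ _

lemma writes_greedyStep (ind : Bool) (r : ℕ) : (greedyStep ind r).writes ⊆
    Loc.ivar '' {5, 18, 19, 20, 22} ∪ {.iarr 2} ∪ Loc.rvar '' Set.Ici 3 := by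
  have h : (eligCode ind r).writes ⊆
      Loc.ivar '' {5, 18, 19, 20, 22} ∪ {.iarr 2} ∪ Loc.rvar '' Set.Ici 3 :=
    (writes_eligCode ind r).trans (Set.union_subset_union_left _ (by simp))
  simp only [greedyStep, Prog.writes, Instr.target, Set.union_subset_iff,
    Set.singleton_subset_iff, h]
  simp

open Classical in
lemma run_eligCode (ind : Bool) (s : State) (h0 : s.ivar 0 = n) :
    Run mem f (eligCode ind r) s fun t s' => t ≤ lexCost r 0 20 r + 1 ∧
      s'.ivar 22 = if Elig ind n (s.column r) s.tuple (s.ivar 20) then 1 else 0 := by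
  cases ind
  · simp [eligCode, run_instr, Instr.effect, Elig]
  · refine (run_lexCode 0 20 22 r (by norm_num) (by norm_num) (by norm_num) s).imp ?_
    rintro t s' - ⟨ht, h⟩
    exact ⟨by omega, by simpa [Elig, Below, h0] using h⟩

open Classical in
lemma run_greedyStep (hmem : mem ∅) (ind : Bool) {s : State} {t : ℕ} (h0 : s.ivar 0 = n)
    (h1 : s.ivar 1 = 1) (h9 : s.ivar 9 = 0) (h12 : s.ivar 12 = t)
    (hs : s.support n 2 = greedySet mem (Elig ind n (s.column r) s.tuple) (s.iarr 0) t) :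
    Run mem f (greedyStep ind r) s fun t' s' => t' ≤ greedyStepCost r ∧
      s'.support n 2 =
        greedySet mem (Elig ind n (s.column r) s.tuple) (s.iarr 0) (t + 1) := by
  set G := greedySet mem (Elig ind n (s.column r) s.tuple) (s.iarr 0) with hG
  have hGm : mem (G t) := mem_greedySet hmem _ _ _
  have hsame (i : Fin n) : s.iarr 2 i ≠ 0 ↔ i ∈ G t := by rw [← hs]; rfl
  have hsucc (i : Fin n) : i ∈ G (t + 1) ↔ i ∈ G t ∨ ((i : ℕ) = s.iarr 0 t ∧
      Elig ind n (s.column r) s.tuple i ∧ mem (insert i (G t))) := Iff.rfl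
  simp only [greedyStep, run_seq, run_instr, Instr.effect, run_ite]
  by_cases hn : s.iarr 0 t < n
  swap
  · simp only [State.ivar_setIvar, h12, h0, hn, if_true, if_false, Nat.reduceEqDiff,
      OfNat.zero_ne_ofNat]
    refine ⟨by unfold greedyStepCost; omega, ?_⟩
    ext i
    simp only [State.support, Set.mem_ofPred_eq, State.iarr_setIvar, hsame, hsucc]
    have : (i : ℕ) ≠ s.iarr 0 t := by omega
    simp [this]
  simp only [State.ivar_setIvar, h12, h0, hn, if_true, if_false, Nat.reduceEqDiff,
    OfNat.zero_ne_ofNat, one_ne_zero]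
  refine (run_eligCode ind _ (by simp [h0])).imp ?_
  rintro t₁ s₁ hf₁ ⟨ht₁, h22⟩
  have hw₁ (x : ℕ) (hx : x ≠ 22) : Loc.ivar x ∉ (eligCode ind r).writes :=
    fun h => hx (by simpa using writes_eligCode _ _ h)
  have e20 := hf₁.ivar (hw₁ 20 (by norm_num))
  have e1 := hf₁.ivar (hw₁ 1 (by norm_num))
  have e9 := hf₁.ivar (hw₁ 9 (by norm_num))
  have e2 : s₁.iarr 2 = _ := hf₁.iarr fun h => by simpa using writes_eligCode _ _ h
  simp only [State.ivar_setIvar, State.iarr_setIvar, State.column_setIvar, Nat.reduceEqDiff,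
    if_true, if_false, OfNat.one_ne_ofNat, h1, h9] at e20 e1 e9 e2 h22
  rw [State.tuple_setIvar _ (by norm_num), State.tuple_setIvar _ (by norm_num)] at h22
  by_cases he : Elig ind n (s.column r) s.tuple (s.iarr 0 t)
  swap
  · simp only [h22, he, if_false, if_true]
    refine ⟨by unfold greedyStepCost; omega, ?_⟩
    ext i
    simp only [State.support, Set.mem_ofPred_eq, State.iarr_setIvar, e2, hsame, hsucc]
    refine (or_iff_left ?_).symm
    rintro ⟨hi, he', -⟩
    exact he (hi ▸ he')
  have hset : {i : Fin n | Function.update (s.iarr 2) (s.iarr 0 t) 1 i ≠ 0} =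
      insert ⟨s.iarr 0 t, hn⟩ (G t) := by
    ext i
    by_cases hi : (i : ℕ) = s.iarr 0 t
    · have : i = ⟨s.iarr 0 t, hn⟩ := Fin.ext hi
      simp [this]
    · have : i ≠ ⟨s.iarr 0 t, hn⟩ := fun h => hi (by rw [h])
      simp only [Set.mem_ofPred_eq, Function.update_of_ne hi, hsame, Set.mem_insert_iff, this,
        false_or]
  simp only [h22, he, if_true, if_false, one_ne_zero, e20, e1, e2, State.iarr_setIarr,
    State.ivar_setIarr, hset, e9]
  by_cases hm : mem (insert ⟨s.iarr 0 t, hn⟩ (G t))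
  · simp only [hm, if_true, if_false, one_ne_zero]
    refine ⟨by unfold greedyStepCost; omega, ?_⟩
    simp only [State.support, State.iarr_setIvar, State.iarr_setIarr, if_true, e2, hset]
    ext i
    simp only [hsucc, Set.mem_insert_iff]
    constructor
    · rintro (rfl | hi)
      · exact Or.inr ⟨rfl, he, hm⟩
      · exact Or.inl hi
    · rintro (hi | ⟨hi, -⟩)
      · exact Or.inr hi
      · exact Or.inl (Fin.ext hi)
  · simp only [hm, if_true, if_false]
    refine ⟨by unfold greedyStepCost; omega, ?_⟩
    have hnot : ⟨s.iarr 0 t, hn⟩ ∉ G t := fun h => hm (by rwa [Set.insert_eq_of_mem h])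
    ext i
    simp only [State.support, State.iarr_setIvar, State.iarr_setIarr, if_true, e2,
      Set.mem_ofPred_eq, Function.update_idem, hsucc]
    by_cases hi : (i : ℕ) = s.iarr 0 t
    · obtain rfl : i = ⟨s.iarr 0 t, hn⟩ := Fin.ext hi
      simp [hm, hnot]
    · rw [Function.update_of_ne hi, hsame]
      simp [hi]

lemma run_greedyCode (hmem : mem ∅) (ind : Bool) {s : State} (h0 : s.ivar 0 = n)
    (h1 : s.ivar 1 = 1) (h9 : s.ivar 9 = 0) :
    Run mem f (greedyCode ind r) s fun t s' => t ≤ greedyCost r n (s.ivar 3) ∧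
      s'.support n 2 =
        greedySet mem (Elig ind n (s.column r) s.tuple) (s.iarr 0) (s.ivar 3) := by
  simp only [greedyCode, run_seq, run_instr, Instr.effect]
  refine (Run.forLoop (T := 1) (fun k s' => ∀ j < k, s'.iarr 2 j = 0) (by simpa) (by simp)
    (by norm_num) (by simp [Prog.writes, Instr.target]) (by simp) ?_).imp ?_
  · intro k s' _ _ hf hi hI
    have e9 := hf.ivar (x := 9) (by simp [writes_forLoop, Prog.writes, Instr.target])
    simp only [State.ivar_setIvar, Nat.reduceEqDiff, if_false, h9] at e9
    simp only [run_instr, Instr.effect]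
    refine ⟨le_rfl, fun v j hj => ?_⟩
    rcases Nat.lt_succ_iff_lt_or_eq.1 hj with hj | rfl
    · simp [hi, hj.ne, hI j hj]
    · simp [hi, e9]
  rintro t₁ s₁ hf₁ ⟨ht₁, hI⟩
  have e₁ (x : ℕ) (hx : x ≠ 5) (hx' : x ≠ 12) : s₁.ivar x = s.ivar x := by
    rw [hf₁.ivar (by simp [writes_forLoop, Prog.writes, Instr.target]; omega)]
    simp [hx']
  have hcol₁ : s₁.column r = s.column r := (State.column_eq_of_frame hf₁ fun i _ => by
    simp [writes_forLoop, Prog.writes, Instr.target]).trans (s.column_setIvar 12 0)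
  have htup₁ : s₁.tuple = s.tuple := (State.tuple_eq_of_frame hf₁ fun x hx => by
    simp [writes_forLoop, Prog.writes, Instr.target]; omega).trans (s.tuple_setIvar (by norm_num) 0)
  have hσ₁ : s₁.iarr 0 = s.iarr 0 := hf₁.iarr (by
    simp [writes_forLoop, Prog.writes, Instr.target])
  simp only [State.ivar_setIvar, OfNat.zero_ne_ofNat, if_true, if_false, h0] at ht₁ hI
  have hwr (x : ℕ) (hx : x ∉ ({5, 18, 19, 20, 22} : Set ℕ)) :
      Loc.ivar x ∉ (greedyStep ind r).writes := fun h => hx <| by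
    simpa using writes_greedyStep ind r h
  refine (Run.forLoop (T := greedyStepCost r) (fun k s' =>
    s'.support n 2 = greedySet mem (Elig ind n (s.column r) s.tuple) (s.iarr 0) k)
    (by simp [e₁, h1]) (by simp) (by norm_num)
    ⟨hwr 12 (by simp), hwr 3 (by simp), hwr 1 (by simp)⟩ ?_ ?_).imp ?_
  · intro v
    ext i
    simp [State.support, greedySet, hI i i.2]
  · intro k s' _ hk hf hi hI
    have hwf (x : ℕ) (hx : x ≠ 12) (hx' : x ∉ ({5, 18, 19, 20, 22} : Set ℕ)) :
        Loc.ivar x ∉ (forLoop 12 3 (greedyStep ind r)).writes := by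
      rw [writes_forLoop]
      have h := hwr x hx'
      simp only [Set.mem_union, Set.mem_insert_iff, Set.mem_singleton_iff, Loc.ivar.injEq,
        not_or] at hx' ⊢
      exact ⟨h, hx, hx'.1⟩
    have hcol : s'.column r = s.column r := (State.column_eq_of_frame hf fun i _ h => by
      rw [writes_forLoop] at h
      rcases h with h | h
      · simpa using writes_greedyStep ind r h
      · simp at h).trans hcol₁
    have htup : s'.tuple = s.tuple := (State.tuple_eq_of_frame hf fun x hx =>
      hwf x (by omega) (by simp; omega)).trans ((State.tuple_setIvar _ (by norm_num) _).trans htup₁)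
    have hσ : s'.iarr 0 = s.iarr 0 := (hf.iarr fun h => by
      rw [writes_forLoop] at h
      rcases h with h | h
      · simpa using writes_greedyStep ind r h
      · simp at h).trans hσ₁
    have e (x : ℕ) (hx : x ≠ 12) (hx' : x ∉ ({5, 18, 19, 20, 22} : Set ℕ)) :
        s'.ivar x = s.ivar x := by
      rw [hf.ivar (hwf x hx hx')]
      simp only [Set.mem_insert_iff, Set.mem_singleton_iff, not_or] at hx'
      simp [e₁ x hx'.1 hx, hx]
    have := run_greedyStep (mem := mem) (f := f) hmem ind (s := s') (t := k)
      ((e 0 (by norm_num) (by simp)).trans h0) ((e 1 (by norm_num) (by simp)).trans h1)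
      ((e 9 (by norm_num) (by simp)).trans h9) hi (by rw [hcol, htup, hσ, hI])
    refine this.imp ?_
    rintro t s'' - ⟨ht, hs''⟩
    rw [hcol, htup, hσ] at hs''
    exact ⟨ht, fun v => hs''⟩
  · rintro t s' - ⟨ht, hs'⟩
    have e3 : (s₁.setIvar 12 0).ivar 3 = s.ivar 3 := by simp [e₁]
    rw [e3] at hs' ht
    refine ⟨?_, hs'⟩
    unfold greedyCost
    simp only [State.ivar_setIvar, if_true, Nat.sub_zero] at ht ht₁
    omega

/-! ### Evaluation of a candidate -/

open Classical in
/-- The sum of the columns in `G`, which is the image of the incidence vector of `G`. -/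
noncomputable def imagePoint (a : ℕ → Fin r → ℝ) (G : Set (Fin n)) (i : Fin r) : ℝ :=
  ∑ j : Fin n, if j ∈ G then a j i else 0

/-- Stores the entry `i` of the sum of the columns in the current set. -/
def rowSum (r i : ℕ) : Prog :=
  .seq (.instr (.rconst 1 0)) (.seq (.instr (.iconst 12 0))
    (.seq (forLoop 12 0 (.seq (.instr (.iload 20 2 12))
      (.ite 20 (.seq (.instr (.rload 2 i 12)) (.instr (.radd 1 1 2))) (.instr (.iconst 5 0)))))
      (.seq (.instr (.iconst 20 i)) (.instr (.rstore r 20 1)))))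

/-- Stores the first `k` entries of the sum of the columns in the current set. -/
def sumCode (r : ℕ) : ℕ → Prog
  | 0 => .instr (.iconst 5 0)
  | k + 1 => .seq (sumCode r k) (rowSum r k)

/-- The parts of the memory that `sumCode` may overwrite. -/
def sumScratch (r : ℕ) : Set Loc :=
  Loc.ivar '' {5, 12, 20} ∪ Loc.rvar '' {1, 2} ∪ {.rarr r}

lemma writes_rowSum (r i : ℕ) : (rowSum r i).writes ⊆ sumScratch r := by
  simp only [rowSum, Prog.writes, Instr.target, writes_forLoop, Set.union_subset_iff,
    Set.singleton_subset_iff, Set.insert_subset_iff]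
  simp [sumScratch]

lemma writes_sumCode (r k : ℕ) : (sumCode r k).writes ⊆ sumScratch r := by
  induction k with
  | zero => simp [sumCode, Prog.writes, Instr.target, sumScratch]
  | succ k ih => exact Set.union_subset ih (writes_rowSum r k)

lemma run_rowSum {s : State} (h0 : s.ivar 0 = n) (h1 : s.ivar 1 = 1) {i : ℕ} (hi : i < r) :
    Run mem f (rowSum r i) s fun t s' => t ≤ n * 7 + 6 ∧
      s'.rarr r = Function.update (s.rarr r) i
        (imagePoint (s.column r) (s.support n 2) ⟨i, hi⟩) := by
  classical
  simp only [rowSum, run_seq, run_instr, Instr.effect]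
  refine (Run.forLoop (T := 4) (fun k s' =>
    s'.rvar 1 = ∑ j ∈ Finset.range k, if s.iarr 2 j ≠ 0 then s.rarr i j else 0) (by simpa)
    (by simp) (by norm_num) (by simp [Prog.writes, Instr.target]) (by simp) ?_).imp ?_
  · intro k s' _ _ hf hk hI
    have e2 : s'.iarr 2 = s.iarr 2 :=
      hf.iarr (by simp [writes_forLoop, Prog.writes, Instr.target])
    have ei : s'.rarr i = s.rarr i :=
      hf.rarr (by simp [writes_forLoop, Prog.writes, Instr.target])
    simp only [run_seq, run_instr, Instr.effect, run_ite, State.ivar_setIvar, if_true, hk, e2]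
    by_cases h : s.iarr 2 k = 0
    · simp [h, Finset.sum_range_succ, hI]
    · simp [h, Finset.sum_range_succ, hI, ei]
  · rintro t s' hf ⟨ht, hs'⟩
    have er : s'.rarr r = s.rarr r :=
      hf.rarr (by simp [writes_forLoop, Prog.writes, Instr.target])
    simp only [State.ivar_setIvar, State.ivar_setRvar, OfNat.zero_ne_ofNat, if_true, if_false,
      h0] at ht hs'
    simp only [State.ivar_setIvar, State.rvar_setIvar, State.rarr_setIvar, State.rarr_setRarr,
      if_true, er, hs', Finset.sum_range]
    refine ⟨by omega, ?_⟩
    refine congrArg _ (Finset.sum_congr rfl fun j _ => ?_)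
    by_cases h : s.iarr 2 j = 0 <;> simp [State.support, State.column, h]

lemma run_sumCode {s : State} (h0 : s.ivar 0 = n) (h1 : s.ivar 1 = 1) {k : ℕ} (hk : k ≤ r) :
    Run mem f (sumCode r k) s fun t s' => t ≤ k * (n * 7 + 6) + 1 ∧
      ∀ i : Fin r, (i : ℕ) < k →
        s'.rarr r i = imagePoint (s.column r) (s.support n 2) i := by
  induction k with
  | zero => simp [sumCode, run_instr]
  | succ k ih =>
    rw [sumCode, run_seq]
    refine (ih (by omega)).imp ?_
    rintro t₁ s₁ hf₁ ⟨ht₁, hs₁⟩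
    have e₁ (x : ℕ) (hx : x < 5) : s₁.ivar x = s.ivar x := hf₁.ivar fun h => by
      have := writes_sumCode r k h
      simp [sumScratch] at this
      omega
    have hcol₁ : s₁.column r = s.column r := State.column_eq_of_frame hf₁ fun i hi h => by
      have := writes_sumCode r k h
      simp [sumScratch] at this
      omega
    have hsup₁ : s₁.support n 2 = s.support n 2 := by
      have : s₁.iarr 2 = s.iarr 2 := hf₁.iarr fun h => by
        simpa [sumScratch] using writes_sumCode r k h
      simp [State.support, this]
    refine (run_rowSum ((e₁ 0 (by norm_num)).trans h0) ((e₁ 1 (by norm_num)).trans h1) hk).imp ?_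
    rintro t₂ s₂ - ⟨ht₂, hs₂⟩
    refine ⟨by rw [add_one_mul]; omega, fun i hi => ?_⟩
    rw [hs₂, hcol₁, hsup₁]
    rcases Nat.lt_succ_iff_lt_or_eq.1 hi with hi | hi
    · rw [Function.update_of_ne hi.ne, hs₁ i hi]
    · rw [hi, Function.update_self]
      exact congrArg _ (Fin.ext hi.symm)

@[simp] lemma State.support_setIvar (s : State) (x k b : ℕ) :
    (s.setIvar x k).support n b = s.support n b := rfl

@[simp] lemma State.support_setRvar (s : State) (u : ℕ) (c : ℝ) (b : ℕ) :
    (s.setRvar u c).support n b = s.support n b := rfl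

/-- Makes the current set, with its value in the real variable `1`, the incumbent.  A real variable
is copied by adding zero. -/
def replaceCode : Prog :=
  .seq (copyCode 2 3 0) (.seq (.instr (.rconst 2 0)) (.seq (.instr (.radd 0 1 2))
    (.instr (.iconst 4 1))))

/-- Evaluates the function oracle at the stored point, and replaces the incumbent, kept in the
integer array `3` with its value in the real variable `0`, if there is none yet or the new value is
larger. -/
def updateCode (r : ℕ) : Prog :=
  .seq (.instr (.value 1 r))
    (.seq (.ite 4 (.instr (.rlt 18 0 1)) (.instr (.iconst 18 1)))
      (.ite 18 replaceCode (.instr (.iconst 5 0))))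

/-- Generates and evaluates the candidate that belongs to the current tuple. -/
def candidateCode (ind : Bool) (r : ℕ) : Prog :=
  .seq (sortCode r) (.seq (greedyCode ind r) (.seq (sumCode r r) (updateCode r)))

/-- The parts of the memory that `candidateCode` may overwrite. -/
def candidateScratch (r : ℕ) : Set Loc :=
  Loc.ivar '' ({4, 5} ∪ Set.Ico 10 100) ∪ Loc.iarr '' {0, 1, 2, 3} ∪ Loc.rvar '' Set.univ ∪
    {.rarr r}

lemma writes_updateCode (r : ℕ) : (updateCode r).writes ⊆
    Loc.ivar '' {4, 5, 12, 18, 20} ∪ {.iarr 3} ∪ Loc.rvar '' {0, 1, 2} := by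
  simp only [updateCode, replaceCode, copyCode, Prog.writes, Instr.target, writes_forLoop,
    Set.union_subset_iff, Set.singleton_subset_iff, Set.insert_subset_iff]
  simp

lemma writes_greedyCode (ind : Bool) (r : ℕ) : (greedyCode ind r).writes ⊆
    Loc.ivar '' {5, 12, 18, 19, 20, 22} ∪ {.iarr 2} ∪ Loc.rvar '' Set.Ici 3 := by
  have h : (greedyStep ind r).writes ⊆
      Loc.ivar '' {5, 12, 18, 19, 20, 22} ∪ {.iarr 2} ∪ Loc.rvar '' Set.Ici 3 := by
    refine (writes_greedyStep ind r).trans (Set.union_subset_union_left _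
      (Set.union_subset_union_left _ (Set.image_mono ?_)))
    intro x
    simp
    tauto
  simp only [greedyCode, Prog.writes, Instr.target, writes_forLoop, Set.union_subset_iff,
    Set.singleton_subset_iff, Set.insert_subset_iff, h]
  simp

lemma writes_candidateCode (ind : Bool) (r : ℕ) :
    (candidateCode ind r).writes ⊆ candidateScratch r := by
  simp only [candidateCode, Prog.writes, Set.union_subset_iff]
  refine ⟨(writes_sortCode r).trans ?_, (writes_greedyCode ind r).trans ?_,
    (writes_sumCode r r).trans ?_, (writes_updateCode r).trans ?_⟩
  all_goals
    rintro (x | x | x | x) h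
    all_goals
      simp [candidateScratch, passScratch, sumScratch] at h ⊢
      try omega

/-- The sequence `σ` lists all indices below `N` in descending order of the keys for the tuple `p`,
columns with equal keys in any order. -/
structure IsOrder (a : ℕ → Fin r → ℝ) (p : ℕ → ℕ) (N : ℕ) (σ : ℕ → ℕ) : Prop where
  sorted : ∀ t t', t < t' → t' < N → ¬ Below a p (σ t) (σ t')
  surj : ∀ e < N, ∃ t < N, σ t = e

/-- The candidate set for a tuple `p`, given a listing `σ` of the columns in descending order. -/
def candidate (mem : Set (Fin n) → Prop) (ind : Bool) (a : ℕ → Fin r → ℝ) (p : ℕ → ℕ) (N : ℕ)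
    (σ : ℕ → ℕ) : Set (Fin n) :=
  greedySet mem (Elig ind n a p) σ N

/-- The invariant of the search: the inputs are in place, and the incumbent, if there is one, is
feasible and stored with its value.  The incumbent exists if variable `4` is nonzero. -/
structure Searching (f : (Fin r → ℝ) → ℝ) (feas : Set (Fin n) → Prop) (a : ℕ → Fin r → ℝ)
    (M N : ℕ) (s : State) : Prop where
  h0 : s.ivar 0 = n
  h1 : s.ivar 1 = 1
  h2 : s.ivar 2 = M
  h3 : s.ivar 3 = N
  h9 : s.ivar 9 = 0
  column : s.column r = a
  incumbent : s.ivar 4 ≠ 0 →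
    feas (s.support n 3) ∧ f (imagePoint a (s.support n 3)) = s.rvar 0

/-- The incumbent is at least as good as a candidate for the tuple `p`. -/
def Searched (mem : Set (Fin n) → Prop) (f : (Fin r → ℝ) → ℝ) (ind : Bool) (a : ℕ → Fin r → ℝ)
    (N : ℕ) (p : ℕ → ℕ) (s : State) : Prop :=
  s.ivar 4 ≠ 0 ∧ ∃ σ, IsOrder a p N σ ∧ f (imagePoint a (candidate mem ind a p N σ)) ≤ s.rvar 0

/-- A bound for the running time of `candidateCode` on `N = 2 ^ K` indices. -/
def candidateCost (r n N K : ℕ) : ℕ :=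
  sortCost r N K + greedyCost r n N + (r * (n * 7 + 6) + 1) + (n * 5 + 11)

lemma run_replaceCode {feas : Set (Fin n) → Prop} {a : ℕ → Fin r → ℝ} {M N : ℕ} {s : State}
    (hs : Searching f feas a M N s) (hfeas : feas (s.support n 2)) (k : ℕ)
    (h : s.ivar 4 ≠ 0 → s.rvar 0 ≤ f (imagePoint a (s.support n 2))) :
    Run mem f replaceCode ((s.setRvar 1 (f (imagePoint a (s.support n 2)))).setIvar 18 k)
      fun t s' => t ≤ n * 5 + 6 ∧ Searching f feas a M N s' ∧
      s'.ivar 4 ≠ 0 ∧ f (imagePoint a (s.support n 2)) ≤ s'.rvar 0 ∧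
      (s.ivar 4 ≠ 0 → s.rvar 0 ≤ s'.rvar 0) := by
  rw [replaceCode, run_seq]
  refine (run_copyCode (by norm_num) (by norm_num) (by simp [hs.h1])).imp ?_
  rintro t s₁ hf₁ ⟨ht, hcopy⟩
  have e (x : ℕ) (hx : x ∉ ({5, 12, 18, 20} : Set ℕ)) : s₁.ivar x = s.ivar x := by
    simp only [Set.mem_insert_iff, Set.mem_singleton_iff, not_or] at hx
    rw [hf₁.ivar (by simp [copyCode, writes_forLoop, Prog.writes, Instr.target]; omega)]
    simp [hx]
  have er := hf₁.rvar (u := 1)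
    (by simp [copyCode, writes_forLoop, Prog.writes, Instr.target])
  have hcol : s₁.column r = a := (State.column_eq_of_frame hf₁ fun i _ => by
    simp [copyCode, writes_forLoop, Prog.writes, Instr.target]).trans hs.column
  simp only [State.ivar_setIvar, State.ivar_setRvar, hs.h0, OfNat.zero_ne_ofNat, if_false,
    State.iarr_setIvar, State.iarr_setRvar] at ht hcopy
  have hsup : s₁.support n 3 = s.support n 2 := by
    ext i
    simp [State.support, hcopy i i.2]
  simp only [State.rvar_setIvar, State.rvar_setRvar, if_true] at er
  simp only [run_seq, run_instr, Instr.effect, State.rvar_setIvar, State.rvar_setRvar,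
    State.ivar_setIvar, if_true, if_false, Nat.cast_zero, add_zero, er,
    OfNat.one_ne_ofNat, one_ne_zero, ne_eq, not_false_eq_true, le_refl, true_and]
  refine ⟨by omega, ⟨?_, ?_, ?_, ?_, ?_, hcol, fun _ => ?_⟩, h⟩
  · simp [e, hs.h0]
  · simp [e, hs.h1]
  · simp [e, hs.h2]
  · simp [e, hs.h3]
  · simp [e, hs.h9]
  · simpa [hsup] using hfeas

lemma run_updateCode {feas : Set (Fin n) → Prop} {a : ℕ → Fin r → ℝ} {M N : ℕ} {s : State}
    (hs : Searching f feas a M N s) (hfeas : feas (s.support n 2))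
    (hr : ∀ i : Fin r, s.rarr r i = imagePoint a (s.support n 2) i) :
    Run mem f (updateCode r) s fun t s' => t ≤ n * 5 + 11 ∧ Searching f feas a M N s' ∧
      s'.ivar 4 ≠ 0 ∧ f (imagePoint a (s.support n 2)) ≤ s'.rvar 0 ∧
      (s.ivar 4 ≠ 0 → s.rvar 0 ≤ s'.rvar 0) := by
  have hval : (fun i : Fin r => s.rarr r i) = imagePoint a (s.support n 2) := funext hr
  simp only [updateCode, run_seq, run_instr, Instr.effect, run_ite, State.ivar_setRvar,
    State.ivar_setIvar, State.rvar_setRvar, if_true, one_ne_zero, if_false, hval]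
  by_cases h4 : s.ivar 4 = 0
  · simp only [h4, if_true]
    refine (run_replaceCode hs hfeas 1 fun h => absurd h4 h).imp ?_
    rintro t s' - ⟨ht, h⟩
    rw [h4] at h
    exact ⟨by omega, h⟩
  · simp only [h4, if_false]
    by_cases hlt : s.rvar 0 < f (imagePoint a (s.support n 2))
    · simp only [zero_ne_one, if_false, hlt, if_true, one_ne_zero]
      refine (run_replaceCode hs hfeas 1 fun _ => hlt.le).imp ?_
      rintro t s' - ⟨ht, h⟩
      exact ⟨by omega, by simpa [h4] using h⟩
    · simp only [zero_ne_one, if_false, hlt, if_true]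
      refine ⟨by omega, ⟨?_, ?_, ?_, ?_, ?_, hs.column, ?_⟩, ?_, ?_, ?_⟩
      · simp [hs.h0]
      · simp [hs.h1]
      · simp [hs.h2]
      · simp [hs.h3]
      · simp [hs.h9]
      · intro _
        obtain ⟨h₁, h₂⟩ := hs.incumbent h4
        exact ⟨h₁, by simpa using h₂⟩
      · simpa using h4
      · simpa using hlt
      · simp

lemma run_candidateCode (hmem : mem ∅) (ind : Bool) {feas : Set (Fin n) → Prop}
    {a : ℕ → Fin r → ℝ} {M K : ℕ}
    (hfeas : ∀ p σ, IsOrder a p (2 ^ K) σ → feas (candidate mem ind a p (2 ^ K) σ))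
    {s : State} (hs : Searching f feas a M (2 ^ K) s) :
    Run mem f (candidateCode ind r) s fun t s' => t ≤ candidateCost r n (2 ^ K) K ∧
      Searching f feas a M (2 ^ K) s' ∧ Searched mem f ind a (2 ^ K) s.tuple s' ∧
      ∀ p, Searched mem f ind a (2 ^ K) p s → Searched mem f ind a (2 ^ K) p s' := by
  simp only [candidateCode, run_seq]
  refine (run_sortCode hs.h1 hs.h9 hs.h3).imp ?_
  rintro t₁ s₁ hf₁ ⟨ht₁, hsort, hsurj⟩
  have e₁ (x : ℕ) (hx : x ≠ 5) (hx' : x < 10) : s₁.ivar x = s.ivar x := hf₁.ivar fun h => by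
    have := writes_sortCode r h
    simp [passScratch] at this
    omega
  have hcol₁ : s₁.column r = a := (State.column_eq_of_frame hf₁ fun i _ h => by
    simpa [passScratch] using writes_sortCode r h).trans hs.column
  have htup₁ : s₁.tuple = s.tuple := State.tuple_eq_of_frame hf₁ fun x hx h => by
    have := writes_sortCode r h
    simp [passScratch] at this
    omega
  have e₁0 : s₁.rvar 0 = s.rvar 0 := hf₁.rvar fun h => by
    simpa [passScratch] using writes_sortCode r h
  have e₁3 : s₁.iarr 3 = s.iarr 3 := hf₁.iarr fun h => by
    simpa [passScratch] using writes_sortCode r h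
  refine (run_greedyCode hmem ind ((e₁ 0 (by norm_num) (by norm_num)).trans hs.h0)
    ((e₁ 1 (by norm_num) (by norm_num)).trans hs.h1)
    ((e₁ 9 (by norm_num) (by norm_num)).trans hs.h9)).imp ?_
  rintro t₂ s₂ hf₂ ⟨ht₂, hsup₂⟩
  rw [hcol₁, htup₁, e₁ 3 (by norm_num) (by norm_num), hs.h3] at hsup₂
  rw [e₁ 3 (by norm_num) (by norm_num), hs.h3] at ht₂
  have e₂ (x : ℕ) (hx : x ≠ 5) (hx' : x < 10) : s₂.ivar x = s.ivar x :=
    (hf₂.ivar fun h => by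
      have := writes_greedyCode ind r h
      simp at this
      omega).trans (e₁ x hx hx')
  have hcol₂ : s₂.column r = a := (State.column_eq_of_frame hf₂ fun i _ h => by
    simpa using writes_greedyCode ind r h).trans hcol₁
  have e₂0 : s₂.rvar 0 = s.rvar 0 := (hf₂.rvar fun h => by
    simpa using writes_greedyCode ind r h).trans e₁0
  have e₂3 : s₂.iarr 3 = s.iarr 3 := (hf₂.iarr fun h => by
    simpa using writes_greedyCode ind r h).trans e₁3
  refine (run_sumCode ((e₂ 0 (by norm_num) (by norm_num)).trans hs.h0)
    ((e₂ 1 (by norm_num) (by norm_num)).trans hs.h1) le_rfl).imp ?_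
  rintro t₃ s₃ hf₃ ⟨ht₃, hsum⟩
  have hsc := writes_sumCode r r
  have e₃ (x : ℕ) (hx : x ≠ 5) (hx' : x < 10) : s₃.ivar x = s.ivar x :=
    (hf₃.ivar fun h => by
      have := hsc h
      simp [sumScratch] at this
      omega).trans (e₂ x hx hx')
  have hcol₃ : s₃.column r = a := (State.column_eq_of_frame hf₃ fun i hi h => by
    have := hsc h
    simp [sumScratch] at this
    omega).trans hcol₂
  have e₃0 : s₃.rvar 0 = s.rvar 0 := (hf₃.rvar fun h => by
    simpa [sumScratch] using hsc h).trans e₂0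
  have e₃i (b : ℕ) : s₃.iarr b = s₂.iarr b := hf₃.iarr fun h => by
    simpa [sumScratch] using hsc h
  have hsup₃ : s₃.support n 2 = candidate mem ind a s.tuple (2 ^ K) (s₁.iarr 0) := by
    rw [candidate, ← hsup₂]
    simp [State.support, e₃i]
  have horder : IsOrder a s.tuple (2 ^ K) (s₁.iarr 0) := ⟨by rwa [hs.column] at hsort, hsurj⟩
  have hsearch : Searching f feas a M (2 ^ K) s₃ := by
    refine ⟨?_, ?_, ?_, ?_, ?_, hcol₃, ?_⟩
    · rw [e₃ 0 (by norm_num) (by norm_num), hs.h0]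
    · rw [e₃ 1 (by norm_num) (by norm_num), hs.h1]
    · rw [e₃ 2 (by norm_num) (by norm_num), hs.h2]
    · rw [e₃ 3 (by norm_num) (by norm_num), hs.h3]
    · rw [e₃ 9 (by norm_num) (by norm_num), hs.h9]
    · have : s₃.support n 3 = s.support n 3 := by simp [State.support, e₃i, e₂3]
      rw [e₃ 4 (by norm_num) (by norm_num), this, e₃0]
      exact hs.incumbent
  refine (run_updateCode hsearch (by rw [hsup₃]; exact hfeas _ _ horder) ?_).imp ?_
  · intro i
    rw [hsum i i.2, hcol₂]
    congr 1
    simp [State.support, e₃i]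
  rintro t₄ s₄ - ⟨ht₄, hs₄, h4, hle, hmono⟩
  rw [e₃ 4 (by norm_num) (by norm_num), e₃0] at hmono
  refine ⟨?_, hs₄, ⟨h4, s₁.iarr 0, horder, by rwa [hsup₃] at hle⟩, ?_⟩
  · unfold candidateCost
    omega
  · rintro p ⟨h4', σ, hσ, hσ'⟩
    exact ⟨h4, σ, hσ, hσ'.trans (hmono h4')⟩

/-! ### Enumeration of the tuples -/

/-- The least admissible entry number `l` of a tuple.  The last two entries only range over the
columns that have been appended to the matrix. -/
def tupleStart (r n l : ℕ) : ℕ := if l < 2 * r - 2 then 0 else n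

/-- Runs `body` for all admissible values of the first `l` entries of the tuple. -/
def enumCode (r : ℕ) (body : Prog) : ℕ → Prog
  | 0 => body
  | l + 1 =>
    .seq (.instr (if l < 2 * r - 2 then .iconst (100 + l) 0 else .iadd (100 + l) 0 9))
      (forLoop (100 + l) 2 (enumCode r body l))

/-- A bound for the running time of `enumCode`, for a body with running time `T`. -/
def enumCost (r n T : ℕ) : ℕ → ℕ
  | 0 => T
  | l + 1 => (n + 1 + r - tupleStart r n l) * (enumCost r n T l + 3) + 3

lemma Searching.setIvar {feas : Set (Fin n) → Prop} {a : ℕ → Fin r → ℝ} {M N : ℕ} {s : State}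
    (hs : Searching f feas a M N s) {x : ℕ} (hx : x = 5 ∨ 10 ≤ x) (k : ℕ) :
    Searching f feas a M N (s.setIvar x k) := by
  have h (y : ℕ) (hy : y ≠ 5 ∧ y < 10) : (s.setIvar x k).ivar y = s.ivar y := by
    have : y ≠ x := by omega
    simp [this]
  exact ⟨(h 0 (by norm_num)).trans hs.h0, (h 1 (by norm_num)).trans hs.h1,
    (h 2 (by norm_num)).trans hs.h2, (h 3 (by norm_num)).trans hs.h3,
    (h 9 (by norm_num)).trans hs.h9, hs.column, by rw [h 4 (by norm_num)]; exact hs.incumbent⟩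

lemma Searched.setIvar {ind : Bool} {a : ℕ → Fin r → ℝ} {N : ℕ} {p : ℕ → ℕ} {s : State}
    (hs : Searched mem f ind a N p s) {x : ℕ} (hx : x = 5 ∨ 10 ≤ x) (k : ℕ) :
    Searched mem f ind a N p (s.setIvar x k) := by
  have h : (s.setIvar x k).ivar 4 = s.ivar 4 := by
    have : 4 ≠ x := by omega
    simp [this]
  exact ⟨by rw [h]; exact hs.1, hs.2⟩

lemma writes_enumCode (ind : Bool) (r l : ℕ) :
    (enumCode r (candidateCode ind r) l).writes ⊆
      candidateScratch r ∪ Loc.ivar '' Set.Ico 100 (100 + l) := by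
  induction l with
  | zero => exact (writes_candidateCode ind r).trans Set.subset_union_left
  | succ l ih =>
    have h : Loc.ivar '' Set.Ico 100 (100 + l) ⊆ Loc.ivar '' Set.Ico 100 (100 + (l + 1)) :=
      Set.image_mono (Set.Ico_subset_Ico_right (by omega))
    have hi : (if l < 2 * r - 2 then Instr.iconst (100 + l) 0 else .iadd (100 + l) 0 9).target =
        .ivar (100 + l) := by
      split_ifs <;> rfl
    simp only [enumCode, Prog.writes, writes_forLoop, hi, Set.union_subset_iff,
      Set.singleton_subset_iff, Set.insert_subset_iff,
      ih.trans (Set.union_subset_union_right _ h)]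
    simp [candidateScratch]

lemma run_enumCode (hmem : mem ∅) (ind : Bool) {feas : Set (Fin n) → Prop}
    {a : ℕ → Fin r → ℝ} {K : ℕ}
    (hfeas : ∀ p σ, IsOrder a p (2 ^ K) σ → feas (candidate mem ind a p (2 ^ K) σ)) (l : ℕ)
    {s : State} (hs : Searching f feas a (n + 1 + r) (2 ^ K) s) :
    Run mem f (enumCode r (candidateCode ind r) l) s fun t s' =>
      t ≤ enumCost r n (candidateCost r n (2 ^ K) K) l ∧
      Searching f feas a (n + 1 + r) (2 ^ K) s' ∧
      (∀ q : ℕ → ℕ, (∀ l' < l, tupleStart r n l' ≤ q l' ∧ q l' < n + 1 + r) →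
        (∀ l' ≥ l, q l' = s.tuple l') → Searched mem f ind a (2 ^ K) q s') ∧
      ∀ q, Searched mem f ind a (2 ^ K) q s → Searched mem f ind a (2 ^ K) q s' := by
  induction l generalizing s with
  | zero =>
    refine (run_candidateCode hmem ind hfeas hs).imp ?_
    rintro t s' - ⟨ht, h₁, h₂, h₃⟩
    refine ⟨ht, h₁, fun q _ hq => ?_, h₃⟩
    rwa [show q = s.tuple from funext fun l' => hq l' (Nat.zero_le _)]
  | succ l ih =>
    rw [enumCode, run_seq, run_instr]
    have heff : (if l < 2 * r - 2 then Instr.iconst (100 + l) 0 else .iadd (100 + l) 0 9).effect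
        mem f s = s.setIvar (100 + l) (tupleStart r n l) := by
      unfold tupleStart
      split_ifs
      · rfl
      · simp [Instr.effect, hs.h0, hs.h9]
    rw [heff]
    set s₀ := s.setIvar (100 + l) (tupleStart r n l) with hs₀
    have hs₀' : Searching f feas a (n + 1 + r) (2 ^ K) s₀ := hs.setIvar (by omega) _
    have hstart : s₀.ivar (100 + l) = tupleStart r n l := by simp [s₀]
    have hle : tupleStart r n l ≤ n + 1 + r := by
      unfold tupleStart
      split_ifs <;> omega
    have hw (x : ℕ) (hx : x = 1 ∨ x = 2 ∨ 100 + l ≤ x) :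
        Loc.ivar x ∉ (enumCode r (candidateCode ind r) l).writes := fun h => by
      have := writes_enumCode ind r l h
      simp [candidateScratch] at this
      omega
    refine (Run.forLoop (T := enumCost r n (candidateCost r n (2 ^ K) K) l) (fun k s' =>
      Searching f feas a (n + 1 + r) (2 ^ K) s' ∧
      (∀ q : ℕ → ℕ, (∀ l' ≤ l, tupleStart r n l' ≤ q l' ∧ q l' < n + 1 + r) → q l < k →
        (∀ l' > l, q l' = s.tuple l') → Searched mem f ind a (2 ^ K) q s') ∧
      ∀ q, Searched mem f ind a (2 ^ K) q s → Searched mem f ind a (2 ^ K) q s')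
      hs₀'.h1 (by rw [hstart, hs₀'.h2]; exact hle) (by omega)
      ⟨hw _ (by omega), hw _ (by omega), hw _ (by omega)⟩ ?_ ?_).imp ?_
    · intro v
      refine ⟨hs₀'.setIvar (Or.inl rfl) v, fun q hq hql => ?_, fun q hq =>
        (hq.setIvar (by omega) _).setIvar (Or.inl rfl) v⟩
      rw [hstart] at hql
      exact absurd hql (not_lt.2 (hq l le_rfl).1)
    · rintro k s' - hk hf hi ⟨hI₁, hI₂, hI₃⟩
      have htup (l' : ℕ) (hl' : l < l') : s'.tuple l' = s.tuple l' := by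
        have h₁ : 100 + l' ≠ 100 + l := by omega
        have : s'.ivar (100 + l') = s₀.ivar (100 + l') := hf.ivar (by
          rw [writes_forLoop]
          have := hw (100 + l') (by omega)
          simp [this]
          omega)
        rw [State.tuple, this]
        simp only [s₀, State.ivar_setIvar, if_neg h₁, State.tuple]
      refine (ih hI₁).imp ?_
      rintro t s'' - ⟨ht, h₁, h₂, h₃⟩
      refine ⟨ht, fun v => ⟨(h₁.setIvar (by omega) _).setIvar (Or.inl rfl) v,
        fun q hq hql hq' => ?_,
        fun q hq => ((h₃ q (hI₃ q hq)).setIvar (by omega) _).setIvar (Or.inl rfl) v⟩⟩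
      refine Searched.setIvar (Searched.setIvar ?_ (by omega) _) (Or.inl rfl) v
      rcases Nat.lt_succ_iff_lt_or_eq.1 hql with hql | hql
      · exact h₃ q (hI₂ q hq hql hq')
      · refine h₂ q (fun l' hl' => hq l' hl'.le) fun l' hl' => ?_
        rcases eq_or_lt_of_le hl' with rfl | hl'
        · rw [hql, State.tuple, hi]
        · rw [hq' l' hl', htup l' hl']
    · rintro t s' - ⟨ht, h₁, h₂, h₃⟩
      rw [hstart, hs₀'.h2] at ht
      rw [hs₀'.h2] at h₂
      refine ⟨by rw [enumCost]; omega, h₁, fun q hq hq' => ?_, h₃⟩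
      exact h₂ q (fun l' hl' => hq l' (by omega)) (hq l (by omega)).2 fun l' hl' => hq' l' hl'

/-! ### Preparation and output -/

/-- The columns of `A`, followed by a zero column with index `n` and the standard basis vectors. -/
noncomputable def extColumn (A : Matrix (Fin r) (Fin n) ℝ) (e : ℕ) (i : Fin r) : ℝ :=
  if h : e < n then A i ⟨e, h⟩ else if e = n + 1 + i then 1 else 0

/-- Appends the first `k` standard basis vectors to the matrix. -/
def basisCode : ℕ → Prog
  | 0 => .instr (.iconst 5 0)
  | k + 1 => .seq (basisCode k) (.seq (.instr (.rstore k 2 1)) (.instr (.iadd 2 2 1)))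

/-- Sets up the constants, computes the least power of two that is at least `n` and extends the
matrix. -/
def setupCode (r : ℕ) : Prog :=
  .seq (.instr (.iconst 1 1)) (.seq (.instr (.iconst 3 1)) (.seq (.instr (.ilt 11 3 0))
    (.seq (.loop 11 (.seq (.instr (.iadd 3 3 3)) (.instr (.ilt 11 3 0))))
      (.seq (.instr (.rconst 1 1)) (.seq (.instr (.iadd 2 0 1)) (basisCode r))))))

/-- Writes the incidence vector of the incumbent to the real array `0`. -/
def outputCode : Prog :=
  .seq (.instr (.rconst 1 1)) (.seq (.instr (.rconst 2 0)) (.seq (.instr (.iconst 12 0))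
    (forLoop 12 0 (.seq (.instr (.iload 20 3 12))
      (.ite 20 (.instr (.rstore 0 12 1)) (.instr (.rstore 0 12 2)))))))

lemma run_basisCode {s : State} (h1 : s.ivar 1 = 1) (hr1 : s.rvar 1 = 1) (k : ℕ) :
    Run mem f (basisCode k) s fun t s' => t ≤ k * 2 + 1 ∧
      (∀ x, x ≠ 2 → x ≠ 5 → s'.ivar x = s.ivar x) ∧ s'.ivar 2 = s.ivar 2 + k ∧ s'.rvar 1 = 1 ∧
      ∀ i, s'.rarr i = if i < k then Function.update (s.rarr i) (s.ivar 2 + i) 1 else s.rarr i := by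
  induction k with
  | zero =>
    simp only [basisCode, run_instr, Instr.effect]
    refine ⟨le_rfl, fun x _ h => by simp [h], by simp, by simpa, by simp⟩
  | succ k ih =>
    simp only [basisCode, run_seq, run_instr, Instr.effect]
    refine ih.imp ?_
    rintro t s' - ⟨ht, hi, h2, hr1', ha⟩
    refine ⟨by omega, fun x hx hx' => by simp [hx, hi x hx hx'], ?_, by simpa, fun i => ?_⟩
    · simp [h2, hi 1 (by norm_num) (by norm_num), h1, add_assoc]
    · rcases lt_trichotomy i k with h | rfl | h
      · simp [h.ne, ha, h, h.trans (Nat.lt_succ_self k)]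
      · simp [ha, h2, hr1']
      · simp [h.ne', ha, h.not_gt, (show ¬ i < k + 1 by omega)]

/-- A bound for the running time of `setupCode`. -/
def setupCost (r n : ℕ) : ℕ := Nat.clog 2 n * 3 + r * 2 + 7

lemma run_setupCode (feas : Set (Fin n) → Prop) (A : Matrix (Fin r) (Fin n) ℝ) :
    Run mem f (setupCode r) (inputState A) fun t s' => t ≤ setupCost r n ∧
      Searching f feas (extColumn A) (n + 1 + r) (2 ^ Nat.clog 2 n) s' ∧ s'.tuple = 0 := by
  simp only [setupCode, run_seq, run_instr, Instr.effect]
  set K := Nat.clog 2 n with hK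
  let J : ℕ → State → Prop := fun k s => k ≤ K ∧ s.ivar 3 = 2 ^ (K - k) ∧
    s.ivar 11 = (if s.ivar 3 < n then 1 else 0) ∧ s.ivar 0 = n ∧ s.ivar 1 = 1 ∧
    (∀ x, x ∉ ({0, 1, 3, 11} : Set ℕ) → s.ivar x = 0) ∧
    s.rarr = (inputState A).rarr
  refine (Run.loop (T := 2) (Q := J 0) J ?_ ?_ K ?_).imp ?_
  · rintro k s ⟨hk, h3, h11, h0, h1, hx, hr⟩
    have hlt : 2 ^ (K - (k + 1)) < n := by
      by_contra h
      have := Nat.clog_le_of_le_pow (not_lt.1 h)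
      omega
    have hdbl : 2 ^ (K - (k + 1)) + 2 ^ (K - (k + 1)) = 2 ^ (K - k) := by
      rw [← two_mul, ← pow_succ']; congr 1; omega
    refine ⟨by simp [h11, h3, hlt], ?_⟩
    simp only [run_seq, run_instr, Instr.effect]
    refine ⟨le_rfl, by omega, by simp [h3, hdbl], by simp [h0], by simp [h0], by simp [h1],
      fun x hx' => ?_, hr⟩
    have := hx x hx'
    simp only [Set.mem_insert_iff, Set.mem_singleton_iff, not_or] at hx'
    simp [hx', this]
  · rintro s hs
    refine ⟨?_, hs⟩
    have h : ¬ 2 ^ K < n := not_lt.2 (Nat.le_pow_clog (by norm_num) n)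
    obtain ⟨-, h3, h11, -⟩ := hs
    simpa [h3, h] using h11
  · refine ⟨le_rfl, by simp, by simp [inputState], by simp [inputState], by simp, fun x hx => ?_,
      rfl⟩
    simp only [Set.mem_insert_iff, Set.mem_singleton_iff, not_or] at hx
    simp [hx, inputState]
  · rintro t₁ s₁ - ⟨ht₁, -, h3, -, h0, h1, hx, hr⟩
    refine (run_basisCode (by simp [h1]) (by simp) r).imp ?_
    rintro t₂ s₂ - ⟨ht₂, hi, h2, -, ha⟩
    simp only [State.ivar_setIvar, State.ivar_setRvar, if_true, h0, h1] at h2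
    have h4 : s₂.ivar 4 = 0 := by
      rw [hi 4 (by norm_num) (by norm_num)]
      simp [hx 4]
    refine ⟨by unfold setupCost; omega, ⟨?_, ?_, h2, ?_, ?_, ?_, fun h => absurd h4 h⟩, ?_⟩
    · rw [hi 0 (by norm_num) (by norm_num)]; simp [h0]
    · rw [hi 1 (by norm_num) (by norm_num)]; simp [h1]
    · rw [hi 3 (by norm_num) (by norm_num)]; simp [h3]
    · rw [hi 9 (by norm_num) (by norm_num)]; simp [hx 9]
    · funext e i
      rw [State.column, ha, if_pos i.2]
      simp only [State.rarr_setIvar, State.rarr_setRvar, hr, State.ivar_setIvar, if_true,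
        State.ivar_setRvar, h0, h1, Function.update_apply, extColumn]
      by_cases he : e < n
      · have : e ≠ n + 1 + i := by omega
        simp [this, he, inputState]
      · simp [he, inputState]
    · funext l
      have h₁ : 100 + l ≠ 2 := by omega
      have h₂ : 100 + l ≠ 5 := by omega
      rw [State.tuple, hi _ h₁ h₂]
      simp only [State.ivar_setIvar, h₁, if_false, State.ivar_setRvar]
      exact hx _ (by simp; omega)

lemma run_outputCode {feas : Set (Fin n) → Prop} {a : ℕ → Fin r → ℝ} {M N : ℕ} {s : State}
    (hs : Searching f feas a M N s) :
    Run mem f outputCode s fun t s' => t ≤ n * 6 + 5 ∧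
      s'.output n = incidenceVector (s.support n 3) := by
  classical
  simp only [outputCode, run_seq, run_instr, Instr.effect]
  refine (Run.forLoop (T := 3) (fun k s' =>
    ∀ j < k, s'.rarr 0 j = if s.iarr 3 j ≠ 0 then 1 else 0) (by simp [hs.h1])
    (by simp) (by norm_num) (by simp [Prog.writes, Instr.target]) (by simp) ?_).imp ?_
  · intro k s' _ _ hf hk hI
    have e3 : s'.iarr 3 = s.iarr 3 :=
      hf.iarr (by simp [writes_forLoop, Prog.writes, Instr.target])
    have er1 := hf.rvar (u := 1) (by simp [writes_forLoop, Prog.writes, Instr.target])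
    have er2 := hf.rvar (u := 2) (by simp [writes_forLoop, Prog.writes, Instr.target])
    simp at er1 er2
    simp only [run_seq, run_instr, Instr.effect, run_ite, State.ivar_setIvar, if_true, hk, e3]
    by_cases h : s.iarr 3 k = 0
    · simp only [h, if_true]
      refine ⟨le_rfl, fun v j hj => ?_⟩
      rcases Nat.lt_succ_iff_lt_or_eq.1 hj with hj | rfl
      · simpa [hj.ne, hk] using hI j hj
      · simp [h, er2]
    · simp only [h, if_false]
      refine ⟨le_rfl, fun v j hj => ?_⟩
      rcases Nat.lt_succ_iff_lt_or_eq.1 hj with hj | rfl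
      · simpa [hj.ne, hk] using hI j hj
      · simp [h, er1]
  · rintro t s' - ⟨ht, hI⟩
    simp only [State.ivar_setIvar, State.ivar_setRvar, OfNat.zero_ne_ofNat, if_true, if_false,
      hs.h0] at ht hI
    refine ⟨by omega, funext fun j => ?_⟩
    rw [State.output, hI j j.2, incidenceVector, Set.indicator_apply]
    by_cases h : s.iarr 3 j = 0 <;> simp [State.support, h]

/-- The complete program. -/
def solver (ind : Bool) (r : ℕ) : Prog :=
  .seq (setupCode r) (.seq (enumCode r (candidateCode ind r) (2 * r)) outputCode)

/-- A bound for the running time of `solver`. -/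
def solverCost (r n : ℕ) : ℕ :=
  setupCost r n +
    enumCost r n (candidateCost r n (2 ^ Nat.clog 2 n) (Nat.clog 2 n)) (2 * r) + n * 6 + 5

/-- The program outputs a feasible set that is at least as good as a candidate for each
admissible tuple. -/
lemma run_solver (hmem : mem ∅) (ind : Bool) {feas : Set (Fin n) → Prop}
    (A : Matrix (Fin r) (Fin n) ℝ)
    (hfeas : ∀ p σ, IsOrder (extColumn A) p (2 ^ Nat.clog 2 n) σ →
      feas (candidate mem ind (extColumn A) p (2 ^ Nat.clog 2 n) σ)) :
    Run mem f (solver ind r) (inputState A) fun t s' => t ≤ solverCost r n ∧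
      ∃ G, feas G ∧ s'.output n = incidenceVector G ∧
      ∀ q : ℕ → ℕ, (∀ l < 2 * r, tupleStart r n l ≤ q l ∧ q l < n + 1 + r) →
        (∀ l ≥ 2 * r, q l = 0) → ∃ σ, IsOrder (extColumn A) q (2 ^ Nat.clog 2 n) σ ∧
        f (imagePoint (extColumn A) (candidate mem ind (extColumn A) q (2 ^ Nat.clog 2 n) σ)) ≤
          f (imagePoint (extColumn A) G) := by
  simp only [solver, run_seq]
  refine (run_setupCode feas A).imp ?_
  rintro t₁ s₁ - ⟨ht₁, hs₁, htup⟩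
  refine (run_enumCode hmem ind hfeas (2 * r) hs₁).imp ?_
  rintro t₂ s₂ - ⟨ht₂, hs₂, hq, -⟩
  refine (run_outputCode hs₂).imp ?_
  rintro t₃ s₃ - ⟨ht₃, hout⟩
  rw [htup] at hq
  -- the search has found some candidate, since there is an admissible tuple
  have h4 : s₂.ivar 4 ≠ 0 := by
    refine (hq (fun l => if l < 2 * r then n else 0) (fun l hl => ?_) fun l hl => ?_).1
    · rw [if_pos hl]
      unfold tupleStart
      split_ifs <;> omega
    · rw [if_neg (not_lt.2 hl)]
      rfl
  obtain ⟨hG, hval⟩ := hs₂.incumbent h4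
  refine ⟨by unfold solverCost; omega, _, hG, hout, fun q hq₁ hq₂ => ?_⟩
  rw [hval]
  exact (hq q hq₁ hq₂).2

end RealRAM

/-! ### Flags that refine a linear functional -/

section Flag

variable {E : Type*} [AddCommGroup E] [Module ℝ E]

lemma exists_mem_apply_ne_zero {V : Set E} {δ : Module.Dual ℝ E} {w : E}
    (hw : w ∈ Submodule.span ℝ V) (h : δ w ≠ 0) : ∃ v ∈ V, δ v ≠ 0 := by
  by_contra! h'
  have : Submodule.span ℝ V ≤ LinearMap.ker δ := Submodule.span_le.2 h'
  exact h (this hw)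

/-- An extreme ray: unless the finite set `V` spans the zero space, every functional `c` can be
degenerated to a functional `δ` that does not vanish on `V`, is nonnegative where `c` is positive on
`V`, and whose kernel in the span of `V` is spanned by elements of `V`. -/
lemma exists_extreme_functional {V : Set E} (hV : V.Finite) {v₀ : E} (hv₀ : v₀ ∈ V) (h0 : v₀ ≠ 0)
    (c : Module.Dual ℝ E) :
    ∃ δ : Module.Dual ℝ E, (∃ v ∈ V, δ v ≠ 0) ∧ (∀ v ∈ V, 0 < c v → 0 ≤ δ v) ∧
      Submodule.span ℝ (V ∩ {v | δ v = 0}) = Submodule.span ℝ V ⊓ LinearMap.ker δ := by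
  let Δ : Set (Module.Dual ℝ E) := {δ | (∃ v ∈ V, δ v ≠ 0) ∧ ∀ v ∈ V, 0 < c v → 0 ≤ δ v}
  have hΔ : Δ.Nonempty := by
    by_cases hc : ∃ v ∈ V, c v ≠ 0
    · exact ⟨c, hc, fun v _ h => h.le⟩
    · push Not at hc
      obtain ⟨δ, hδ⟩ := Module.Projective.exists_dual_ne_zero ℝ h0
      exact ⟨δ, ⟨v₀, hv₀, hδ⟩, fun v hv h => absurd (hc v hv) h.ne'⟩
  -- among the admissible functionals, one with as many zeros as possible
  obtain ⟨δ, ⟨hδ, hpos⟩, hmax⟩ : ∃ δ ∈ Δ, ∀ δ' ∈ Δ,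
      (V ∩ {v | δ' v = 0}).ncard ≤ (V ∩ {v | δ v = 0}).ncard := by
    let S : Set ℕ := (fun δ : Module.Dual ℝ E => (V ∩ {v | δ v = 0}).ncard) '' Δ
    have hS : BddAbove S := by
      refine ⟨V.ncard, ?_⟩
      rintro _ ⟨δ, -, rfl⟩
      exact Set.ncard_le_ncard Set.inter_subset_left hV
    obtain ⟨δ, hδ, hδ'⟩ := Nat.sSup_mem (hΔ.image _) hS
    refine ⟨δ, hδ, fun δ' h => ?_⟩
    exact (le_csSup hS ⟨δ', h, rfl⟩).trans hδ'.ge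
  refine ⟨δ, hδ, hpos, le_antisymm (Submodule.span_le.2 fun v hv =>
    ⟨Submodule.subset_span hv.1, hv.2⟩) fun w hw => ?_⟩
  by_contra hw'
  -- otherwise `δ` can be moved in a direction `u` that keeps all its zeros, up to a further zero
  obtain ⟨u, huw, hu⟩ := Submodule.exists_le_ker_of_notMem hw'
  have hu' (v : E) (hv : v ∈ V) (h : δ v = 0) : u v = 0 := hu (Submodule.subset_span ⟨hv, h⟩)
  obtain ⟨v, ⟨hv, huv⟩, hmin⟩ : ∃ v ∈ V ∩ {v | u v ≠ 0}, ∀ v' ∈ V ∩ {v | u v ≠ 0},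
      |δ v / u v| ≤ |δ v' / u v'| := by
    refine Set.exists_min_image _ _ (hV.subset Set.inter_subset_left) ?_
    obtain ⟨v, hv, h⟩ := exists_mem_apply_ne_zero hw.1 huw
    exact ⟨v, hv, h⟩
  have huv : u v ≠ 0 := huv
  have hδv : δ v ≠ 0 := fun h => huv (hu' v hv h)
  set t := δ v / u v with ht
  have ht0 : t ≠ 0 := div_ne_zero hδv huv
  have hmem : δ - t • u ∈ Δ := by
    refine ⟨exists_mem_apply_ne_zero hw.1 ?_, fun v' hv' hc => ?_⟩
    · have : δ w = 0 := hw.2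
      simp [this, ht0, huw]
    · have hδ' := hpos v' hv' hc
      by_cases huv' : u v' = 0
      · simpa [huv'] using hδ'
      · have h₁ := hmin v' ⟨hv', huv'⟩
        rw [abs_div (δ v'), le_div_iff₀ (abs_pos.2 huv'), ← abs_mul, abs_of_nonneg hδ'] at h₁
        simpa using (le_abs_self _).trans h₁
  have hlt : (V ∩ {v | δ v = 0}).ncard < (V ∩ {v | (δ - t • u) v = 0}).ncard := by
    refine Set.ncard_lt_ncard ⟨fun v' hv' => ⟨hv'.1, ?_⟩, fun h => hδv ?_⟩
      (hV.subset Set.inter_subset_left)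
    · have : δ v' = 0 := hv'.2
      change δ v' - t * u v' = 0
      rw [this, hu' v' hv'.1 this, mul_zero, sub_zero]
    · refine (h ⟨hv, ?_⟩).2
      change δ v - t * u v = 0
      rw [ht, div_mul_cancel₀ _ huv, sub_self]
  exact absurd (hmax _ hmem) (not_le.2 hlt)

/-- A flag of subspaces spanned by elements of `V`, such that every sequence of functionals adapted
to the flag orders the elements of `V` lexicographically in a way that refines the sign of `c`.  The
element of the flag that comes last may be taken from any other symmetric spanning set `U`. -/
lemma exists_flag [FiniteDimensional ℝ E] (k : ℕ) {V U : Set E} (hV : V.Finite)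
    (hVneg : ∀ v ∈ V, -v ∈ V) (hUneg : ∀ v ∈ U, -v ∈ U)
    (hUV : Submodule.span ℝ U = Submodule.span ℝ V)
    (hk : Module.finrank ℝ (Submodule.span ℝ V) = k) (c : Module.Dual ℝ E) :
    ∃ h : ℕ → E, (∀ j, j + 1 < k → h j ∈ V) ∧ (∀ j, j + 1 = k → h j ∈ U) ∧
      Submodule.span ℝ (h '' Set.Iio k) = Submodule.span ℝ V ∧
      (∀ j < k, h j ∉ Submodule.span ℝ (h '' Set.Iio j)) ∧
      ∀ d : ℕ → Module.Dual ℝ E, (∀ j < k, ∀ i < j, d j (h i) = 0) → (∀ j < k, 0 < d j (h j)) →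
        ∀ v ∈ V, 0 < c v → LexLT k 0 fun j => d j v := by
  induction k generalizing V U with
  | zero =>
    have hbot : Submodule.span ℝ V = ⊥ := Submodule.finrank_eq_zero.1 hk
    refine ⟨0, by omega, by omega, by simp [hbot], by omega, fun d _ _ v hv hc => ?_⟩
    have : v = 0 := by simpa [hbot] using Submodule.subset_span (R := ℝ) hv
    simp [this] at hc
  | succ k ih =>
    obtain ⟨v₀, hv₀, h0⟩ : ∃ v₀ ∈ V, v₀ ≠ 0 := by
      by_contra! h
      have : Submodule.span ℝ V = ⊥ := Submodule.span_eq_bot.2 h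
      rw [this, finrank_bot] at hk
      omega
    obtain ⟨δ, ⟨v₁, hv₁, hδv₁⟩, hpos, hspan⟩ := exists_extreme_functional hV hv₀ h0 c
    set V' := V ∩ {v | δ v = 0} with hV'
    obtain ⟨u, hu, hδu⟩ : ∃ u ∈ U, 0 < δ u := by
      obtain ⟨u, hu, hδu⟩ := exists_mem_apply_ne_zero
        (hUV ▸ Submodule.subset_span hv₁ : v₁ ∈ Submodule.span ℝ U) hδv₁
      rcases lt_or_gt_of_ne hδu with h | h
      · exact ⟨-u, hUneg u hu, by simpa using h⟩
      · exact ⟨u, hu, h⟩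
    have huV : u ∈ Submodule.span ℝ V := hUV ▸ Submodule.subset_span hu
    have hrank : Module.finrank ℝ (Submodule.span ℝ V') = k := by
      have hne : δ.domRestrict (Submodule.span ℝ V) ≠ 0 := fun h =>
        hδv₁ (by simpa using LinearMap.congr_fun h ⟨v₁, Submodule.subset_span hv₁⟩)
      have h₁ := Module.Dual.finrank_ker_add_one_of_ne_zero hne
      have h₂ : LinearMap.ker (δ.domRestrict (Submodule.span ℝ V)) =
          (LinearMap.ker δ).comap (Submodule.span ℝ V).subtype := rfl
      rw [hspan, ← Submodule.map_comap_subtype, Submodule.finrank_map_subtype_eq, ← h₂]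
      omega
    obtain ⟨h, hhV, hhU, hh, hind, hlex⟩ := ih (V := V') (U := V')
      (hV.subset Set.inter_subset_left)
      (fun v hv => ⟨hVneg v hv.1, by have : δ v = 0 := hv.2; simp [this]⟩)
      (fun v hv => ⟨hVneg v hv.1, by have : δ v = 0 := hv.2; simp [this]⟩) rfl hrank
    have hhV' (j : ℕ) (hj : j < k) : h j ∈ V' := by
      rcases (show j + 1 < k ∨ j + 1 = k by omega) with h' | h'
      · exact hhV j h'
      · exact hhU j h'
    set h' := Function.update h k u with hh'
    have hlt (j : ℕ) (hj : j < k) : h' j = h j := Function.update_of_ne hj.ne _ _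
    have hself : h' k = u := Function.update_self _ _ _
    have himage (j : ℕ) (hj : j ≤ k) : h' '' Set.Iio j = h '' Set.Iio j :=
      Set.image_congr fun i (hi : i < j) => hlt i (by omega)
    -- modulo the smaller flag, each element of the span is a multiple of `u`
    have hdecomp (v : E) (hv : v ∈ Submodule.span ℝ V) :
        v - (δ v / δ u) • u ∈ Submodule.span ℝ (h '' Set.Iio k) := by
      rw [hh, hspan]
      refine ⟨sub_mem hv (Submodule.smul_mem _ _ huV), ?_⟩
      simp [hδu.ne']
    refine ⟨h', fun j hj => ?_, fun j hj => ?_, ?_, fun j hj => ?_, fun d hd hd' v hv hc => ?_⟩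
    · rw [hlt j (by omega)]
      exact (hhV' j (by omega)).1
    · obtain rfl : j = k := by omega
      rwa [hself]
    · refine le_antisymm (Submodule.span_le.2 ?_) fun v hv => ?_
      · rintro _ ⟨j, hj, rfl⟩
        rcases Nat.lt_succ_iff_lt_or_eq.1 hj with hj | rfl
        · rw [hlt j hj]
          exact Submodule.subset_span (hhV' j hj).1
        · rwa [hself]
      · have h₁ : Submodule.span ℝ (h '' Set.Iio k) ≤ Submodule.span ℝ (h' '' Set.Iio (k + 1)) := by
          rw [← himage k le_rfl]
          exact Submodule.span_mono (Set.image_mono (Set.Iio_subset_Iio k.le_succ))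
        have h₂ : u ∈ Submodule.span ℝ (h' '' Set.Iio (k + 1)) :=
          Submodule.subset_span ⟨k, by simp, hself⟩
        simpa using add_mem (h₁ (hdecomp v hv)) (Submodule.smul_mem _ (δ v / δ u) h₂)
    · rw [himage j (by omega)]
      rcases Nat.lt_succ_iff_lt_or_eq.1 hj with hj | rfl
      · rw [hlt j hj]
        exact hind j hj
      · rw [hself, hh, hspan]
        exact fun hmem => hδu.ne' hmem.2
    · have hker : Submodule.span ℝ (h '' Set.Iio k) ≤ LinearMap.ker (d k) := by
        refine Submodule.span_le.2 ?_
        rintro _ ⟨j, hj, rfl⟩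
        rw [← hlt j hj]
        exact hd k (by omega) j hj
      have hdk : d k v = δ v / δ u * d k u := by
        have := hker (hdecomp v (Submodule.subset_span hv))
        rw [LinearMap.mem_ker, map_sub, map_smul, smul_eq_mul, sub_eq_zero] at this
        exact this
      have hdu : 0 < d k u := hself ▸ hd' k (by omega)
      rcases (hpos v hv hc).eq_or_lt with hδ | hδ
      · refine Or.inr ⟨by simp [hdk, ← hδ], ?_⟩
        refine hlex d (fun j hj i hi => ?_) (fun j hj => ?_) v ⟨hv, hδ.symm⟩ hc
        · rw [← hlt i (by omega)]
          exact hd j (by omega) i hi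
        · rw [← hlt j hj]
          exact hd' j (by omega)
      · refine Or.inl ?_
        simp only [Pi.zero_apply, hdk]
        positivity

end Flag

/-! ### Every linear functional is refined by the order of some tuple -/

lemma LexLT.of_sub {k : ℕ} {a b : ℕ → ℝ} (h : LexLT k 0 fun j => b j - a j) : LexLT k a b := by
  induction k with
  | zero => exact h
  | succ k ih =>
    rcases h with h | ⟨h, h'⟩
    · exact Or.inl (sub_pos.1 h)
    · exact Or.inr ⟨(sub_eq_zero.1 h.symm).symm, ih h'⟩

namespace RealRAM

variable {n r : ℕ}

/-- The admissible tuples: two indices for each of the `r` differences. -/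
def Admissible (r n : ℕ) (q : ℕ → ℕ) : Prop :=
  (∀ l < 2 * r, tupleStart r n l ≤ q l ∧ q l < n + 1 + r) ∧ ∀ l ≥ 2 * r, q l = 0

lemma extColumn_of_le (A : Matrix (Fin r) (Fin n) ℝ) {e : ℕ} (he : n + 1 + r ≤ e) :
    extColumn A e = 0 := by
  funext i
  have h₁ : ¬ e < n := by omega
  have h₂ : e ≠ n + 1 + i := by omega
  simp [extColumn, h₁, h₂]

lemma extColumn_self (A : Matrix (Fin r) (Fin n) ℝ) : extColumn A n = 0 := by
  funext i
  have h : n ≠ n + 1 + i := by omega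
  simp [extColumn, h]

lemma extColumn_basis (A : Matrix (Fin r) (Fin n) ℝ) (k : Fin r) :
    extColumn A (n + 1 + k) = Pi.single k 1 := by
  funext i
  have h₁ : ¬ n + 1 + (k : ℕ) < n := by omega
  rcases eq_or_ne i k with rfl | hik
  · simp [extColumn, h₁]
  · have : (k : ℕ) ≠ i := fun h => hik (Fin.ext h.symm)
    simp [extColumn, h₁, hik, this]

/-- The set of all differences of columns with indices from `m` on. -/
def diffSet (A : Matrix (Fin r) (Fin n) ℝ) (m : ℕ) : Set (Fin r → ℝ) :=
  (fun x : ℕ × ℕ => extColumn A x.1 - extColumn A x.2) ''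
    (Set.Ico m (n + 1 + r) ×ˢ Set.Ico m (n + 1 + r))

lemma finite_diffSet (A : Matrix (Fin r) (Fin n) ℝ) (m : ℕ) : (diffSet A m).Finite :=
  ((Set.finite_Ico _ _).prod (Set.finite_Ico _ _)).image _

lemma neg_mem_diffSet {A : Matrix (Fin r) (Fin n) ℝ} {m : ℕ} {v : Fin r → ℝ}
    (hv : v ∈ diffSet A m) : -v ∈ diffSet A m := by
  obtain ⟨⟨x, y⟩, ⟨hx, hy⟩, rfl⟩ := hv
  exact ⟨⟨y, x⟩, ⟨hy, hx⟩, (neg_sub _ _).symm⟩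

lemma span_diffSet (A : Matrix (Fin r) (Fin n) ℝ) {m : ℕ} (hm : m ≤ n) :
    Submodule.span ℝ (diffSet A m) = ⊤ := by
  rw [eq_top_iff, ← (Pi.basisFun ℝ (Fin r)).span_eq]
  refine Submodule.span_mono ?_
  rintro _ ⟨k, rfl⟩
  refine ⟨⟨n + 1 + k, n⟩, ⟨⟨by simp; omega, by simp⟩, ⟨hm, by simp; omega⟩⟩, ?_⟩
  simp [extColumn_basis, extColumn_self]

/-- For every linear functional `c`, some admissible tuple orders the columns in a way that refines
the order by the values of `c`. -/
lemma exists_admissible_below (A : Matrix (Fin r) (Fin n) ℝ) (c : Module.Dual ℝ (Fin r → ℝ)) :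
    ∃ q, Admissible r n q ∧
      ∀ e e', c (extColumn A e) < c (extColumn A e') → Below (extColumn A) q e e' := by
  obtain ⟨h, hV, hU, -, hind, hlex⟩ := exists_flag r (V := diffSet A 0) (U := diffSet A n)
    (finite_diffSet A 0) (fun _ => neg_mem_diffSet) (fun _ => neg_mem_diffSet)
    (by rw [span_diffSet A le_rfl, span_diffSet A (Nat.zero_le n)])
    (by rw [span_diffSet A (Nat.zero_le n)]; simp) c
  have hidx (j : ℕ) : ∃ x : ℕ × ℕ, j < r →
      (tupleStart r n (2 * j) ≤ x.1 ∧ x.1 < n + 1 + r) ∧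
      (tupleStart r n (2 * j + 1) ≤ x.2 ∧ x.2 < n + 1 + r) ∧
      extColumn A x.1 - extColumn A x.2 = h j := by
    rcases lt_trichotomy (j + 1) r with hj | hj | hj
    · obtain ⟨x, ⟨⟨h₁, h₂⟩, h₃, h₄⟩, h₅⟩ := hV j hj
      refine ⟨x, fun _ => ⟨⟨?_, h₂⟩, ⟨?_, h₄⟩, h₅⟩⟩ <;>
      · rw [tupleStart, if_pos (by omega)]
        exact Nat.zero_le _
    · obtain ⟨x, ⟨⟨h₁, h₂⟩, h₃, h₄⟩, h₅⟩ := hU j hj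
      refine ⟨x, fun _ => ⟨⟨?_, h₂⟩, ⟨?_, h₄⟩, h₅⟩⟩ <;>
      · rw [tupleStart, if_neg (by omega)]
        assumption
    · exact ⟨(0, 0), fun h => by omega⟩
  choose x hx using hidx
  let q : ℕ → ℕ := fun l =>
    if l < 2 * r then (if l % 2 = 0 then (x (l / 2)).1 else (x (l / 2)).2) else 0
  have hq₁ (j : ℕ) (hj : j < r) : q (2 * j) = (x j).1 := by
    simp [q, hj]
  have hq₂ (j : ℕ) (hj : j < r) : q (2 * j + 1) = (x j).2 := by
    have h₁ : 2 * j + 1 < 2 * r := by omega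
    have h₂ : (2 * j + 1) / 2 = j := by omega
    simp [q, h₁, h₂]
  have hdiff (j : ℕ) (hj : j < r) : diffVec (extColumn A) q j = h j := by
    rw [diffVec, hq₁ j hj, hq₂ j hj]
    exact (hx j hj).2.2
  refine ⟨q, ⟨fun l hl => ?_, fun l hl => if_neg (by omega)⟩, fun e e' hc => ?_⟩
  · rcases Nat.even_or_odd' l with ⟨j, rfl | rfl⟩
    · rw [hq₁ j (by omega)]
      exact (hx j (by omega)).1
    · rw [hq₂ j (by omega)]
      exact (hx j (by omega)).2.1
  · -- columns with large indices vanish, like column `n`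
    have hcol (e : ℕ) : ∃ i ∈ Set.Ico 0 (n + 1 + r), extColumn A i = extColumn A e := by
      by_cases he : e < n + 1 + r
      · exact ⟨e, ⟨Nat.zero_le _, he⟩, rfl⟩
      · exact ⟨n, ⟨Nat.zero_le _, by omega⟩, by rw [extColumn_self, extColumn_of_le A (by omega)]⟩
    obtain ⟨i, hi, hie⟩ := hcol e
    obtain ⟨i', hi', hie'⟩ := hcol e'
    let d : ℕ → Module.Dual ℝ (Fin r → ℝ) := fun j =>
      { toFun := fun v => orthoVec (diffVec (extColumn A) q) j ⬝ᵥ v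
        map_add' := dotProduct_add _
        map_smul' := fun t v => dotProduct_smul t _ v }
    have hd (j : ℕ) (v : Fin r → ℝ) : d j v = orthoVec (diffVec (extColumn A) q) j ⬝ᵥ v := rfl
    refine LexLT.of_sub ?_
    have := hlex d (fun j hj i hi => ?_) (fun j hj => ?_) (extColumn A e' - extColumn A e)
      ⟨(i', i), ⟨hi', hi⟩, by simp only [hie, hie']⟩ (by simpa using hc)
    · simpa [hd, key, dotProduct_sub] using this
    · rw [hd, ← hdiff i (by omega)]
      exact orthoVec_dotProduct_of_lt _ hi
    · rw [hd, ← hdiff j hj]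
      refine orthoVec_dotProduct_self_pos _ ?_
      rw [hdiff j hj, show diffVec (extColumn A) q '' Set.Iio j = h '' Set.Iio j from
        Set.image_congr fun i (hi : i < j) => hdiff i (by omega)]
      exact hind j hj

end RealRAM

/-! ### Optimality of the greedy algorithm -/

section Greedy

/-- Summation by parts: nonincreasing weights and nonnegative partial sums. -/
lemma mul_sum_le_sum_mul_of_partial_sums_nonneg {w z : ℕ → ℝ} (T : ℕ)
    (hw : ∀ t < T, w (t + 1) ≤ w t) (hz : ∀ t ≤ T, 0 ≤ ∑ s ∈ Finset.range t, z s) :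
    w T * ∑ s ∈ Finset.range (T + 1), z s ≤ ∑ s ∈ Finset.range (T + 1), w s * z s := by
  induction T with
  | zero => simp
  | succ T ih =>
    have h₁ := ih (fun t ht => hw t (by omega)) fun t ht => hz t (by omega)
    have h₂ := mul_le_mul_of_nonneg_right (hw T (by omega)) (hz (T + 1) le_rfl)
    rw [Finset.sum_range_succ _ (T + 1), Finset.sum_range_succ _ (T + 1), mul_add]
    linarith

variable {n N : ℕ} {σ : ℕ → ℕ}

lemma bijOn_of_surj (hσ : ∀ e < N, ∃ t < N, σ t = e) :
    Set.InjOn σ (Finset.range N) ∧ (Finset.range N).image σ = Finset.range N := by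
  have hsub : Finset.range N ⊆ (Finset.range N).image σ := fun e he => by
    obtain ⟨t, ht, rfl⟩ := hσ e (Finset.mem_range.1 he)
    exact Finset.mem_image_of_mem _ (Finset.mem_range.2 ht)
  have heq := Finset.eq_of_subset_of_card_le hsub Finset.card_image_le
  exact ⟨Finset.card_image_iff.1 (by rw [← heq]), heq.symm⟩

open Classical in
/-- The incidence function of a subset of `[n]`, on all natural numbers. -/
noncomputable def chi (G : Set (Fin n)) (e : ℕ) : ℝ := if e ∈ Fin.val '' G then 1 else 0

open Classical in
lemma sum_ite_eq_sum_chi (hσ : ∀ e < N, ∃ t < N, σ t = e) (hn : n ≤ N) (w : ℕ → ℝ)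
    (G : Set (Fin n)) :
    ∑ j : Fin n, (if j ∈ G then w j else 0) = ∑ s ∈ Finset.range N, w (σ s) * chi G (σ s) := by
  obtain ⟨hinj, himg⟩ := bijOn_of_surj hσ
  rw [← Finset.sum_image (f := fun e => w e * chi G e) hinj, himg]
  have h₁ (j : Fin n) : (if j ∈ G then w j else 0) = w j * chi G j := by
    have : (j : ℕ) ∈ Fin.val '' G ↔ j ∈ G :=
      ⟨fun ⟨i, hi, hij⟩ => Fin.ext hij ▸ hi, fun h => ⟨j, h, rfl⟩⟩
    simp only [chi, this, mul_ite, mul_one, mul_zero]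
  rw [Finset.sum_congr rfl fun j _ => h₁ j, ← Finset.sum_range fun e => w e * chi G e]
  refine Finset.sum_subset (Finset.range_subset_range.2 hn) fun e _ he => ?_
  have : e ∉ Fin.val '' G := by
    rintro ⟨i, -, rfl⟩
    exact he (Finset.mem_range.2 i.2)
  simp [chi, this]

lemma sum_chi_eq_ncard (hσ : ∀ e < N, ∃ t < N, σ t = e) (G : Set (Fin n)) {t : ℕ} (ht : t ≤ N) :
    ∑ s ∈ Finset.range t, chi G (σ s) = ((G ∩ {i | ∃ s < t, σ s = i}).ncard : ℝ) := by
  classical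
  have hinj := (bijOn_of_surj hσ).1
  simp only [chi, Finset.sum_boole, Nat.cast_inj]
  rw [← Set.ncard_coe_finset, ← Set.ncard_image_of_injective _ Fin.val_injective,
    ← Set.InjOn.ncard_image (f := σ) (hinj.mono fun s hs => ?_)]
  · congr 1
    ext e
    simp only [Finset.coe_filter, Finset.mem_range, Set.mem_image, Set.mem_ofPred_eq,
      Set.mem_inter_iff]
    constructor
    · rintro ⟨s, ⟨hs, i, hi, his⟩, rfl⟩
      exact ⟨i, ⟨hi, s, hs, his.symm⟩, his⟩
    · rintro ⟨i, ⟨hi, s, hs, his⟩, rfl⟩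
      exact ⟨s, ⟨hs, i, hi, his.symm⟩, his⟩
  · simp only [Finset.coe_filter, Finset.mem_range, Set.mem_ofPred_eq] at hs
    simpa using hs.1.trans_le ht

lemma greedySet_mono {mem : Set (Fin n) → Prop} {elig : ℕ → Prop} {s t : ℕ} (h : s ≤ t) :
    greedySet mem elig σ s ⊆ greedySet mem elig σ t := by
  induction t, h using Nat.le_induction with
  | base => exact subset_rfl
  | succ t _ ih => exact ih.trans fun i hi => Or.inl hi

lemma greedySet_subset {mem : Set (Fin n) → Prop} {elig : ℕ → Prop} (t : ℕ) {i : Fin n}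
    (hi : i ∈ greedySet mem elig σ t) : elig i ∧ ∃ s < t, σ s = i := by
  induction t with
  | zero => exact absurd hi (Set.notMem_empty i)
  | succ t ih =>
    rcases hi with hi | ⟨hi, he, -⟩
    · obtain ⟨he, s, hs, h⟩ := ih hi
      exact ⟨he, s, by omega, h⟩
    · exact ⟨he, t, by omega, hi.symm⟩

variable {M : Matroid (Fin n)} {elig : ℕ → Prop}

/-- An eligible element that the greedy algorithm has seen belongs to the greedy set if it can be
added to it. -/
lemma mem_greedySet_of_indep_insert {t : ℕ} {i : Fin n} (he : elig i) (hs : ∃ s < t, σ s = i)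
    (hi : M.Indep (insert i (greedySet M.Indep elig σ t))) : i ∈ greedySet M.Indep elig σ t := by
  obtain ⟨s, hs, hsi⟩ := hs
  refine greedySet_mono (Nat.succ_le_of_lt hs) (Or.inr ⟨hsi.symm, he, hi.subset ?_⟩)
  exact Set.insert_subset_insert (greedySet_mono hs.le)

/-- In each initial segment, no independent set of eligible elements is larger than the greedy
set. -/
lemma ncard_le_ncard_greedySet (hM : M.E = Set.univ) {I : Set (Fin n)} (hI : M.Indep I)
    (hel : ∀ i ∈ I, elig i) {t : ℕ} (ht : t ≤ N) :
    (I ∩ {i | ∃ s < t, σ s = i}).ncard ≤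
      (greedySet M.Indep elig σ N ∩ {i | ∃ s < t, σ s = i}).ncard := by
  set P : Set (Fin n) := {i | ∃ s < t, σ s = i} with hP
  set G := greedySet M.Indep elig σ t with hG
  have hGi : M.Indep G := mem_greedySet M.empty_indep elig σ t
  have hbasis : M.IsBasis G (G ∪ I ∩ P) := by
    refine hGi.isBasis_of_forall_insert Set.subset_union_left ?_
    rintro e ⟨he | he, heG⟩
    · exact absurd he heG
    · refine ⟨fun hind => heG ?_, by simp [hM]⟩
      exact mem_greedySet_of_indep_insert (hel e he.1) he.2 hind
  obtain ⟨J, hJ, hIJ⟩ := (hI.subset Set.inter_subset_left).subset_isBasis_of_subset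
    (Set.subset_union_right : I ∩ P ⊆ G ∪ I ∩ P) (by simp [hM])
  calc (I ∩ P).ncard ≤ J.ncard := Set.ncard_le_ncard hIJ
    _ = G.ncard := by rw [Set.ncard, Set.ncard, hJ.encard_eq_encard hbasis]
    _ ≤ (greedySet M.Indep elig σ N ∩ P).ncard :=
      Set.ncard_le_ncard fun i hi => ⟨greedySet_mono ht hi, (greedySet_subset t hi).2⟩

open Classical in
/-- The greedy set has the largest weight among all independent sets of eligible elements, if the
weights are nonnegative, and among those of its own cardinality in any case. -/
lemma sum_le_sum_greedySet (hM : M.E = Set.univ) (hσ : ∀ e < N, ∃ t < N, σ t = e) (hn : n ≤ N)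
    {w : ℕ → ℝ} (hw : ∀ t t', t < t' → t' < N → w (σ t') ≤ w (σ t)) {I : Set (Fin n)}
    (hI : M.Indep I) (hel : ∀ i ∈ I, elig i)
    (h : (∀ e, 0 ≤ w e) ∨ I.ncard = (greedySet M.Indep elig σ N).ncard) :
    ∑ j : Fin n, (if j ∈ I then w j else 0) ≤
      ∑ j : Fin n, if j ∈ greedySet M.Indep elig σ N then w j else 0 := by
  set G := greedySet M.Indep elig σ N with hG
  rw [sum_ite_eq_sum_chi hσ hn, sum_ite_eq_sum_chi hσ hn, ← sub_nonneg, ← Finset.sum_sub_distrib]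
  simp only [← mul_sub]
  rcases N with _ | T
  · simp
  have hpart (t : ℕ) (ht : t ≤ T + 1) : ∑ s ∈ Finset.range t, (chi G (σ s) - chi I (σ s)) =
      ((G ∩ {i | ∃ s < t, σ s = i}).ncard : ℝ) - (I ∩ {i | ∃ s < t, σ s = i}).ncard := by
    rw [Finset.sum_sub_distrib, sum_chi_eq_ncard hσ G ht, sum_chi_eq_ncard hσ I ht]
  have hpos (t : ℕ) (ht : t ≤ T + 1) :
      0 ≤ ∑ s ∈ Finset.range t, (chi G (σ s) - chi I (σ s)) := by
    rw [hpart t ht, sub_nonneg, Nat.cast_le]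
    exact ncard_le_ncard_greedySet hM hI hel ht
  refine le_trans ?_ (mul_sum_le_sum_mul_of_partial_sums_nonneg (w := fun s => w (σ s)) T
    (fun t ht => hw t (t + 1) (by omega) (by omega)) fun t ht => hpos t (by omega))
  rcases h with h | h
  · exact mul_nonneg (h _) (hpos _ le_rfl)
  · have hall : ({i | ∃ s < T + 1, σ s = i} : Set (Fin n)) = Set.univ :=
      Set.eq_univ_of_forall fun i => hσ i (by omega)
    rw [hpart _ le_rfl, hall, Set.inter_univ, Set.inter_univ, h, sub_self, mul_zero]

lemma isBase_greedySet (hM : M.E = Set.univ) (hσ : ∀ e < N, ∃ t < N, σ t = e) (hn : n ≤ N)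
    (hel : ∀ i : Fin n, elig i) : M.IsBase (greedySet M.Indep elig σ N) := by
  rw [← M.isBasis_ground_iff]
  refine Matroid.Indep.isBasis_of_forall_insert (mem_greedySet M.empty_indep elig σ N)
    (by simp [hM]) ?_
  rintro e ⟨-, he⟩
  refine ⟨fun hind => he ?_, by simp [hM]⟩
  exact mem_greedySet_of_indep_insert (hel e) (hσ e (by omega)) hind

end Greedy

namespace RealRAM

variable {n r : ℕ}

/-! ### Optimality of the best candidate -/

lemma mulVec_incidenceVector (A : Matrix (Fin r) (Fin n) ℝ) (G : Set (Fin n)) :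
    A.mulVec (incidenceVector G) = imagePoint (extColumn A) G := by
  classical
  funext i
  simp only [Matrix.mulVec, dotProduct, imagePoint, incidenceVector, Set.indicator_apply]
  refine Finset.sum_congr rfl fun j _ => ?_
  by_cases h : j ∈ G <;> simp [h, extColumn]

open Classical in
lemma apply_imagePoint (a : ℕ → Fin r → ℝ) (c : Module.Dual ℝ (Fin r → ℝ)) (G : Set (Fin n)) :
    c (imagePoint a G) = ∑ j : Fin n, if j ∈ G then c (a j) else 0 := by
  have : imagePoint a G = ∑ j : Fin n, if j ∈ G then a j else 0 := by
    funext i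
    rw [imagePoint, Finset.sum_apply]
    refine Finset.sum_congr rfl fun j _ => ?_
    split_ifs <;> rfl
  rw [this, map_sum]
  refine Finset.sum_congr rfl fun j _ => ?_
  split_ifs <;> simp

/-- The feasible sets: independent sets if `ind = true`, bases otherwise. -/
def Feasible (ind : Bool) (M : Matroid (Fin n)) (G : Set (Fin n)) : Prop :=
  if ind then M.Indep G else M.IsBase G

lemma feasible_candidate {ind : Bool} {M : Matroid (Fin n)} (hM : M.E = Set.univ)
    {a : ℕ → Fin r → ℝ} {p σ : ℕ → ℕ} {N : ℕ} (hn : n ≤ N) (h : IsOrder a p N σ) :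
    Feasible ind M (candidate M.Indep ind a p N σ) := by
  cases ind
  · exact isBase_greedySet hM h.surj hn fun i => by simp [Elig]
  · exact mem_greedySet M.empty_indep _ _ _

/-- If the order of the tuple `p` refines a linear functional, then the candidate for `p` maximizes
this functional over all feasible sets. -/
lemma apply_imagePoint_le_candidate {ind : Bool} {M : Matroid (Fin n)} (hM : M.E = Set.univ)
    (A : Matrix (Fin r) (Fin n) ℝ) {p σ : ℕ → ℕ} {N : ℕ} (hn : n ≤ N)
    (h : IsOrder (extColumn A) p N σ) {c : Module.Dual ℝ (Fin r → ℝ)}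
    (hc : ∀ e e', c (extColumn A e) < c (extColumn A e') → Below (extColumn A) p e e')
    {I : Set (Fin n)} (hI : Feasible ind M I) :
    c (imagePoint (extColumn A) I) ≤
      c (imagePoint (extColumn A) (candidate M.Indep ind (extColumn A) p N σ)) := by
  classical
  rw [apply_imagePoint, apply_imagePoint]
  have hw (t t' : ℕ) (htt' : t < t') (ht' : t' < N) :
      c (extColumn A (σ t')) ≤ c (extColumn A (σ t)) :=
    not_lt.1 fun hlt => h.sorted t t' htt' ht' (hc _ _ hlt)
  cases ind
  · have hI : M.IsBase I := hI
    have helig (i : Fin n) : Elig false n (extColumn A) p i := by simp [Elig]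
    refine sum_le_sum_greedySet hM h.surj hn (w := fun e => c (extColumn A e)) hw hI.indep
      (fun i _ => helig i) (Or.inr ?_)
    exact hI.ncard_eq_ncard_of_isBase (isBase_greedySet hM h.surj hn helig)
  · have hI : M.Indep I := hI
    -- negative weights are cut off, and with them the elements that are not eligible
    set G := candidate M.Indep true (extColumn A) p N σ with hG
    have hzero : c (extColumn A n) = 0 := by rw [extColumn_self, map_zero]
    have helig (e : ℕ) (he : Elig true n (extColumn A) p e) : 0 ≤ c (extColumn A e) := by
      rw [← hzero]
      exact not_lt.1 fun hlt => LexLT.asymm (he rfl) (hc _ _ hlt)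
    have hnot (e : ℕ) (he : ¬ Elig true n (extColumn A) p e) : c (extColumn A e) ≤ 0 := by
      rw [← hzero]
      exact not_lt.1 fun hlt => he fun _ => hc _ _ hlt
    have key := sum_le_sum_greedySet hM h.surj hn (elig := Elig true n (extColumn A) p)
      (w := fun e => max (c (extColumn A e)) 0)
      (fun t t' htt' ht' => max_le_max_right 0 (hw t t' htt' ht'))
      (I := I ∩ {i | Elig true n (extColumn A) p i}) (hI.subset Set.inter_subset_left)
      (fun i hi => hi.2) (Or.inl fun e => le_max_right _ _)
    refine le_trans (Finset.sum_le_sum fun j _ => ?_) (key.trans (Finset.sum_le_sum fun j _ => ?_))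
    · by_cases hj : Elig true n (extColumn A) p j
      · by_cases hjI : j ∈ I <;> simp [hj, hjI]
      · by_cases hjI : j ∈ I
        · simpa [hj, hjI] using hnot j hj
        · simp [hjI]
    · by_cases hj : j ∈ greedySet M.Indep (Elig true n (extColumn A) p) σ N
      · have hjG : j ∈ G := hj
        rw [if_pos hj, if_pos hjG, max_eq_left (helig j (greedySet_subset N hj).1)]
      · have hjG : j ∉ G := hj
        rw [if_neg hj, if_neg hjG]

/-- A value that bounds a convex function at one candidate for each admissible tuple bounds it at
all feasible points: a feasible point outside the convex hull of these candidates could be separated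
from them by a linear functional, contradicting the optimality of the candidate whose tuple refines
this functional. -/
lemma le_of_forall_candidate_le {ind : Bool} {M : Matroid (Fin n)} (hM : M.E = Set.univ)
    (A : Matrix (Fin r) (Fin n) ℝ) {f : (Fin r → ℝ) → ℝ} (hf : ConvexOn ℝ Set.univ f) {N : ℕ}
    (hn : n ≤ N) {b : ℝ}
    (hb : ∀ q, Admissible r n q → ∃ σ, IsOrder (extColumn A) q N σ ∧
      f (imagePoint (extColumn A) (candidate M.Indep ind (extColumn A) q N σ)) ≤ b)
    {I : Set (Fin n)} (hI : Feasible ind M I) : f (imagePoint (extColumn A) I) ≤ b := by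
  let K : Set (Fin r → ℝ) := imagePoint (extColumn A) '' {G : Set (Fin n) |
    ∃ q σ, IsOrder (extColumn A) q N σ ∧ G = candidate M.Indep ind (extColumn A) q N σ ∧
      f (imagePoint (extColumn A) G) ≤ b}
  have hK : K.Finite := (Set.toFinite _).image _
  have hmem : imagePoint (extColumn A) I ∈ convexHull ℝ K := by
    by_contra hnot
    obtain ⟨c, u, hcK, hcI⟩ := geometric_hahn_banach_closed_point (convex_convexHull ℝ K)
      (hK.isClosed_convexHull ℝ) hnot
    obtain ⟨q, hq, hqc⟩ := exists_admissible_below A (c : Module.Dual ℝ (Fin r → ℝ))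
    obtain ⟨σ, hσ, hσb⟩ := hb q hq
    have h₁ := hcK _ (subset_convexHull ℝ K ⟨_, ⟨q, σ, hσ, rfl, hσb⟩, rfl⟩)
    have h₂ : c (imagePoint (extColumn A) I) ≤ _ := apply_imagePoint_le_candidate hM A hn hσ hqc hI
    exact absurd (h₂.trans_lt (h₁.trans hcI)) (lt_irrefl _)
  obtain ⟨_, ⟨G, ⟨-, -, -, -, hG⟩, rfl⟩, hle⟩ :=
    hf.exists_ge_of_mem_convexHull (Set.subset_univ K) hmem
  exact hle.trans hG

/-! ### The running time -/

lemma isBigO_const_mul_log (c : ℝ) :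
    (fun _ : ℕ => c) =O[atTop] fun n : ℕ => (n : ℝ) * Real.log n := by
  have h : Tendsto (fun n : ℕ => (n : ℝ) * Real.log n) atTop atTop :=
    tendsto_natCast_atTop_atTop.atTop_mul_atTop₀
      (Real.tendsto_log_atTop.comp tendsto_natCast_atTop_atTop)
  exact (isLittleO_const_left.2 (Or.inr (tendsto_norm_atTop_atTop.comp h))).isBigO

lemma isBigO_one_log : (fun _ : ℕ => (1 : ℝ)) =O[atTop] fun n : ℕ => Real.log n :=
  (isLittleO_const_left.2 (Or.inr (tendsto_norm_atTop_atTop.comp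
    (Real.tendsto_log_atTop.comp tendsto_natCast_atTop_atTop)))).isBigO

lemma isBigO_id_mul_log :
    (fun n : ℕ => (n : ℝ)) =O[atTop] fun n : ℕ => (n : ℝ) * Real.log n := by
  simpa using (isBigO_refl (fun n : ℕ => (n : ℝ)) atTop).mul isBigO_one_log

lemma two_pow_clog_le {n : ℕ} (hn : 2 ≤ n) : 2 ^ Nat.clog 2 n ≤ 2 * n := by
  have h₁ := Nat.pow_pred_clog_lt_self (b := 2) (by norm_num) (x := n) (by omega)
  have h₂ : 0 < Nat.clog 2 n := Nat.clog_pos (by norm_num) hn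
  obtain ⟨k, hk⟩ := Nat.exists_eq_succ_of_ne_zero h₂.ne'
  rw [hk] at h₁ ⊢
  simp only [Nat.pred_succ, Nat.succ_eq_add_one] at h₁ ⊢
  rw [pow_succ]
  omega

lemma isBigO_two_pow_clog :
    (fun n : ℕ => ((2 ^ Nat.clog 2 n : ℕ) : ℝ)) =O[atTop] fun n : ℕ => (n : ℝ) := by
  refine IsBigO.of_bound 2 (eventually_atTop.2 ⟨2, fun n hn => ?_⟩)
  rw [Real.norm_natCast, Real.norm_natCast]
  exact_mod_cast two_pow_clog_le hn

lemma isBigO_clog : (fun n : ℕ => (Nat.clog 2 n : ℝ)) =O[atTop] fun n : ℕ => Real.log n := by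
  refine IsBigO.of_bound (2 / Real.log 2) (eventually_atTop.2 ⟨2, fun n hn => ?_⟩)
  have hn' : (2 : ℝ) ≤ n := by exact_mod_cast hn
  have hlog2 : 0 < Real.log 2 := Real.log_pos (by norm_num)
  have hlog : Real.log 2 ≤ Real.log n := Real.log_le_log (by norm_num) hn'
  rw [Real.norm_natCast, Real.norm_of_nonneg (hlog2.le.trans hlog), div_mul_eq_mul_div,
    le_div_iff₀ hlog2]
  have h : (2 : ℝ) ^ Nat.clog 2 n ≤ 2 * n := by exact_mod_cast two_pow_clog_le hn
  have h' := Real.log_le_log (by positivity) h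
  rw [Real.log_pow, Real.log_mul (by norm_num) (by positivity)] at h'
  linarith

lemma isBigO_one_pow (k : ℕ) : (fun _ : ℕ => (1 : ℝ)) =O[atTop] fun n : ℕ => (n : ℝ) ^ k := by
  refine IsBigO.of_bound 1 (eventually_atTop.2 ⟨1, fun n hn => ?_⟩)
  have hn' : (1 : ℝ) ≤ n := by exact_mod_cast hn
  rw [norm_one, one_mul, Real.norm_of_nonneg (by positivity)]
  exact one_le_pow₀ hn'

lemma isBigO_clog_mul_log :
    (fun n : ℕ => (Nat.clog 2 n : ℝ)) =O[atTop] fun n : ℕ => (n : ℝ) * Real.log n := by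
  refine isBigO_clog.trans ?_
  simpa using (isBigO_one_pow 1).mul (isBigO_refl (fun n : ℕ => Real.log n) atTop)

lemma isBigO_candidateCost (r : ℕ) :
    (fun n : ℕ => (candidateCost r n (2 ^ Nat.clog 2 n) (Nat.clog 2 n) : ℝ)) =O[atTop]
      fun n : ℕ => (n : ℝ) * Real.log n := by
  have h₁ := isBigO_const_mul_log
  have hn := isBigO_id_mul_log
  have hN : (fun n : ℕ => ((2 ^ Nat.clog 2 n : ℕ) : ℝ)) =O[atTop]
      fun n : ℕ => (n : ℝ) * Real.log n := isBigO_two_pow_clog.trans hn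
  have hK := isBigO_clog_mul_log
  have hKN : (fun n : ℕ => (Nat.clog 2 n : ℝ) * ((2 ^ Nat.clog 2 n : ℕ) : ℝ)) =O[atTop]
      fun n : ℕ => (n : ℝ) * Real.log n := by
    simpa [mul_comm] using isBigO_clog.mul isBigO_two_pow_clog
  have hsum := ((((hN.const_mul_left 4).add (hKN.const_mul_left (mergeStepCost r + 8))).add
    (hK.const_mul_left 10)).add ((hN.const_mul_left (greedyStepCost r + 3)).add
    (hn.const_mul_left (9 + 7 * r)))).add (h₁ (24 + 6 * r))
  refine hsum.congr_left fun n => ?_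
  simp only [candidateCost, sortCost, greedyCost]
  push_cast
  ring

lemma isBigO_enumCost (r : ℕ) {T : ℕ → ℕ}
    (hT : (fun n => (T n : ℝ)) =O[atTop] fun n : ℕ => (n : ℝ) * Real.log n) (l : ℕ) :
    (fun n => (enumCost r n (T n) l : ℝ)) =O[atTop]
      fun n : ℕ => (n : ℝ) ^ min l (2 * r - 2) * ((n : ℝ) * Real.log n) := by
  have hconst (k : ℕ) (c : ℝ) : (fun _ : ℕ => c) =O[atTop]
      fun n : ℕ => (n : ℝ) ^ k * ((n : ℝ) * Real.log n) := by
    simpa using (isBigO_one_pow k).mul (isBigO_const_mul_log c)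
  induction l with
  | zero => simpa [enumCost] using hT
  | succ l ih =>
    simp only [enumCost, Nat.cast_add, Nat.cast_mul]
    refine IsBigO.add ?_ (hconst _ _)
    have ih' := ih.add (hconst (min l (2 * r - 2)) ((3 : ℕ) : ℝ))
    by_cases hl : l < 2 * r - 2
    · have hlen : (fun n : ℕ => ((n + 1 + r - tupleStart r n l : ℕ) : ℝ)) =O[atTop]
          fun n : ℕ => (n : ℝ) := by
        have h := (isBigO_refl (fun n : ℕ => (n : ℝ)) atTop).add
          (((isBigO_one_pow 1).const_mul_left (1 + r : ℝ)).congr_right fun n => pow_one _)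
        refine h.congr_left fun n => ?_
        simp only [tupleStart, if_pos hl, Nat.sub_zero]
        push_cast
        ring
      refine (hlen.mul ih').congr_right fun n => ?_
      rw [min_eq_left (by omega : l + 1 ≤ 2 * r - 2), min_eq_left hl.le, pow_succ]
      ring
    · have hlen : (fun n : ℕ => ((n + 1 + r - tupleStart r n l : ℕ) : ℝ)) =O[atTop]
          fun _ : ℕ => (1 : ℝ) := by
        refine (isBigO_const_const (1 + r : ℝ) one_ne_zero atTop).congr_left fun n => ?_
        rw [tupleStart, if_neg hl, show n + 1 + r - n = 1 + r by omega]
        push_cast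
        ring
      refine (hlen.mul ih').congr_right fun n => ?_
      rw [min_eq_right (by omega), min_eq_right (by omega), one_mul]

lemma isBigO_solverCost {r : ℕ} (hr : 1 ≤ r) :
    (fun n => (solverCost r n : ℝ)) =O[atTop]
      fun n : ℕ => (n : ℝ) ^ (2 * r - 1) * Real.log n := by
  have hpow (n : ℕ) : (n : ℝ) ^ (2 * r - 2) * ((n : ℝ) * Real.log n) =
      (n : ℝ) ^ (2 * r - 1) * Real.log n := by
    rw [← mul_assoc, ← pow_succ, show 2 * r - 2 + 1 = 2 * r - 1 by omega]
  have henum := isBigO_enumCost r (isBigO_candidateCost r) (2 * r)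
  rw [min_eq_right (by omega)] at henum
  -- the remaining terms are smaller than the time of a single candidate
  have hrest : (fun n : ℕ => ((setupCost r n + n * 6 + 5 : ℕ) : ℝ)) =O[atTop]
      fun n : ℕ => (n : ℝ) ^ (2 * r - 2) * ((n : ℝ) * Real.log n) := by
    have h : (fun n : ℕ => ((setupCost r n + n * 6 + 5 : ℕ) : ℝ)) =O[atTop]
        fun n : ℕ => (n : ℝ) * Real.log n := by
      refine (((isBigO_clog_mul_log.const_mul_left 3).add
        (isBigO_id_mul_log.const_mul_left 6)).add
        (isBigO_const_mul_log (r * 2 + 12))).congr_left fun n => ?_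
      simp only [setupCost]
      push_cast
      ring
    simpa using (isBigO_one_pow (2 * r - 2)).mul h
  refine ((henum.add hrest).congr_left fun n => ?_).congr_right hpow
  simp only [solverCost]
  push_cast
  ring

end RealRAM

open RealRAM in
/-- The solver is correct and fast, for independent sets as well as for bases. -/
lemma convexMaxSolvableInTime_of_feasible {r : ℕ} (hr : 1 ≤ r) (ind : Bool)
    {feasible : (n : ℕ) → Matroid (Fin n) → Set (Fin n → ℝ)}
    (hfeas : ∀ n M, feasible n M = {x | ∃ G, Feasible ind M G ∧ x = incidenceVector G}) :
    ConvexMaxSolvableInTime r feasible fun n : ℕ => (n : ℝ) ^ (2 * r - 1) * Real.log n := by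
  refine ⟨solver ind r, solverCost r, isBigO_solverCost hr, fun n M hM A _ f hf => ?_⟩
  have hn : n ≤ 2 ^ Nat.clog 2 n := Nat.le_pow_clog (by norm_num) n
  obtain ⟨t, s, hexec, ht, G, hG, hout, hbest⟩ := run_solver (f := f) M.empty_indep ind A
    fun p σ h => feasible_candidate (ind := ind) hM hn h
  refine ⟨t, s, hexec, ht, ?_, ?_⟩
  · rw [hfeas, hout]
    exact ⟨G, hG, rfl⟩
  · rw [hfeas, hout]
    rintro _ ⟨I, hI, rfl⟩
    rw [mulVec_incidenceVector, mulVec_incidenceVector]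
    exact le_of_forall_candidate_le hM A hf hn (fun q hq => hbest q hq.1 hq.2) hI

theorem corollary1 (r : ℕ) (hr : 1 ≤ r) :
    ConvexMaxSolvableInTime r matroidVectors
      (fun n : ℕ => (n : ℝ) ^ (2 * r - 1) * Real.log n) ∧
    ConvexMaxSolvableInTime r baseVectors
      (fun n : ℕ => (n : ℝ) ^ (2 * r - 1) * Real.log n) :=
  ⟨convexMaxSolvableInTime_of_feasible hr true fun _ _ => rfl,
    convexMaxSolvableInTime_of_feasible hr false fun _ _ => rfl⟩
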